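/- **Conventions.** $G$ is a countable group. A $G$-system $(G,X,\mu)$ is a probability space $(X,\mu)$ with an action of $G$ by measurable, $\mu$-preserving transformations. Partitions are ordered, measurable and at most countable (empty atoms are allowed), and $H(\alpha)=-\sum_{A\in\alpha}\mu(A)\log\mu(A)$. We write $\alpha\ge\beta$ if every atom of $\alpha$ is contained, up to a null set, in an atom of $\beta$. A *sofic approximation* to $G$ is a sequence $\Sigma=(\sigma_i)_{i\ge1}$ of maps $\sigma_i:G\to\mathrm{Sym}(m_i)$ with $m_i\ge1$ and $m_i\to\infty$, for which there are sets $F_1\subset F_2\subset\cdots$ with $\bigcup_iF_i=G$ and reals $\epsilon_i\to0$ such that, for every $i$, at least $(1-\epsilon_i)m_i$ points $v\in\{1,\dots,m_i\}$ satisfy, for all $f,f'\in F_i$, $\sigma_i(f)\sigma_i(f')v=\sigma_i(ff')v$, and $\sigma_i(f)v\ne\sigma_i(f')v$ if $f\neq f'$. *Entropy.* Let $F\subset G$ be finite and $\sigma:G\to\mathrm{Sym}(m)$. For a finite partition $\alpha=(A_1,\dots,A_u)$ of $X$ and $\epsilon>0$, let $\mathcal{AP}(\sigma,\alpha:F,\epsilon)$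 be the set of ordered partitions $\bar\alpha=(\bar A_1,\dots,\bar A_u)$ of $\{1,\dots,m\}$ (empty atoms allowed) with $$\sum_{\phi:F\to\{1,\dots,u\}}\Big|\mu\Big(\bigcap_{f\in F}fA_{\phi(f)}\Big)-\frac1m\Big|\bigcap_{f\in F}\sigma(f)\bar A_{\phi(f)}\Big|\Big|\le\epsilon .$$ With $\log 0=-\infty$, put $$H(\Sigma,\alpha:F)=\lim_{\epsilon\to0}\ \limsup_{i\to\infty}\frac1{m_i}\log|\mathcal{AP}(\sigma_i,\alpha:F,\epsilon)| .$$ For a countable partition $\alpha$, let $H(\Sigma,\alpha:F)$ be the infimum of $\lim_nH(\Sigma,\alpha_n:F)$ over all chains of $\alpha$ for which this limit exists, where a chain of $\alpha$ is a sequence of finite partitions $\alpha_1\le\alpha_2\le\cdots\le\alpha$ with $\bigvee_n\alpha_n=\alpha$ up to null sets. Put $h(\Sigma,\alpha)=\inf_FH(\Sigma,\alpha:F)$, the infimum being over the finite sets $F\subset G$. The partition $\alpha$ is generating if every measurable set agrees up to a null set with a member of the smallest $G$-invariant $\sigma$-algebra containing the atoms of $\alpha$. The statement that $h(\Sigma,G,X,\mu)$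 is defined and equals $c\in[-\infty,\infty]$ means that $X$ has a generating partition of finite entropy and that $h(\Sigma,\alpha)=c$ for every such partition $\alpha$. *Bernoulli shifts.* For a standard Borel probability space $(K,\kappa)$, let $H(\kappa)=-\sum_{k\in K}\kappa(\{k\})\log\kappa(\{k\})$ if $\kappa$ is concentrated on a countable set, and $H(\kappa)=\infty$ otherwise. $G$ acts on $(K^G,\kappa^G)$ by $(gx)(f)=x(g^{-1}f)$. The canonical partition is $\beta=\{B_k\}_{k\in K}$ with $B_k=\{x\in K^G: x(e)=k\}$. The group $G$ acts diagonally on products, and $\alpha\times\beta=\{A\times B: A\in\alpha,\ B\in\beta\}$. **Theorem.** Let $\Sigma$ be a sofic approximation to the countable group $G$. 1. Let $K$ be a finite or countably infinite set, $\kappa$ a probability measure on $K$ with $H(\kappa)<\infty$, and $\beta$ the canonical partition of $K^G$. Let $(G,X,\mu)$ be any $G$-system. (a) For every partition $\alpha$ of $X$ with $H(\alpha)<\infty$ and every non-empty finite $F\subset G$, $$H(\Sigma,\alpha\times\beta:F)=H(\Sigma,\alpha:F)+H(\kappa).$$ If $\alpha$ and $K$ are finite, this holds with both readings of $H(\Sigma,\cdot:F)$,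 the direct one for finite partitions and the one through chains. (b) If $(G,X,\mu)$ has a generating partition of finite entropy, then $h(\Sigma,G,X,\mu)$ and $h(\Sigma,G,X\times K^G,\mu\times\kappa^G)$ are defined and $$h(\Sigma,G,X\times K^G,\mu\times\kappa^G)=h(\Sigma,G,X,\mu)+H(\kappa).$$ 2. For every standard Borel probability space $(K,\kappa)$ with $H(\kappa)<\infty$, $h(\Sigma,G,K^G,\kappa^G)$ is defined and equals $H(\kappa)$. -/

import Mathlib

open MeasureTheory Filter Topology
open scoped ENNReal Pointwise

noncomputable section

namespace SoficEntropy

/-! ### Sofic approximations -/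

/-- For a map `σ : G → Sym(m)` and `F ⊆ G`, the set `V(F)` of points `v` at which `σ` behaves like
a free action of `G` as far as `F` can see. -/
def goodSet {G : Type*} [Group G] {m : ℕ} (σ : G → Equiv.Perm (Fin m)) (F : Set G) :
    Set (Fin m) :=
  {v | ∀ f₁ ∈ F, ∀ f₂ ∈ F,
    σ f₁ (σ f₂ v) = σ (f₁ * f₂) v ∧ (f₁ ≠ f₂ → σ f₁ v ≠ σ f₂ v)}

/-- `σ` is an `(F, ε)`-approximation to `G`: `|V(F)| ≥ (1 - ε) m`. -/
def IsApproximation {G : Type*} [Group G] {m : ℕ} (σ : G → Equiv.Perm (Fin m)) (F : Set G)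
    (ε : ℝ) : Prop :=
  (1 - ε) * (m : ℝ) ≤ ((goodSet σ F).ncard : ℝ)

/-- A map sequence for `G`: arbitrary maps `σ i : G → Sym(m i)` (not assumed to be homomorphisms)
with `m i ≥ 1` and `m i → ∞`. -/
structure MapSequence (G : Type*) where
  m : ℕ → ℕ
  one_le_m : ∀ i, 1 ≤ m i
  tendsto_m : Tendsto m atTop atTop
  σ : ∀ i, G → Equiv.Perm (Fin (m i))

/-- A map sequence is a sofic approximation to `G` if `σ i` is an `(F i, ε i)`-approximation, where
the `F i` increase to `G` and `ε i → 0`. -/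
def MapSequence.IsSofic {G : Type*} [Group G] (S : MapSequence G) : Prop :=
  ∃ (F : ℕ → Set G) (ε : ℕ → ℝ),
    (∀ i, F i ⊆ F (i + 1)) ∧ (⋃ i, F i) = Set.univ ∧ Tendsto ε atTop (𝓝 0) ∧
      ∀ i, IsApproximation (S.σ i) (F i) (ε i)

/-! ### Partitions

An ordered partition of `X` with labels in `ι` is given by its label function `α : X → ι`; its atoms
are the sets `α ⁻¹' {i}`, some of which may be empty. -/

/-- All atoms of `α` are measurable. -/
def IsMeasurablePartition {X ι : Type*} [MeasurableSpace X] (α : X → ι) : Prop :=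
  ∀ i, MeasurableSet (α ⁻¹' {i})

/-- The Shannon entropy `H(α) = -∑ μ(A) log μ(A)`, with values in `[0, ∞]`. -/
def partitionEntropy {X ι : Type*} [MeasurableSpace X] (μ : Measure X) (α : X → ι) : ℝ≥0∞ :=
  ∑' i, ENNReal.ofReal (Real.negMulLog (μ.real (α ⁻¹' {i})))

/-- `α` refines `β`: every atom of `α` lies in an atom of `β` up to a null set. -/
def Refines {X ι κ : Type*} [MeasurableSpace X] (μ : Measure X) (α : X → ι) (β : X → κ) : Prop :=
  ∀ i, ∃ j, μ (α ⁻¹' {i} \ β ⁻¹' {j}) = 0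

/-- A chain of `α`: finite partitions `α₀ ≤ α₁ ≤ ⋯ ≤ α` whose join is `α`. The join of all `αₙ` is
the partition with label function `x ↦ (αₙ x)ₙ`; it is coarser than `α` because every `αₙ` is, so
the join equals `α` up to null sets iff it refines `α`. -/
structure IsChain {X ι : Type*} [MeasurableSpace X] (μ : Measure X) (α : X → ι) (u : ℕ → ℕ)
    (a : ∀ n, X → Fin (u n)) : Prop where
  measurable : ∀ n, IsMeasurablePartition (a n)
  mono : ∀ n, Refines μ (a (n + 1)) (a n)
  le : ∀ n, Refines μ α (a n)
  join : Refines μ (fun (x : X) (n : ℕ) => a n x) α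

/-- `α` is generating: every measurable set agrees up to a null set with a member of the smallest
`G`-invariant σ-algebra containing the atoms of `α`, that is, of the σ-algebra generated by the
translates of the atoms. -/
def IsGenerating (G : Type*) {X ι : Type*} [Group G] [MulAction G X] [MeasurableSpace X]
    (μ : Measure X) (α : X → ι) : Prop :=
  ∀ A : Set X, MeasurableSet A → ∃ A' : Set X,
    MeasurableSet[MeasurableSpace.generateFrom
      {s : Set X | ∃ (g : G) (i : ι), s = g • (α ⁻¹' {i})}] A' ∧ μ (symmDiff A A') = 0

/-! ### Entropy with respect to a map sequence -/

section

variable {G X ι : Type*} [Group G] [MulAction G X] [MeasurableSpace X]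

/-- `d_F(α, β) = ∑_{φ : F → ι} |μ(A_φ) - ζ(B_φ)|` for a partition `α` of `X` and a partition `β` of
`{1, …, m}`, where `A_φ = ⋂ f A_{φ(f)}`, `B_φ = ⋂ σ(f) B_{φ(f)}` and `ζ` is uniform. -/
def partDist (μ : Measure X) {m : ℕ} (σ : G → Equiv.Perm (Fin m)) (F : Finset G)
    (α : X → ι) (β : Fin m → ι) : ℝ :=
  ∑' φ : F → ι,
    |μ.real (⋂ f : F, (f : G) • (α ⁻¹' {φ f})) -
      ((⋂ f : F, σ (f : G) '' (β ⁻¹' {φ f})).ncard : ℝ) / (m : ℝ)|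

/-- The set `AP(σ, α : F, ε)` of approximating partitions. -/
def approxPartitions (μ : Measure X) {m : ℕ} (σ : G → Equiv.Perm (Fin m)) (F : Finset G)
    (α : X → ι) (ε : ℝ) : Set (Fin m → ι) :=
  {β | partDist μ σ F α β ≤ ε}

/-- `H(Σ, α : F, ε) = limsup (1 / mᵢ) log |AP(σᵢ, α : F, ε)|` for a finite partition `α`, with
`log 0 = -∞`. -/
def finEntropyEps (S : MapSequence G) (μ : Measure X) (α : X → ι) (F : Finset G) (ε : ℝ) : EReal :=
  limsup (fun i =>
    ENNReal.log ((approxPartitions μ (S.σ i) F α ε).encard : ℝ≥0∞) / ((S.m i : ℝ) : EReal)) atTop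

/-- `H(Σ, α : F)` for a finite partition `α`; the limit as `ε → 0` is the infimum over `ε > 0`
because `H(Σ, α : F, ε)` is monotone in `ε`. -/
def finEntropyAt (S : MapSequence G) (μ : Measure X) (α : X → ι) (F : Finset G) : EReal :=
  ⨅ (ε : ℝ) (_ : 0 < ε), finEntropyEps S μ α F ε

/-- `H(Σ, α : F)` for a countable partition `α`: the infimum of `lim H(Σ, αₙ : F)` over the chains
`(αₙ)` of `α`. -/
def entropyAt (S : MapSequence G) (μ : Measure X) (α : X → ι) (F : Finset G) : EReal :=
  sInf {L : EReal | ∃ (u : ℕ → ℕ) (a : ∀ n, X → Fin (u n)), IsChain μ α u a ∧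
    Tendsto (fun n => finEntropyAt S μ (a n) F) atTop (𝓝 L)}

/-- The mean `Σ`-entropy `h(Σ, α) = inf_F H(Σ, α : F)`. -/
def meanEntropy (S : MapSequence G) (μ : Measure X) (α : X → ι) : EReal :=
  ⨅ F : Finset G, entropyAt S μ α F

end

/-- `α` is a finite-entropy generating countable partition (with labels in `ℕ`). -/
def IsFiniteEntropyGenerator (G : Type*) {X : Type*} [Group G] [MulAction G X] [MeasurableSpace X]
    (μ : Measure X) (α : X → ℕ) : Prop :=
  IsMeasurablePartition α ∧ partitionEntropy μ α < ⊤ ∧ IsGenerating G μ α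

/-- The entropy `h(Σ, G, X, μ)` is defined and equal to `c`: finite-entropy generating partitions
exist, and all of them have mean `Σ`-entropy `c`. -/
def HasSoficEntropy {G X : Type*} [Group G] [MulAction G X] [MeasurableSpace X]
    (S : MapSequence G) (μ : Measure X) (c : EReal) : Prop :=
  (∃ α : X → ℕ, IsFiniteEntropyGenerator G μ α) ∧
    ∀ α : X → ℕ, IsFiniteEntropyGenerator G μ α → meanEntropy S μ α = c

/-! ### Bernoulli shifts -/

open Classical in
/-- The entropy `H(κ)` of a probability measure: the Shannon entropy of its atoms if `κ` is
concentrated on a countable set, and `∞` otherwise. -/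
def baseEntropy {K : Type*} [MeasurableSpace K] (κ : Measure K) : ℝ≥0∞ :=
  if ∃ K' : Set K, K'.Countable ∧ κ K' = 1 then
    ∑' k, ENNReal.ofReal (Real.negMulLog (κ.real {k}))
  else ⊤

/-- The space `K^G`. -/
def Shift (G K : Type*) : Type _ := G → K

instance (G K : Type*) [MeasurableSpace K] : MeasurableSpace (Shift G K) :=
  inferInstanceAs (MeasurableSpace (G → K))

/-- The shift action `(g x)(f) = x(g⁻¹ f)`. -/
instance (G K : Type*) [Group G] : MulAction G (Shift G K) where
  smul g x := fun f => x (g⁻¹ * f)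
  one_smul x := funext fun f => by
    change x (1⁻¹ * f) = x f
    simp
  mul_smul g h x := funext fun f => by
    change x ((g * h)⁻¹ * f) = x (h⁻¹ * (g⁻¹ * f))
    simp [mul_assoc]

/-- The product measure `κ^G`. -/
def bernoulliMeasure (G : Type*) {K : Type*} [MeasurableSpace K] (κ : Measure K)
    [IsProbabilityMeasure κ] : Measure (Shift G K) :=
  Measure.infinitePi (fun _ : G => κ)

/-- The canonical partition `{B_k}` of `K^G`, `B_k = {x | x(e) = k}`. -/
def canonicalPartition (G K : Type*) [Group G] : Shift G K → K := fun x => x 1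

/-- The partition `α × β = {A × B}` of `X × Y`. -/
def prodPartition {X Y ι κ : Type*} (α : X → ι) (β : Y → κ) : X × Y → ι × κ :=
  fun p => (α p.1, β p.2)

end SoficEntropy

end

open SoficEntropy

/-! Everything is phrased through names: the `F`-name of a point lists the labels met along the
inverse translates by `F`, and a partition of `{1, …, m}` approximates `α` exactly when its
empirical law of names is `ℓ¹`-close to that of `α`. Entropy inequalities then become comparisons of
counts of words.

For finite partitions, the upper bound in the product formula comes from forgetting the second
coordinate. This sends approximations of `α × β` to approximations of `α`, and over a fixed word
there are at most `exp (m (H(α × β) - H(α) + η)) = exp (m (H(κ) + η))` words of the right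
frequencies (`exists_card_fiber_le`, `finEntropyAt_le_of_coarsening`). For the lower bound, fix an
approximation of `α` and choose the second coordinate at random, with independent letters of law
`κ`. At two good points whose names read disjoint sets of sites the occurrences of a name are
independent, so the variance of each name frequency is small (`second_moment_le`). Hence with
probability at least one half the random word completes the given one to an approximation of `α ×
β`. Each such random word has probability at most about `exp (-m H(κ))`, so there are at least about
`exp (m H(κ))` of them (`finEntropyAt_add_le`). Soficity enters here: it makes the sites of a
typical name distinct.

For countable partitions the same conditional-entropy bound shows that a late member of one chain
exceeds the `n`-th member `a` of another by at most `H(α) - H(a)`, up to arbitrarily small errors.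
This difference tends to zero because a chain eventually separates the atoms of `α` of positive
measure. So all chains have the same limit, and the product formula can be read along a product of
truncations.

Independence of the generator is a coding argument (`finEntropyAt_le_of_codes`). If `α` and `β`
generate, a finite part of `α` is nearly a local function `Φ` of `β`, and a finite part `π ∘ β` is
nearly a local function `Ψ` of `α`. Sending a model word `b` of `β` to its `Φ`-image gives a model
word of `α`. That image nearly determines `π ∘ b`, so its fibres have exponential size about `H(β) -
H(π ∘ β)`, which is small. By symmetry the two mean entropies agree.

The statements on systems follow by taking the infimum over nonempty `F`. A Bernoulli shift on its
own is the product case with a trivial partition, whose entropy is zero. -/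

noncomputable section

namespace SoficEntropy

/-! ### Laws of finite partitions -/

section Law

variable {X Y A B : Type*} [MeasurableSpace X] [MeasurableSpace Y]

/-- The distribution of the label function `g`. -/
def law (μ : Measure X) (g : X → A) (a : A) : ℝ := μ.real (g ⁻¹' {a})

/-- The `ℓ¹` distance of two functions on a finite set. -/
def l1 [Fintype A] (p q : A → ℝ) : ℝ := ∑ a, |p a - q a|

open Classical in
/-- The push-forward of a weight function. -/
def push [Fintype A] (π : A → B) (p : A → ℝ) (b : B) : ℝ := ∑ a with π a = b, p a

/-- The Shannon entropy of a weight function on a finite set. -/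
def finH [Fintype A] (p : A → ℝ) : ℝ := ∑ a, Real.negMulLog (p a)

theorem law_nonneg (μ : Measure X) (g : X → A) (a : A) : 0 ≤ law μ g a := measureReal_nonneg

theorem IsMeasurablePartition.preimage [Countable A] {g : X → A} (hg : IsMeasurablePartition g)
    (s : Set A) : MeasurableSet (g ⁻¹' s) := by
  have : g ⁻¹' s = ⋃ a ∈ s, g ⁻¹' {a} := by ext; simp
  rw [this]
  exact MeasurableSet.biUnion s.to_countable fun a _ => hg a

theorem IsMeasurablePartition.comp [Countable A] {g : X → A} (hg : IsMeasurablePartition g)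
    (π : A → B) : IsMeasurablePartition (π ∘ g) := fun b => hg.preimage (π ⁻¹' {b})

theorem IsMeasurablePartition.pair {g : X → A} {h : X → B} (hg : IsMeasurablePartition g)
    (hh : IsMeasurablePartition h) : IsMeasurablePartition fun x => (g x, h x) := by
  rintro ⟨a, b⟩
  have : (fun x => (g x, h x)) ⁻¹' {(a, b)} = g ⁻¹' {a} ∩ h ⁻¹' {b} := by ext; simp
  rw [this]
  exact (hg a).inter (hh b)

theorem isMeasurablePartition_fin {m : ℕ} (g : Fin m → A) : IsMeasurablePartition g :=
  fun _ => MeasurableSet.of_discrete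

variable [Fintype A]

theorem law_comp (μ : Measure X) [IsFiniteMeasure μ] {g : X → A} (hg : IsMeasurablePartition g)
    (π : A → B) : law μ (π ∘ g) = push π (law μ g) := by
  classical
  ext b
  unfold law push
  have : π ∘ g ⁻¹' {b} = ⋃ a ∈ Finset.univ.filter (fun a => π a = b), g ⁻¹' {a} := by
    ext; simp
  rw [this, measureReal_biUnion_finset]
  · rintro a - a' - h
    exact Disjoint.preimage g (by simpa using h)
  · exact fun a _ => hg a

variable [Fintype B]

theorem sum_push_mul (π : A → B) (p : A → ℝ) (h : B → ℝ) :
    ∑ b, push π p b * h b = ∑ a, p a * h (π a) := by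
  classical
  unfold push
  rw [← Finset.sum_fiberwise_of_maps_to (g := π) (t := Finset.univ)
    (fun _ _ => Finset.mem_univ _) (fun a => p a * h (π a))]
  refine Finset.sum_congr rfl fun b _ => ?_
  rw [Finset.sum_mul]
  refine Finset.sum_congr rfl fun a ha => ?_
  rw [(Finset.mem_filter.1 ha).2]

theorem sum_law (μ : Measure X) [IsProbabilityMeasure μ] {g : X → A}
    (hg : IsMeasurablePartition g) : ∑ a, law μ g a = 1 := by
  have h := congrFun (law_comp μ hg (fun _ => ())) ()
  have e : (fun _ => ()) ∘ g ⁻¹' {()} = Set.univ := by ext; simp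
  rw [law, e] at h
  simpa [push] using h.symm

theorem l1_triangle (p q r : A → ℝ) : l1 p r ≤ l1 p q + l1 q r := by
  unfold l1
  rw [← Finset.sum_add_distrib]
  exact Finset.sum_le_sum fun a _ => abs_sub_le _ _ _

theorem l1_push_le (π : A → B) (p q : A → ℝ) : l1 (push π p) (push π q) ≤ l1 p q := by
  classical
  unfold l1 push
  rw [← Finset.sum_fiberwise_of_maps_to (g := π) (t := Finset.univ)
    (fun _ _ => Finset.mem_univ _) (fun a => |p a - q a|)]
  refine Finset.sum_le_sum fun b _ => ?_
  rw [← Finset.sum_sub_distrib]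
  exact Finset.abs_sum_le_sum_abs _ _

theorem l1_comp_le (μ : Measure X) [IsFiniteMeasure μ] (ν : Measure Y) [IsFiniteMeasure ν]
    {g : X → A} (hg : IsMeasurablePartition g) {h : Y → A} (hh : IsMeasurablePartition h)
    (π : A → B) : l1 (law μ (π ∘ g)) (law ν (π ∘ h)) ≤ l1 (law μ g) (law ν h) := by
  rw [law_comp μ hg, law_comp ν hh]
  exact l1_push_le π _ _

/-- Both laws are marginals of the joint law of `(g, h)`. Diagonal atoms cancel, and each
off-diagonal atom is charged once to each marginal, whence the factor 2. -/
theorem l1_law_le (μ : Measure X) [IsFiniteMeasure μ] {g h : X → A}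
    (hg : IsMeasurablePartition g) (hh : IsMeasurablePartition h) :
    l1 (law μ g) (law μ h) ≤ 2 * μ.real {x | g x ≠ h x} := by
  classical
  have hgh := hg.pair hh
  have e1 : law μ g = push Prod.fst (law μ fun x => (g x, h x)) := law_comp μ hgh Prod.fst
  have e2 : law μ h = push Prod.snd (law μ fun x => (g x, h x)) := law_comp μ hgh Prod.snd
  set P := law μ fun x => (g x, h x)
  have hD : μ.real {x | g x ≠ h x} = ∑ p : A × A, if p.1 ≠ p.2 then P p else 0 := by
    have := congrFun (law_comp μ hgh (fun p => decide (p.1 ≠ p.2))) true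
    rw [push, Finset.sum_filter] at this
    simp only [decide_eq_true_eq] at this
    rw [← this]
    unfold law
    congr 1
    ext x; simp
  have key : ∀ a, |law μ g a - law μ h a| ≤
      (∑ p : A × A, if p.1 = a then (if p.1 ≠ p.2 then P p else 0) else 0) +
        ∑ p : A × A, if p.2 = a then (if p.1 ≠ p.2 then P p else 0) else 0 := by
    intro a
    rw [e1, e2]
    unfold push
    rw [Finset.sum_filter, Finset.sum_filter, ← Finset.sum_sub_distrib, ← Finset.sum_add_distrib]
    refine (Finset.abs_sum_le_sum_abs _ _).trans (Finset.sum_le_sum fun p _ => ?_)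
    have : 0 ≤ P p := law_nonneg _ _ _
    by_cases h1 : p.1 = a <;> by_cases h2 : p.2 = a <;> by_cases h3 : p.1 = p.2 <;>
      simp_all [abs_of_nonneg]
  refine (Finset.sum_le_sum fun a _ => key a).trans ?_
  rw [Finset.sum_add_distrib, Finset.sum_comm, Finset.sum_comm (s := Finset.univ (α := A))]
  simp only [Finset.sum_ite_eq, Finset.mem_univ, if_true]
  rw [hD]
  linarith

theorem abs_sub_le_l1 (p q : A → ℝ) (a : A) : |p a - q a| ≤ l1 p q :=
  Finset.single_le_sum (f := fun a => |p a - q a|) (fun _ _ => abs_nonneg _) (Finset.mem_univ a)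

/-- Applied with `h` the logarithm of a weight, this turns closeness of letter frequencies into
closeness of the exponents of product weights. -/
theorem abs_sum_mul_sub_le (p q h : A → ℝ) :
    |∑ a, p a * h a - ∑ a, q a * h a| ≤ l1 p q * ∑ a, |h a| := by
  rw [← Finset.sum_sub_distrib, Finset.mul_sum]
  refine (Finset.abs_sum_le_sum_abs _ _).trans (Finset.sum_le_sum fun a _ => ?_)
  rw [← sub_mul, abs_mul]
  exact mul_le_mul_of_nonneg_right (abs_sub_le_l1 p q a) (abs_nonneg _)

theorem finH_continuous : Continuous (finH : (A → ℝ) → ℝ) :=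
  continuous_finsetSum _ fun a _ => Real.continuous_negMulLog.comp (continuous_apply a)

theorem exists_l1_finH_lt (p : A → ℝ) {η : ℝ} (hη : 0 < η) :
    ∃ ε > 0, ∀ q : A → ℝ, l1 p q ≤ ε → |finH q - finH p| < η := by
  obtain ⟨δ, hδ, h⟩ := Metric.continuous_iff.1 (finH_continuous (A := A)) p η hη
  refine ⟨δ / 2, by positivity, fun q hq => ?_⟩
  have : dist q p < δ := by
    refine lt_of_le_of_lt ((dist_pi_le_iff (by positivity : (0 : ℝ) ≤ δ / 2)).2 fun a => ?_)
      (half_lt_self hδ)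
    rw [Real.dist_eq, abs_sub_comm]
    exact (abs_sub_le_l1 p q a).trans hq
  simpa [Real.dist_eq] using h q this

theorem finH_comp_injective {e : A → B} (he : Function.Injective e) (μ : Measure X) (g : X → A) :
    finH (law μ (e ∘ g)) = finH (law μ g) := by
  unfold finH
  symm
  refine Finset.sum_of_injOn e he.injOn (by simp) ?_ ?_
  · intro b _ hb
    have : e ∘ g ⁻¹' {b} = ∅ := by
      ext x
      simp only [Set.mem_preimage, Function.comp_apply, Set.mem_singleton_iff,
        Set.mem_empty_iff_false, iff_false]
      rintro rfl
      exact hb ⟨g x, by simp, rfl⟩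
    simp [law, this]
  · intro a _
    have : e ∘ g ⁻¹' {e a} = g ⁻¹' {a} := by
      ext x; simp [he.eq_iff]
    simp [law, this]

end Law

/-! ### The uniform measure on `Fin m` -/

/-- The uniform measure on `Fin m`. -/
def unif (m : ℕ) : Measure (Fin m) := (m : ℝ≥0∞)⁻¹ • Measure.count

theorem unif_real {m : ℕ} (s : Set (Fin m)) : (unif m).real s = s.ncard / m := by
  have : Measure.count s = (s.ncard : ℝ≥0∞) := by
    rw [Measure.count_apply MeasurableSet.of_discrete, ← Set.Finite.cast_ncard_eq (Set.toFinite s)]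
    exact ENat.toENNReal_coe _
  rw [unif, measureReal_def, Measure.smul_apply, this, smul_eq_mul, ENNReal.toReal_mul,
    ENNReal.toReal_inv]
  simp only [ENNReal.toReal_natCast]
  rw [div_eq_inv_mul]

instance isProbabilityMeasure_unif {m : ℕ} [NeZero m] : IsProbabilityMeasure (unif m) := by
  constructor
  simp [unif, Measure.count_apply]
  exact ENNReal.inv_mul_cancel (by simp [NeZero.ne m]) (by simp)

theorem unif_real_image {m : ℕ} (e : Equiv.Perm (Fin m)) (s : Set (Fin m)) :
    (unif m).real (e '' s) = (unif m).real s := by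
  rw [unif_real, unif_real, Set.ncard_image_of_injective _ e.injective]

theorem law_unif_comp_perm {m : ℕ} {A : Type*} (e : Equiv.Perm (Fin m)) (g : Fin m → A) :
    law (unif m) (g ∘ e) = law (unif m) g := by
  ext a
  unfold law
  rw [← unif_real_image e]
  congr 1
  rw [Set.preimage_comp, Equiv.image_preimage]

/-- The logarithm of a product weight of a word is thereby `m` times an average against its letter
frequencies. -/
theorem sum_eq_mul_sum_law {m : ℕ} [NeZero m] {A : Type*} [Fintype A] (g : Fin m → A) (h : A → ℝ) :
    ∑ v, h (g v) = m * ∑ a, law (unif m) g a * h a := by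
  classical
  rw [← Finset.sum_fiberwise_of_maps_to (g := g) (t := Finset.univ)
    (fun _ _ => Finset.mem_univ _) (fun v => h (g v)), Finset.mul_sum]
  refine Finset.sum_congr rfl fun a _ => ?_
  rw [law, unif_real, Finset.sum_congr rfl (g := fun _ => h a)
    (fun v hv => by rw [(Finset.mem_filter.1 hv).2]), Finset.sum_const, nsmul_eq_mul]
  have : (g ⁻¹' {a}).ncard = (Finset.univ.filter fun v => g v = a).card := by
    rw [← Set.ncard_coe_finset]; congr 1; ext; simp
  rw [this]
  have : (m : ℝ) ≠ 0 := Nat.cast_ne_zero.2 (NeZero.ne m)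
  field_simp

/-! ### Counting words with prescribed frequencies -/

section Count

variable {A B : Type*} [Fintype A]

/-- The singularity of `log` at `0` is harmless: where `r i = 0` the coefficient itself kills the
term. -/
theorem tendsto_sum_mul_log {l : Filter ℝ} (r : A → ℝ) (s : ℝ → A → ℝ)
    (hs : ∀ i, Tendsto (fun δ => s δ i) l (𝓝 (r i))) :
    Tendsto (fun δ => ∑ i, r i * Real.log (s δ i)) l (𝓝 (-finH r)) := by
  have : -finH r = ∑ i, r i * Real.log (r i) := by
    simp [finH, Real.negMulLog]
  rw [this]
  refine tendsto_finsetSum _ fun i _ => ?_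
  by_cases h0 : r i = 0
  · simpa [h0] using tendsto_const_nhds
  · exact ((hs i).log h0).const_mul _

variable [Fintype B]

/-- Weights whose fibre sums are at most one and whose expected negative logarithm is close to the
conditional entropy. -/
theorem exists_weights (π : A → B) (p : A → ℝ) (hp : ∀ a, 0 ≤ p a) {η : ℝ} (hη : 0 < η) :
    ∃ w : A → ℝ, (∀ a, 0 < w a) ∧ (∀ b, push π w b ≤ 1) ∧
      -∑ a, p a * Real.log (w a) < finH p - finH (push π p) + η := by
  classical
  -- The natural weights are the conditional probabilities of a letter given its image, but these
  -- may be `0` or `0 / 0`. Adding `δ` makes them positive, and letting `δ → 0` recovers the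
  -- conditional entropy.
  let q : ℝ → A → ℝ := fun δ a => p a + δ
  let w : ℝ → A → ℝ := fun δ a => q δ a / push π (q δ) (π a)
  have hq : ∀ δ > 0, ∀ a, 0 < q δ a := fun δ hδ a => add_pos_of_nonneg_of_pos (hp a) hδ
  have hpush : ∀ δ > 0, ∀ a, 0 < push π (q δ) (π a) := by
    intro δ hδ a
    exact Finset.sum_pos (fun a _ => hq δ hδ a) ⟨a, by simp⟩
  have hpδ : ∀ a, Tendsto (fun δ => q δ a) (𝓝[>] 0) (𝓝 (p a)) := by
    intro a
    have : Tendsto (fun δ : ℝ => p a + δ) (𝓝 0) (𝓝 (p a + 0)) :=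
      (continuous_const.add continuous_id).tendsto 0
    rw [add_zero] at this
    exact this.mono_left nhdsWithin_le_nhds
  have hlim : Tendsto (fun δ => -∑ a, p a * Real.log (w δ a)) (𝓝[>] 0)
      (𝓝 (finH p - finH (push π p))) := by
    have h1 := tendsto_sum_mul_log p q hpδ
    have h2 := tendsto_sum_mul_log (push π p) (fun δ => push π (q δ))
      (fun b => tendsto_finsetSum _ fun a _ => hpδ a)
    have h3 := h2.sub h1
    have e : -finH (push π p) - -finH p = finH p - finH (push π p) := by ring
    rw [e] at h3
    refine h3.congr' ?_
    filter_upwards [self_mem_nhdsWithin] with δ hδ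
    rw [sum_push_mul, ← Finset.sum_sub_distrib, ← Finset.sum_neg_distrib]
    refine Finset.sum_congr rfl fun a _ => ?_
    rw [Real.log_div (hq δ hδ a).ne' (hpush δ hδ a).ne']
    ring
  obtain ⟨δ, hδ, hδ0⟩ := ((hlim.eventually_lt_const (lt_add_of_pos_right _ hη)).and
    (self_mem_nhdsWithin (s := Set.Ioi (0 : ℝ)))).exists
  refine ⟨w δ, fun a => div_pos (hq δ hδ0 a) (hpush δ hδ0 a), fun b => ?_, hδ⟩
  have : push π (w δ) b = push π (q δ) b / push π (q δ) b := by
    unfold push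
    rw [Finset.sum_div]
    refine Finset.sum_congr rfl fun a ha => ?_
    rw [← (Finset.mem_filter.1 ha).2]
    rfl
  rw [this]
  -- Only `≤ 1`: the quotient is `0 / 0 = 0` when `b` is not in the range of `π`.
  exact div_self_le_one _

/-- The number of words over `A` with frequencies close to `p` that lie over a given word over `B`
grows at most with the conditional entropy. -/
theorem exists_card_fiber_le (π : A → B) (p : A → ℝ) (hp : ∀ a, 0 ≤ p a) {η : ℝ} (hη : 0 < η) :
    ∃ ε > 0, ∀ (m : ℕ) [NeZero m] (b : Fin m → B),
      ({a : Fin m → A | π ∘ a = b ∧ l1 p (law (unif m) a) ≤ ε}.ncard : ℝ) ≤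
        Real.exp (m * (finH p - finH (push π p) + η)) := by
  classical
  obtain ⟨w, hw0, hw1, hw⟩ := exists_weights π p hp (half_pos hη)
  set M := ∑ a, |Real.log (w a)|
  have hM : 0 ≤ M := Finset.sum_nonneg fun _ _ => abs_nonneg _
  -- Half of `η` is spent on the weights, the other half on the deviation of frequencies; the `+ 1`
  -- covers `M = 0`.
  refine ⟨η / 2 / (M + 1), by positivity, fun m _ b => ?_⟩
  set c := finH p - finH (push π p) + η
  set T : Finset (Fin m → A) := Finset.univ.filter
    fun a => π ∘ a = b ∧ l1 p (law (unif m) a) ≤ η / 2 / (M + 1)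
  have hT : {a : Fin m → A | π ∘ a = b ∧ l1 p (law (unif m) a) ≤ η / 2 / (M + 1)} = T := by
    ext; simp [T]
  rw [hT, Set.ncard_coe_finset]
  have hlow : ∀ a ∈ T, Real.exp (-(m * c)) ≤ ∏ v, w (a v) := by
    intro a ha
    have ha2 := (Finset.mem_filter.1 ha).2.2
    have : ∏ v, w (a v) = Real.exp (∑ v, Real.log (w (a v))) := by
      rw [Real.exp_sum]
      exact Finset.prod_congr rfl fun v _ => (Real.exp_log (hw0 _)).symm
    rw [this, Real.exp_le_exp, sum_eq_mul_sum_law a (fun x => Real.log (w x)), ← mul_neg]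
    refine mul_le_mul_of_nonneg_left ?_ (Nat.cast_nonneg m)
    have h1 := abs_le.1 (abs_sum_mul_sub_le p (law (unif m) a) (fun x => Real.log (w x)))
    have h2 : l1 p (law (unif m) a) * M ≤ η / 2 := by
      calc _ ≤ η / 2 / (M + 1) * M := mul_le_mul_of_nonneg_right ha2 hM
        _ ≤ η / 2 / (M + 1) * (M + 1) := by gcongr; linarith
        _ = η / 2 := by field_simp
    have h3 := h1.2
    change _ ≤ l1 p (law (unif m) a) * M at h3
    simp only [c]
    linarith
  -- The weights of all words over `b` sum to a product over the sites of fibre sums, each at most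
  -- one. Since every word of `T` has weight at least `exp (-m c)`, this bounds the size of `T`.
  have hsum : ∑ a ∈ T, ∏ v, w (a v) ≤ 1 := by
    calc ∑ a ∈ T, ∏ v, w (a v)
        ≤ ∑ a ∈ Fintype.piFinset (fun v => Finset.univ.filter fun x => π x = b v),
            ∏ v, w (a v) := by
          refine Finset.sum_le_sum_of_subset_of_nonneg ?_
            fun a _ _ => Finset.prod_nonneg fun v _ => (hw0 _).le
          intro a ha
          simp only [Fintype.mem_piFinset, Finset.mem_filter, Finset.mem_univ, true_and]
          exact fun v => congrFun (Finset.mem_filter.1 ha).2.1 v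
      _ = ∏ v, push π w (b v) := by
          rw [← Finset.prod_univ_sum]
          rfl
      _ ≤ 1 := Finset.prod_le_one
          (fun v _ => Finset.sum_nonneg fun a _ => (hw0 a).le) fun v _ => hw1 _
  have h := (Finset.card_nsmul_le_sum T _ _ hlow).trans hsum
  rw [nsmul_eq_mul, Real.exp_neg, ← div_eq_mul_inv, div_le_one (Real.exp_pos _)] at h
  exact h

/-- Words with frequencies close to `p` have small `p`-product weight. -/
theorem exists_prod_le (p : A → ℝ) (hp : ∀ a, 0 ≤ p a) {η : ℝ} (hη : 0 < η) :
    ∃ ε > 0, ∀ (m : ℕ) [NeZero m] (a : Fin m → A), l1 p (law (unif m) a) ≤ ε →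
      ∏ v, p (a v) ≤ Real.exp (-(m * (finH p - η))) := by
  set M := ∑ a, |Real.log (p a)|
  have hM : 0 ≤ M := Finset.sum_nonneg fun _ _ => abs_nonneg _
  refine ⟨η / (M + 1), by positivity, fun m _ a ha => ?_⟩
  -- A word using a letter of probability zero has product zero; otherwise logarithms may be taken.
  by_cases h0 : ∃ v, p (a v) = 0
  · obtain ⟨v, hv⟩ := h0
    rw [Finset.prod_eq_zero (Finset.mem_univ v) hv]
    positivity
  push Not at h0
  have : ∏ v, p (a v) = Real.exp (∑ v, Real.log (p (a v))) := by
    rw [Real.exp_sum]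
    exact Finset.prod_congr rfl
      fun v _ => (Real.exp_log (lt_of_le_of_ne (hp _) (h0 v).symm)).symm
  rw [this, Real.exp_le_exp, sum_eq_mul_sum_law a (fun x => Real.log (p x)), ← mul_neg]
  refine mul_le_mul_of_nonneg_left ?_ (Nat.cast_nonneg m)
  have h1 := abs_le.1 (abs_sum_mul_sub_le p (law (unif m) a) (fun x => Real.log (p x)))
  have h2 : l1 p (law (unif m) a) * M ≤ η := by
    calc _ ≤ η / (M + 1) * M := mul_le_mul_of_nonneg_right ha hM
      _ ≤ η / (M + 1) * (M + 1) := by gcongr; linarith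
      _ = η := by field_simp
  have h3 := h1.1
  change -(l1 p (law (unif m) a) * M) ≤ _ at h3
  have h4 : finH p = -∑ a, p a * Real.log (p a) := by simp [finH, Real.negMulLog]
  linarith

/-- Counting through a map whose fibres are bounded. -/
theorem ncard_le_mul_of_fiber_le {α β : Type*} [Finite α] [Finite β] (s : Set α) (t : Set β)
    (f : α → β) (hf : ∀ a ∈ s, f a ∈ t) {c : ℝ}
    (hc : ∀ b ∈ t, ({a ∈ s | f a = b}.ncard : ℝ) ≤ c) : (s.ncard : ℝ) ≤ t.ncard * c := by
  classical
  have := Fintype.ofFinite α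
  have := Fintype.ofFinite β
  have h := Finset.card_eq_sum_card_fiberwise (f := f) (s := s.toFinset) (t := t.toFinset)
    (fun a ha => by simpa using hf a (by simpa using ha))
  rw [Set.ncard_eq_toFinset_card', Set.ncard_eq_toFinset_card', h, Nat.cast_sum, ← nsmul_eq_mul]
  refine Finset.sum_le_card_nsmul _ _ _ fun b hb => ?_
  have := hc b (by simpa using hb)
  rw [Set.ncard_eq_toFinset_card'] at this
  refine le_of_eq_of_le (congrArg _ (congrArg _ ?_)) this
  ext; simp

end Count

open scoped Classical

/-! ### Exponential growth rates -/

theorem ereal_le_of_forall_pos_le_add {a b : EReal} (h : ∀ η : ℝ, 0 < η → a ≤ b + (η : EReal)) :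
    a ≤ b := by
  induction b with
  | top => exact le_top
  | bot => simpa using h 1 one_pos
  | coe b =>
    refine EReal.le_of_forall_lt_iff_le.1 fun z hz => ?_
    have hz' : b < z := by exact_mod_cast hz
    have := h (z - b) (sub_pos.2 hz')
    rwa [← EReal.coe_add, add_sub_cancel] at this

theorem ereal_le_iInf_add {ι : Sort*} {a : EReal} {u : ι → EReal} {c : ℝ}
    (h : ∀ i, a ≤ u i + (c : EReal)) : a ≤ (⨅ i, u i) + (c : EReal) := by
  have h' : a - c ≤ ⨅ i, u i := le_iInf fun i => EReal.sub_le_of_le_add (h i)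
  exact (EReal.sub_le_iff_le_add (.inl (EReal.coe_ne_bot c)) (.inl (EReal.coe_ne_top c))).1 h'

theorem ereal_limsup_add_coe_le {ι : Type*} {l : Filter ι} [l.NeBot] (u : ι → EReal) (c : ℝ) :
    limsup (fun i => u i + (c : EReal)) l ≤ limsup u l + (c : EReal) := by
  have := EReal.limsup_add_le (f := l) (u := u) (v := fun _ => (c : EReal))
    (.inr (by simp)) (.inr (by simp))
  simpa [Pi.add_def] using this

instance neZero_m {G : Type*} (S : MapSequence G) (i : ℕ) : NeZero (S.m i) :=
  ⟨by have := S.one_le_m i; omega⟩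

theorem encard_eq_ofReal {α : Type*} [Finite α] (s : Set α) :
    ((s.encard : ℕ∞) : ℝ≥0∞) = ENNReal.ofReal s.ncard := by
  rw [← Set.Finite.cast_ncard_eq (Set.toFinite s), ENNReal.ofReal_natCast]
  exact ENat.toENNReal_coe _

section

variable {G X Y A B : Type*} [Group G] [MulAction G X] [MeasurableSpace X]
  [MulAction G Y] [MeasurableSpace Y]

/-- The bridge from counting to entropy: a factor `exp (m c)` between two counts, needed only for
large `i`, becomes an additive `c`. Empty sets are covered because `log 0 = ⊥`. -/
theorem finEntropyEps_le_of_ncard_le [Finite A] [Finite B] (S : MapSequence G) (μ : Measure X)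
    (ν : Measure Y) {α : X → A} {β : Y → B} {F F' : Finset G} {ε ε' c : ℝ}
    (h : ∀ᶠ i in atTop, ((approxPartitions μ (S.σ i) F α ε).ncard : ℝ) ≤
      (approxPartitions ν (S.σ i) F' β ε').ncard * Real.exp (S.m i * c)) :
    finEntropyEps S μ α F ε ≤ finEntropyEps S ν β F' ε' + (c : EReal) := by
  refine le_trans ?_ (ereal_limsup_add_coe_le _ c)
  refine limsup_le_limsup ?_
  filter_upwards [h] with i hi
  have hm : (0 : ℝ) < S.m i := Nat.cast_pos.2 (S.one_le_m i)
  have hc : ((c : ℝ) : EReal) = ((S.m i * c : ℝ) : EReal) / ((S.m i : ℝ) : EReal) := by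
    rw [← EReal.coe_div]
    congr 1
    field_simp
  rw [hc, ← EReal.add_div_of_nonneg_right (by exact_mod_cast hm.le)]
  refine EReal.div_le_div_right_of_nonneg (by exact_mod_cast hm.le) ?_
  have he : ((S.m i * c : ℝ) : EReal) = ENNReal.log (ENNReal.ofReal (Real.exp (S.m i * c))) := by
    rw [ENNReal.log_ofReal_of_pos (Real.exp_pos _), Real.log_exp]
  rw [he, ← ENNReal.log_mul_add, encard_eq_ofReal, encard_eq_ofReal,
    ← ENNReal.ofReal_mul (Nat.cast_nonneg _)]
  exact ENNReal.log_monotone (ENNReal.ofReal_le_ofReal hi)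

/-! ### Names -/

/-- The `F`-name of a point of `X`. -/
def pname (F : Finset G) (α : X → A) (x : X) : F → A := fun f => α ((f : G)⁻¹ • x)

/-- The `F`-name of a point of `Fin m`. -/
def mname {m : ℕ} (σ : G → Equiv.Perm (Fin m)) (F : Finset G) (β : Fin m → A) (v : Fin m) : F → A :=
  fun f => β ((σ f).symm v)

theorem pname_preimage {X : Type*} [MulAction G X] (F : Finset G) (α : X → A) (φ : F → A) :
    pname F α ⁻¹' {φ} = ⋂ f : F, (f : G) • (α ⁻¹' {φ f}) := by
  ext x
  simp [pname, Set.mem_smul_set_iff_inv_smul_mem, funext_iff]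

theorem mname_preimage {G : Type*} {m : ℕ} (σ : G → Equiv.Perm (Fin m)) (F : Finset G) (β : Fin m → A)
    (φ : F → A) : mname σ F β ⁻¹' {φ} = ⋂ f : F, σ (f : G) '' (β ⁻¹' {φ f}) := by
  ext x
  simp [mname, Equiv.image_eq_preimage_symm, funext_iff]

/-- The intersections in the definition are the level sets of the names, and normalised counting is
the uniform measure. -/
theorem mem_approxPartitions [Fintype A] (μ : Measure X) {m : ℕ} (σ : G → Equiv.Perm (Fin m))
    (F : Finset G) (α : X → A) (β : Fin m → A) (ε : ℝ) :
    β ∈ approxPartitions μ σ F α ε ↔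
      l1 (law μ (pname F α)) (law (unif m) (mname σ F β)) ≤ ε := by
  rw [approxPartitions, Set.mem_ofPred_eq, partDist, tsum_fintype]
  simp only [l1, law, pname_preimage, mname_preimage, unif_real]

theorem finEntropyEps_mono [Finite A] (S : MapSequence G) (μ : Measure X) (α : X → A)
    (F : Finset G) {ε ε' : ℝ} (h : ε ≤ ε') :
    finEntropyEps S μ α F ε ≤ finEntropyEps S μ α F ε' := by
  have := finEntropyEps_le_of_ncard_le S μ μ (α := α) (β := α) (F := F) (F' := F) (ε := ε)
    (ε' := ε') (c := 0) (Eventually.of_forall fun i => by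
      simp only [mul_zero, Real.exp_zero, mul_one, Nat.cast_le]
      exact Set.ncard_le_ncard fun β hβ => le_trans hβ h)
  simpa using this

/-- The system enters the definition only through the law of its `F`-names, so one system may be
replaced by another. -/
theorem finEntropyAt_congr [Fintype A] (S : MapSequence G) (μ : Measure X) (ν : Measure Y)
    (α : X → A) (β : Y → A) (F : Finset G) (h : law μ (pname F α) = law ν (pname F β)) :
    finEntropyAt S μ α F = finEntropyAt S ν β F := by
  have : ∀ {m : ℕ} (σ : G → Equiv.Perm (Fin m)) ε,
      approxPartitions μ σ F α ε = approxPartitions ν σ F β ε := by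
    intro m σ ε
    ext γ
    rw [mem_approxPartitions, mem_approxPartitions, h]
  simp only [finEntropyAt, finEntropyEps, this]

theorem measureReal_smul_ne (μ : Measure X) [SMulInvariantMeasure G X μ] (α α' : X → A) (g : G) :
    μ.real {x | α (g⁻¹ • x) ≠ α' (g⁻¹ • x)} = μ.real {x | α x ≠ α' x} := by
  rw [measureReal_def, measureReal_def]
  congr 1
  exact measure_preimage_smul μ g⁻¹ {x | α x ≠ α' x}

theorem law_smul (μ : Measure X) [SMulInvariantMeasure G X μ] (α : X → A) (g : G) :
    law μ (fun x => α (g • x)) = law μ α := by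
  ext a
  rw [law, law, measureReal_def, measureReal_def]
  congr 1
  exact measure_preimage_smul μ g (α ⁻¹' {a})

theorem measureReal_pname_ne_le (μ : Measure X) [IsFiniteMeasure μ] [SMulInvariantMeasure G X μ]
    (F : Finset G) (α α' : X → A) :
    μ.real {x | pname F α x ≠ pname F α' x} ≤ F.card * μ.real {x | α x ≠ α' x} := by
  have : {x | pname F α x ≠ pname F α' x} ⊆ ⋃ f ∈ F, {x | α (f⁻¹ • x) ≠ α' (f⁻¹ • x)} := by
    intro x hx
    simp only [pname, Set.mem_ofPred_eq, ne_eq, funext_iff, not_forall] at hx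
    obtain ⟨f, hf⟩ := hx
    simp only [Set.mem_iUnion]
    exact ⟨f, f.2, hf⟩
  refine (measureReal_mono this (measure_ne_top _ _)).trans ((measureReal_biUnion_finset_le _ _).trans ?_)
  simp [measureReal_smul_ne]

/-! ### Entropy of a partition against that of its coarsenings -/

variable [MeasurableConstSMul G X]

theorem IsMeasurablePartition.pname {α : X → A} (hα : IsMeasurablePartition α) (F : Finset G) :
    IsMeasurablePartition (pname F α) := by
  intro φ
  rw [pname_preimage]
  exact MeasurableSet.iInter fun f => (hα _).const_smul _

theorem l1_pname_le (μ : Measure X) [IsFiniteMeasure μ] [SMulInvariantMeasure G X μ] [Fintype A]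
    (F : Finset G) {α α' : X → A} (hα : IsMeasurablePartition α) (hα' : IsMeasurablePartition α') :
    l1 (law μ (pname F α)) (law μ (pname F α')) ≤ 2 * (F.card * μ.real {x | α x ≠ α' x}) :=
  (l1_law_le μ (hα.pname F) (hα'.pname F)).trans
    (mul_le_mul_of_nonneg_left (measureReal_pname_ne_le μ F α α') zero_le_two)

/-- Single-site frequencies are controlled by name frequencies. -/
theorem l1_law_le_l1_name (μ : Measure X) [IsFiniteMeasure μ] [SMulInvariantMeasure G X μ]
    [Fintype A] {m : ℕ} [NeZero m] (σ : G → Equiv.Perm (Fin m)) {F : Finset G} (hF : F.Nonempty)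
    {α : X → A} (hα : IsMeasurablePartition α) (β : Fin m → A) :
    l1 (law μ α) (law (unif m) β) ≤ l1 (law μ (pname F α)) (law (unif m) (mname σ F β)) := by
  obtain ⟨f, hf⟩ := hF
  have := l1_comp_le μ (unif m) (hα.pname F) (isMeasurablePartition_fin (mname σ F β))
    (fun φ => φ ⟨f, hf⟩)
  have e1 : (fun φ : F → A => φ ⟨f, hf⟩) ∘ pname F α = fun x => α (f⁻¹ • x) := rfl
  have e2 : (fun φ : F → A => φ ⟨f, hf⟩) ∘ mname σ F β = β ∘ (σ f).symm := rfl
  rwa [e1, e2, law_smul, law_unif_comp_perm] at this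

/-- The entropy of `α` exceeds that of an approximate coarsening by at most a conditional
entropy. -/
theorem finEntropyAt_le_of_coarsening [Fintype A] [Fintype B] (S : MapSequence G) (μ : Measure X)
    [IsProbabilityMeasure μ] [SMulInvariantMeasure G X μ] {α : X → A} {α' : X → B}
    (hα : IsMeasurablePartition α) (θ : A → B) {F : Finset G}
    (hF : F.Nonempty) {ε : ℝ} (hε : 0 < ε)
    (h : l1 (law μ (pname F α')) (law μ (pname F (θ ∘ α))) ≤ ε / 2) :
    finEntropyAt S μ α F ≤ finEntropyEps S μ α' F ε +
      ((finH (law μ α) - finH (law μ (θ ∘ α)) : ℝ) : EReal) := by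
  refine ereal_le_of_forall_pos_le_add fun η hη => ?_
  obtain ⟨ε₀, hε₀, hcount⟩ := exists_card_fiber_le θ (law μ α) (law_nonneg μ α) hη
  -- The bound `ε / 2` keeps the image of an approximation within `ε` of `α'`; the bound `ε₀` makes
  -- the fibre count apply.
  have hδ : 0 < min (ε / 2) ε₀ := lt_min (half_pos hε) hε₀
  refine (iInf₂_le _ hδ).trans ?_
  rw [add_assoc, ← EReal.coe_add]
  refine finEntropyEps_le_of_ncard_le S μ μ (Eventually.of_forall fun i => ?_)
  refine ncard_le_mul_of_fiber_le _ _ (fun β => θ ∘ β) ?_ ?_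
  · intro β hβ
    rw [mem_approxPartitions] at hβ ⊢
    have h2 := l1_comp_le μ (unif (S.m i)) (hα.pname F)
      (isMeasurablePartition_fin (mname (S.σ i) F β)) (fun φ f => θ (φ f))
    have h3 := l1_triangle (law μ (pname F α')) (law μ (pname F (θ ∘ α)))
      (law (unif (S.m i)) (mname (S.σ i) F (θ ∘ β)))
    have h4 : l1 (law μ (pname F (θ ∘ α))) (law (unif (S.m i)) (mname (S.σ i) F (θ ∘ β))) ≤
      min (ε / 2) ε₀ := h2.trans hβ
    have := min_le_left (ε / 2) ε₀
    linarith
  · intro b _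
    rw [law_comp μ hα θ]
    refine le_trans (Nat.cast_le.2 (Set.ncard_le_ncard ?_)) (hcount (S.m i) b)
    rintro β ⟨hβ, hb⟩
    rw [mem_approxPartitions] at hβ
    exact ⟨hb, (l1_law_le_l1_name μ (S.σ i) hF hα β).trans (hβ.trans (min_le_right _ _))⟩

/-- An injective relabelling forgets nothing, so the conditional entropy in the coarsening bound
vanishes. -/
theorem finEntropyAt_comp_le [Fintype A] [Fintype B] (S : MapSequence G) (μ : Measure X)
    [IsProbabilityMeasure μ] [SMulInvariantMeasure G X μ] {α : X → A}
    (hα : IsMeasurablePartition α) {θ : A → B} (hθ : Function.Injective θ) {F : Finset G}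
    (hF : F.Nonempty) : finEntropyAt S μ α F ≤ finEntropyAt S μ (θ ∘ α) F := by
  refine le_iInf₂ fun ε hε => ?_
  have := finEntropyAt_le_of_coarsening S μ hα (α' := θ ∘ α) θ hF hε
    (by simp [l1]; positivity)
  rw [finH_comp_injective hθ] at this
  simpa using this

theorem finEntropyAt_equiv_comp [Fintype A] [Fintype B] (S : MapSequence G) (μ : Measure X)
    [IsProbabilityMeasure μ] [SMulInvariantMeasure G X μ] {α : X → A}
    (hα : IsMeasurablePartition α) (e : A ≃ B) {F : Finset G}
    (hF : F.Nonempty) : finEntropyAt S μ (e ∘ α) F = finEntropyAt S μ α F := by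
  refine le_antisymm ?_ (finEntropyAt_comp_le S μ hα e.injective hF)
  have := finEntropyAt_comp_le S μ (hα.comp e) e.symm.injective hF
  rwa [← Function.comp_assoc, Equiv.symm_comp_self, Function.id_comp] at this

/-- An `F`-name is a function of the `F'`-name, and pushing forward contracts the `ℓ¹` distance. -/
theorem finEntropyAt_anti [Fintype A] (S : MapSequence G) (μ : Measure X)
    [IsProbabilityMeasure μ] {α : X → A}
    (hα : IsMeasurablePartition α) {F F' : Finset G} (h : F ⊆ F') :
    finEntropyAt S μ α F' ≤ finEntropyAt S μ α F := by
  refine iInf₂_mono fun ε hε => ?_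
  have := finEntropyEps_le_of_ncard_le S μ μ (α := α) (β := α) (F := F') (F' := F) (ε := ε)
    (ε' := ε) (c := 0) (Eventually.of_forall fun i => by
      simp only [mul_zero, Real.exp_zero, mul_one, Nat.cast_le]
      refine Set.ncard_le_ncard fun β hβ => ?_
      rw [mem_approxPartitions] at hβ ⊢
      exact (l1_comp_le μ (unif (S.m i)) (hα.pname F')
        (isMeasurablePartition_fin (mname (S.σ i) F' β)) fun φ (f : F) => φ ⟨f, h f.2⟩).trans hβ)
  simpa using this

end

/-! ### Almost all points are good -/

section Sofic

variable {G : Type*} [Group G]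

/-- The points at which `σ` fails to behave like a free action with respect to `D`, in terms of
inverse permutations. -/
def badSet {m : ℕ} (σ : G → Equiv.Perm (Fin m)) (D : Finset G) : Set (Fin m) :=
  {v | (σ 1).symm v ≠ v ∨ ∃ d ∈ D, ∃ e ∈ D, (σ e).symm ((σ d).symm v) ≠ (σ (d * e)).symm v ∨
    (d ≠ e ∧ (σ d).symm v = (σ e).symm v)}

/-- Good behaviour is formulated with `σ`, names with its inverses. If `σ(d)⁻¹ v` and `σ(e)⁻¹ σ(d)⁻¹
v` are all good, the relations there give the inverse relations at `v`. So a bad point is an image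
of a point that is not good under one of finitely many permutations. -/
theorem badSet_subset {m : ℕ} (σ : G → Equiv.Perm (Fin m)) (D : Finset G) :
    badSet σ D ⊆ ⋃ p ∈ insert 1 D ×ˢ insert 1 D,
      (σ p.1 '' (goodSet σ (insert 1 D : Finset G))ᶜ ∪
        (σ p.1 * σ p.2 : Equiv.Perm _) '' (goodSet σ (insert 1 D : Finset G))ᶜ) := by
  intro v hv
  simp only [Set.mem_iUnion]
  by_contra! hcon
  have hgood : ∀ d ∈ insert 1 D, (σ d).symm v ∈ goodSet σ (insert 1 D : Finset G) := by
    intro d hd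
    by_contra hnot
    exact hcon (d, d) (Finset.mk_mem_product hd hd) (.inl ⟨_, hnot, by simp⟩)
  have hgood2 : ∀ d ∈ insert 1 D, ∀ e ∈ insert 1 D,
      (σ e).symm ((σ d).symm v) ∈ goodSet σ (insert 1 D : Finset G) := by
    intro d hd e he
    by_contra hnot
    exact hcon (d, e) (Finset.mk_mem_product hd he) (.inr ⟨_, hnot, by simp⟩)
  have h1 : (1 : G) ∈ insert 1 D := Finset.mem_insert_self _ _
  rcases hv with hv | ⟨d, hd, e, he, hv | ⟨hde, hv⟩⟩
  · have := (hgood 1 h1 1 (by simp) 1 (by simp)).1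
    simp only [Equiv.apply_symm_apply, mul_one] at this
    exact hv ((σ 1).symm_apply_eq.2 this.symm)
  · have hd' := Finset.mem_insert_of_mem (b := (1 : G)) hd
    have he' := Finset.mem_insert_of_mem (b := (1 : G)) he
    have := (hgood2 d hd' e he' d (Finset.mem_coe.2 hd') e (Finset.mem_coe.2 he')).1
    simp only [Equiv.apply_symm_apply] at this
    exact hv ((σ (d * e)).symm_apply_eq.2 this).symm
  · have hd' := Finset.mem_insert_of_mem (b := (1 : G)) hd
    have he' := Finset.mem_insert_of_mem (b := (1 : G)) he
    have := (hgood d hd' d (Finset.mem_coe.2 hd') e (Finset.mem_coe.2 he')).2 hde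
    rw [Equiv.apply_symm_apply, hv, Equiv.apply_symm_apply] at this
    exact this rfl

theorem goodSet_anti {m : ℕ} (σ : G → Equiv.Perm (Fin m)) {F F' : Set G} (h : F ⊆ F') :
    goodSet σ F' ⊆ goodSet σ F :=
  fun _ hv f₁ h₁ f₂ h₂ => hv f₁ (h h₁) f₂ (h h₂)

theorem MapSequence.IsSofic.eventually_goodSet {S : MapSequence G} (hS : S.IsSofic)
    (D : Finset G) {δ : ℝ} (hδ : 0 < δ) :
    ∀ᶠ i in atTop, (unif (S.m i)).real (goodSet (S.σ i) D)ᶜ ≤ δ := by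
  obtain ⟨F, ε, hF, hU, hε, happ⟩ := hS
  have hmono : Monotone F := monotone_nat_of_le_succ hF
  have hsub : ∀ᶠ i in atTop, (D : Set G) ⊆ F i := by
    have : ∀ d ∈ D, ∀ᶠ i in atTop, d ∈ F i := by
      intro d _
      obtain ⟨i, hi⟩ := Set.mem_iUnion.1 (hU ▸ Set.mem_univ d)
      exact eventually_atTop.2 ⟨i, fun j hj => hmono hj hi⟩
    exact ((Finset.eventually_all D).2 this).mono fun i hi d hd => hi d hd
  filter_upwards [hsub, hε.eventually_le_const hδ] with i hi hεi
  rw [probReal_compl_eq_one_sub MeasurableSet.of_discrete]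
  have h1 : (unif (S.m i)).real (goodSet (S.σ i) (F i)) ≤ (unif (S.m i)).real (goodSet (S.σ i) D) :=
    measureReal_mono (goodSet_anti _ hi)
  have hm : (0 : ℝ) < S.m i := Nat.cast_pos.2 (S.one_le_m i)
  have h2 : 1 - ε i ≤ (unif (S.m i)).real (goodSet (S.σ i) (F i)) := by
    rw [unif_real, le_div_iff₀ hm]
    exact happ i
  linarith

/-- The number of images covering the bad set depends on `D` alone, and permutations preserve the
uniform measure. -/
theorem MapSequence.IsSofic.eventually_badSet {S : MapSequence G} (hS : S.IsSofic)
    (D : Finset G) {δ : ℝ} (hδ : 0 < δ) :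
    ∀ᶠ i in atTop, (unif (S.m i)).real (badSet (S.σ i) D) ≤ δ := by
  set n : ℝ := ((insert 1 D ×ˢ insert 1 D).card : ℝ)
  have hn : 0 < n := Nat.cast_pos.2 (Finset.card_pos.2 ⟨(1, 1), by simp⟩)
  filter_upwards [hS.eventually_goodSet (insert 1 D) (δ := δ / (2 * n)) (by positivity)] with i hi
  refine (measureReal_mono (badSet_subset _ _) (measure_ne_top _ _)).trans
    ((measureReal_biUnion_finset_le _ _).trans ?_)
  have : ∀ p ∈ insert 1 D ×ˢ insert 1 D, (unif (S.m i)).real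
      (S.σ i p.1 '' (goodSet (S.σ i) (insert 1 D : Finset G))ᶜ ∪
        (S.σ i p.1 * S.σ i p.2 : Equiv.Perm _) '' (goodSet (S.σ i) (insert 1 D : Finset G))ᶜ) ≤
      2 * (δ / (2 * n)) := by
    intro p _
    refine (measureReal_union_le _ _).trans ?_
    rw [unif_real_image, unif_real_image]
    linarith
  refine (Finset.sum_le_card_nsmul _ _ _ this).trans ?_
  rw [nsmul_eq_mul]
  change n * (2 * (δ / (2 * n))) ≤ δ
  field_simp
  exact le_refl _

end Sofic

/-! ### Random words -/

section Random

variable {G B : Type*} [Group G] [Fintype B] {m : ℕ}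

/-- Independent letters: the probability that a random word has prescribed letters at distinct
places. -/
theorem sum_prod_mul_indicator {J : Type*} [Fintype J] (κ : B → ℝ) (hκ : ∑ b, κ b = 1)
    {u : J → Fin m} (hu : Function.Injective u) (c : J → B) :
    ∑ β : Fin m → B, (∏ v, κ (β v)) * (if ∀ j, β (u j) = c j then 1 else 0) = ∏ j, κ (c j) := by
  -- The letters allowed at the site `v`: all of them off the range of `u`, and by injectivity
  -- exactly `c j` at `u j`.
  set t : Fin m → Finset B := fun v => Finset.univ.filter fun b => ∀ j, u j = v → b = c j
  have h1 : ∑ β : Fin m → B, (∏ v, κ (β v)) * (if ∀ j, β (u j) = c j then 1 else 0) =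
      ∑ β ∈ Fintype.piFinset t, ∏ v, κ (β v) := by
    simp only [mul_ite, mul_one, mul_zero]
    rw [← Finset.sum_filter]
    refine Finset.sum_congr ?_ fun _ _ => rfl
    ext β
    simp only [Finset.mem_filter, Finset.mem_univ, true_and, Fintype.mem_piFinset, t]
    exact ⟨fun h v j hj => hj ▸ h j, fun h j => h _ j rfl⟩
  rw [h1, ← Finset.prod_univ_sum]
  symm
  refine Fintype.prod_of_injective u hu _ _ ?_ ?_
  · intro v hv
    have : t v = Finset.univ := by
      ext b
      simp only [t, Finset.mem_filter, Finset.mem_univ, true_and, iff_true]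
      exact fun j hj => absurd ⟨j, hj⟩ hv
    rw [this, hκ]
  · intro j
    have : t (u j) = {c j} := by
      ext b
      simp only [t, Finset.mem_filter, Finset.mem_univ, true_and, Finset.mem_singleton]
      exact ⟨fun h => h j rfl, fun h j' hj' => by rw [h, hu hj']⟩
    rw [this, Finset.sum_singleton]

theorem sum_prod_eq_one (κ : B → ℝ) (hκ : ∑ b, κ b = 1) (m : ℕ) :
    ∑ β : Fin m → B, ∏ v, κ (β v) = 1 := by
  have := sum_prod_mul_indicator (m := m) (J := PEmpty.{1}) κ hκ
    (u := PEmpty.elim) (fun a => a.elim) PEmpty.elim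
  simpa using this

theorem injective_of_notMem_badSet {σ : G → Equiv.Perm (Fin m)} {F : Finset G} {v : Fin m}
    (hv : v ∉ badSet σ F) : Function.Injective fun f : F => (σ f).symm v := by
  intro f f' h
  by_contra hne
  exact hv (.inr ⟨f, f.2, f', f'.2, .inr ⟨fun h' => hne (Subtype.ext h'), h⟩⟩)

/-- The covariance of the occurrences of a name at two good points without common sites
vanishes. -/
theorem covariance_eq_zero (κ : B → ℝ) (hκ : ∑ b, κ b = 1) (σ : G → Equiv.Perm (Fin m))
    (F : Finset G) (φ : F → B) {v w : Fin m} (hv : v ∉ badSet σ F) (hw : w ∉ badSet σ F)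
    (hvw : ∀ f f' : F, (σ f).symm v ≠ (σ f').symm w) :
    ∑ β : Fin m → B, (∏ x, κ (β x)) *
      (((if mname σ F β v = φ then 1 else 0) - ∏ f, κ (φ f)) *
        ((if mname σ F β w = φ then 1 else 0) - ∏ f, κ (φ f))) = 0 := by
  set p := ∏ f, κ (φ f)
  have hone : ∀ v, v ∉ badSet σ F →
      ∑ β : Fin m → B, (∏ x, κ (β x)) * (if mname σ F β v = φ then 1 else 0) = p := by
    intro v hv
    refine Eq.trans ?_ (sum_prod_mul_indicator κ hκ (injective_of_notMem_badSet hv) φ)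
    simp only [mname, funext_iff]
  have htwo : ∑ β : Fin m → B, (∏ x, κ (β x)) *
      ((if mname σ F β v = φ then 1 else 0) * (if mname σ F β w = φ then 1 else 0)) = p * p := by
    have hu : Function.Injective
        (Sum.elim (fun f : F => (σ f).symm v) (fun f : F => (σ f).symm w)) :=
      (injective_of_notMem_badSet hv).sumElim (injective_of_notMem_badSet hw) hvw
    have := sum_prod_mul_indicator κ hκ hu (Sum.elim φ φ)
    rw [Fintype.prod_sum_type] at this
    simp only [Sum.elim_inl, Sum.elim_inr, Sum.forall] at this
    rw [← this]
    refine Finset.sum_congr rfl fun β _ => ?_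
    congr 1
    simp only [mname, funext_iff, ite_and]
    split_ifs <;> simp
  have hexp : ∀ β : Fin m → B, (∏ x, κ (β x)) *
      (((if mname σ F β v = φ then 1 else 0) - p) * ((if mname σ F β w = φ then 1 else 0) - p)) =
      (∏ x, κ (β x)) *
        ((if mname σ F β v = φ then 1 else 0) * (if mname σ F β w = φ then 1 else 0)) -
      ((∏ x, κ (β x)) * (if mname σ F β v = φ then 1 else 0)) * p -
      ((∏ x, κ (β x)) * (if mname σ F β w = φ then 1 else 0)) * p + (∏ x, κ (β x)) * (p * p) := by
    intro β; ring
  simp only [hexp]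
  rw [Finset.sum_add_distrib, Finset.sum_sub_distrib, Finset.sum_sub_distrib, ← Finset.sum_mul,
    ← Finset.sum_mul, ← Finset.sum_mul, htwo, hone v hv, hone w hw, sum_prod_eq_one κ hκ]
  ring

/-- Expand the square over pairs `(v, w)`. Pairs of good points without a common site contribute
zero, and every other pair at most one. Pairs with a bad point number at most `2 m` times the bad
points. Pairs sharing a site number at most `|F|² m`, since `v`, `f` and `f'` determine `w`. The
coefficients `c` serve to select the points with a given name in a fixed first coordinate. -/
theorem second_moment_le (κ : B → ℝ) (hκ0 : ∀ b, 0 ≤ κ b) (hκ : ∑ b, κ b = 1)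
    (σ : G → Equiv.Perm (Fin m)) (F : Finset G) (φ : F → B) (c : Fin m → ℝ)
    (hc : ∀ v, |c v| ≤ 1) :
    ∑ β : Fin m → B, (∏ x, κ (β x)) *
      (∑ v, c v * ((if mname σ F β v = φ then 1 else 0) - ∏ f, κ (φ f))) ^ 2 ≤
      2 * m * (badSet σ F).ncard + F.card ^ 2 * m := by
  set p := ∏ f, κ (φ f)
  have hκ1 : ∀ b, κ b ≤ 1 := fun b =>
    hκ ▸ Finset.single_le_sum (fun b _ => hκ0 b) (Finset.mem_univ b)
  have hp0 : 0 ≤ p := Finset.prod_nonneg fun _ _ => hκ0 _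
  have hp1 : p ≤ 1 := Finset.prod_le_one (fun _ _ => hκ0 _) fun _ _ => hκ1 _
  have hY : ∀ (β : Fin m → B) v, |(if mname σ F β v = φ then (1 : ℝ) else 0) - p| ≤ 1 := by
    intro β v
    split_ifs <;> rw [abs_le] <;> constructor <;> linarith
  set I : Fin m → ℝ := fun v => if v ∈ badSet σ F then 1 else 0
  set E : Fin m → Fin m → ℝ := fun v w => ∑ f : F, ∑ f' : F,
    if w = σ f' ((σ f).symm v) then 1 else 0
  have hE0 : ∀ v w, 0 ≤ E v w := fun v w =>
    Finset.sum_nonneg fun _ _ => Finset.sum_nonneg fun _ _ => by split_ifs <;> norm_num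
  have hI0 : ∀ v, 0 ≤ I v := fun v => by dsimp only [I]; split_ifs <;> norm_num
  have hpair : ∀ v w, ∑ β : Fin m → B, (∏ x, κ (β x)) *
      (c v * ((if mname σ F β v = φ then 1 else 0) - p) *
        (c w * ((if mname σ F β w = φ then 1 else 0) - p))) ≤ I v + I w + E v w := by
    intro v w
    by_cases hnice : v ∉ badSet σ F ∧ w ∉ badSet σ F ∧ ∀ f f' : F, (σ f).symm v ≠ (σ f').symm w
    · obtain ⟨hv, hw, hvw⟩ := hnice
      have h0 := covariance_eq_zero κ hκ σ F φ hv hw hvw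
      have : ∑ β : Fin m → B, (∏ x, κ (β x)) *
          (c v * ((if mname σ F β v = φ then 1 else 0) - p) *
            (c w * ((if mname σ F β w = φ then 1 else 0) - p))) = 0 := by
        refine Eq.trans ?_ (mul_eq_zero_of_right (c v * c w) h0)
        rw [Finset.mul_sum]
        refine Finset.sum_congr rfl fun β _ => ?_
        simp only [p]
        ring
      rw [this]
      have := hE0 v w
      have h1 : 0 ≤ I v := hI0 _
      have h2 : 0 ≤ I w := hI0 _
      linarith
    · have hle : ∑ β : Fin m → B, (∏ x, κ (β x)) *
          (c v * ((if mname σ F β v = φ then 1 else 0) - p) *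
            (c w * ((if mname σ F β w = φ then 1 else 0) - p))) ≤ 1 := by
        refine le_of_le_of_eq ?_ (sum_prod_eq_one κ hκ m)
        refine Finset.sum_le_sum fun β _ => ?_
        refine mul_le_of_le_one_right (Finset.prod_nonneg fun _ _ => hκ0 _) ?_
        refine (le_abs_self _).trans ?_
        rw [abs_mul, abs_mul, abs_mul]
        have a1 := mul_le_one₀ (hc v) (abs_nonneg _) (hY β v)
        have a2 := mul_le_one₀ (hc w) (abs_nonneg _) (hY β w)
        exact mul_le_one₀ a1 (by positivity) a2
      refine hle.trans ?_
      have h1 : 0 ≤ I v := hI0 _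
      have h2 : 0 ≤ I w := hI0 _
      have h3 := hE0 v w
      by_cases hv : v ∈ badSet σ F
      · have : I v = 1 := by simp [I, hv]
        linarith
      by_cases hw : w ∈ badSet σ F
      · have : I w = 1 := by simp [I, hw]
        linarith
      have : ∃ f f' : F, (σ f).symm v = (σ f').symm w := by
        by_contra! hcon
        exact hnice ⟨hv, hw, hcon⟩
      obtain ⟨f, f', hff⟩ := this
      have hE1 : 1 ≤ E v w := by
        calc (1 : ℝ) = if w = σ f' ((σ f).symm v) then 1 else 0 := by
              rw [if_pos (by rw [hff, Equiv.apply_symm_apply])]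
          _ ≤ ∑ f' : F, if w = σ f' ((σ f).symm v) then (1 : ℝ) else 0 :=
              Finset.single_le_sum (f := fun f' : F => if w = σ f' ((σ f).symm v) then (1 : ℝ) else 0)
                (fun _ _ => by split_ifs <;> norm_num) (Finset.mem_univ f')
          _ ≤ E v w := Finset.single_le_sum
                (f := fun f : F => ∑ f' : F, if w = σ f' ((σ f).symm v) then (1 : ℝ) else 0)
                (fun _ _ => Finset.sum_nonneg fun _ _ => by split_ifs <;> norm_num)
                (Finset.mem_univ f)
      linarith
  have hI : ∑ v, I v = (badSet σ F).ncard := by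
    simp only [I]
    rw [Finset.sum_boole, ← Set.ncard_coe_finset]
    congr 2
    ext; simp
  have hE : ∀ v, ∑ w, E v w = F.card ^ 2 := by
    intro v
    simp only [E]
    rw [Finset.sum_comm]
    have : ∀ f : F, ∑ w, ∑ f' : F, (if w = σ f' ((σ f).symm v) then (1 : ℝ) else 0) = F.card := by
      intro f
      rw [Finset.sum_comm]
      simp
    simp only [this]
    simp [sq]
  calc ∑ β : Fin m → B, (∏ x, κ (β x)) *
      (∑ v, c v * ((if mname σ F β v = φ then 1 else 0) - p)) ^ 2
      = ∑ v, ∑ w, ∑ β : Fin m → B, (∏ x, κ (β x)) *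
        (c v * ((if mname σ F β v = φ then 1 else 0) - p) *
          (c w * ((if mname σ F β w = φ then 1 else 0) - p))) := by
        simp only [sq, Finset.sum_mul_sum]
        simp only [Finset.mul_sum]
        rw [Finset.sum_comm]
        refine Finset.sum_congr rfl fun v _ => ?_
        rw [Finset.sum_comm]
    _ ≤ ∑ v, ∑ w, (I v + I w + E v w) :=
        Finset.sum_le_sum fun v _ => Finset.sum_le_sum fun w _ => hpair v w
    _ = 2 * m * (badSet σ F).ncard + F.card ^ 2 * m := by
        simp only [Finset.sum_add_distrib, hE, hI, Finset.sum_const, Finset.card_univ,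
          Fintype.card_fin, nsmul_eq_mul, ← Finset.mul_sum]
        ring

end Random

/-- The product of a law of names with an independent process with one-site marginal `κ`. -/
def prodLaw {J A B : Type*} [Fintype J] (P : (J → A) → ℝ) (κ : B → ℝ) (φ : J → A × B) : ℝ :=
  P (fun j => (φ j).1) * ∏ j, κ (φ j).2

theorem sum_pi_prod {J A B : Type*} [Fintype J] [DecidableEq J] [Fintype A] [Fintype B]
    (h : (J → A) → (J → B) → ℝ) :
    ∑ φ : J → A × B, h (fun j => (φ j).1) (fun j => (φ j).2) = ∑ φ, ∑ ψ, h φ ψ := by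
  rw [← Fintype.sum_prod_type']
  exact Fintype.sum_equiv (Equiv.arrowProdEquivProdArrow J (fun _ => A) (fun _ => B)) _ _
    fun φ => rfl

theorem sum_pi_prod_eq_one {J B : Type*} [Fintype J] [DecidableEq J] [Fintype B] (κ : B → ℝ)
    (hκ : ∑ b, κ b = 1) : ∑ φ : J → B, ∏ j, κ (φ j) = 1 := by
  have h := Finset.prod_univ_sum (fun _ : J => (Finset.univ : Finset B)) (fun _ b => κ b)
  simp only [hκ, Finset.prod_const_one, Fintype.piFinset_univ] at h
  exact h.symm

/-- For each first component the common second factor sums to one. -/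
theorem l1_prodLaw {J A B : Type*} [Fintype J] [DecidableEq J] [Fintype A] [Fintype B] (P Q : (J → A) → ℝ)
    (κ : B → ℝ) (hκ0 : ∀ b, 0 ≤ κ b) (hκ : ∑ b, κ b = 1) :
    l1 (prodLaw P κ) (prodLaw Q κ) = l1 P Q := by
  unfold l1 prodLaw
  rw [sum_pi_prod fun φ ψ => |P φ * ∏ j, κ (ψ j) - Q φ * ∏ j, κ (ψ j)|]
  refine Finset.sum_congr rfl fun φ _ => ?_
  have : ∀ ψ : J → B, |P φ * ∏ j, κ (ψ j) - Q φ * ∏ j, κ (ψ j)| =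
      |P φ - Q φ| * ∏ j, κ (ψ j) := by
    intro ψ
    rw [← sub_mul, abs_mul, abs_of_nonneg (Finset.prod_nonneg fun _ _ => hκ0 _)]
  simp only [this]
  rw [← Finset.mul_sum, sum_pi_prod_eq_one κ hκ, mul_one]

/-! ### Random extensions and the product formula for finite partitions -/

section Lower

variable {G A B : Type*} [Group G] [Fintype A] [Fintype B]

theorem mname_pair_eq_iff {G A B : Type*} {m : ℕ} (σ : G → Equiv.Perm (Fin m)) (F : Finset G) (a : Fin m → A)
    (β : Fin m → B) (v : Fin m) (φ : F → A × B) :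
    mname σ F (fun x => (a x, β x)) v = φ ↔
      mname σ F a v = (fun f => (φ f).1) ∧ mname σ F β v = fun f => (φ f).2 := by
  simp only [mname, funext_iff, Prod.ext_iff]
  exact forall_and

theorem law_unif_eq_sum {m : ℕ} {C : Type*} (g : Fin m → C) (c : C) :
    law (unif m) g c = (∑ v, if g v = c then (1 : ℝ) else 0) / m := by
  rw [law, unif_real, Finset.sum_boole, ← Set.ncard_coe_finset]
  congr 3
  ext; simp

/-- For a fixed word `a`, the expected squared distance of the name frequencies of `(a, β)`, with
`β` random, from the product of the name frequencies of `a` with `κ`. -/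
theorem expected_l1_sq_le {m : ℕ} [NeZero m] (κ : B → ℝ) (hκ0 : ∀ b, 0 ≤ κ b)
    (hκ : ∑ b, κ b = 1) (σ : G → Equiv.Perm (Fin m)) (F : Finset G) (a : Fin m → A) :
    ∑ β : Fin m → B, (∏ x, κ (β x)) *
      l1 (prodLaw (law (unif m) (mname σ F a)) κ)
        (law (unif m) (mname σ F fun x => (a x, β x))) ^ 2 ≤
      ((Fintype.card (F → A × B) : ℕ) : ℝ) ^ 2 *
        (2 * (unif m).real (badSet σ F) + F.card ^ 2 / m) := by
  set N : ℝ := ((Fintype.card (F → A × B) : ℕ) : ℝ)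
  have hm : (0 : ℝ) < m := Nat.cast_pos.2 (NeZero.pos m)
  set d : (Fin m → B) → (F → A × B) → ℝ := fun β φ =>
    prodLaw (law (unif m) (mname σ F a)) κ φ - law (unif m) (mname σ F fun x => (a x, β x)) φ
  have hd : ∀ φ, ∑ β : Fin m → B, (∏ x, κ (β x)) * d β φ ^ 2 ≤
      2 * (unif m).real (badSet σ F) + F.card ^ 2 / m := by
    intro φ
    -- Only points whose `a`-name is the first component of `φ` matter; at these, the deviation of
    -- `φ` is that of its second component.
    set c : Fin m → ℝ := fun v => if mname σ F a v = (fun f => (φ f).1) then 1 else 0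
    have hc : ∀ v, |c v| ≤ 1 := fun v => by simp only [c]; split_ifs <;> norm_num
    have hsm := second_moment_le κ hκ0 hκ σ F (fun f => (φ f).2) c hc
    have hdc : ∀ β, d β φ ^ 2 = (∑ v, c v * ((if mname σ F β v = (fun f => (φ f).2) then 1 else 0) -
        ∏ f, κ (φ f).2)) ^ 2 / m ^ 2 := by
      intro β
      rw [← div_pow, ← neg_sq]
      congr 1
      simp only [d, prodLaw, law_unif_eq_sum, mname_pair_eq_iff]
      rw [neg_sub, div_mul_eq_mul_div, ← sub_div, Finset.sum_mul, ← Finset.sum_sub_distrib]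
      congr 1
      refine Finset.sum_congr rfl fun v _ => ?_
      simp only [c, ite_and]
      split_ifs <;> ring
    simp only [hdc, mul_div_assoc']
    rw [← Finset.sum_div, div_le_iff₀ (by positivity)]
    refine hsm.trans (le_of_eq ?_)
    rw [unif_real]
    field_simp
  calc ∑ β : Fin m → B, (∏ x, κ (β x)) *
      l1 (prodLaw (law (unif m) (mname σ F a)) κ)
        (law (unif m) (mname σ F fun x => (a x, β x))) ^ 2
      ≤ ∑ β : Fin m → B, (∏ x, κ (β x)) * (N * ∑ φ, d β φ ^ 2) := by
        refine Finset.sum_le_sum fun β _ => ?_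
        refine mul_le_mul_of_nonneg_left ?_ (Finset.prod_nonneg fun _ _ => hκ0 _)
        -- Cauchy–Schwarz costs one factor `N`; the second comes from summing the bound over all
        -- `φ`.
        have := sq_sum_le_card_mul_sum_sq (s := Finset.univ) (f := fun φ => |d β φ|)
        simp only [sq_abs, Finset.card_univ] at this
        exact this
    _ = N * ∑ φ, ∑ β : Fin m → B, (∏ x, κ (β x)) * d β φ ^ 2 := by
        rw [Finset.sum_comm, Finset.mul_sum]
        refine Finset.sum_congr rfl fun β _ => ?_
        rw [← Finset.mul_sum]
        ring
    _ ≤ N * ∑ φ : F → A × B, (2 * (unif m).real (badSet σ F) + F.card ^ 2 / m) := by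
        gcongr with φ _
        exact hd φ
    _ = _ := by
        rw [Finset.sum_const, nsmul_eq_mul, Finset.card_univ]
        ring

theorem mul_ncard_le_of_le_fiber {α β : Type*} [Finite α] [Finite β] (s : Set α) (t : Set β)
    (f : β → α) {c : ℝ} (hc : ∀ a ∈ s, c ≤ ({b ∈ t | f b = a}.ncard : ℝ)) :
    s.ncard * c ≤ t.ncard := by
  have := Fintype.ofFinite α
  have := Fintype.ofFinite β
  have h := Finset.card_eq_sum_card_fiberwise (f := f) (s := (t ∩ f ⁻¹' s).toFinset)
    (t := s.toFinset) (fun a ha => by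
      have : a ∈ t ∩ f ⁻¹' s := by simpa using ha
      simpa using this.2)
  have h2 : ((t ∩ f ⁻¹' s).ncard : ℝ) ≤ t.ncard :=
    Nat.cast_le.2 (Set.ncard_le_ncard Set.inter_subset_left)
  refine le_trans ?_ h2
  rw [Set.ncard_eq_toFinset_card', Set.ncard_eq_toFinset_card', h, Nat.cast_sum, ← nsmul_eq_mul]
  refine Finset.card_nsmul_le_sum _ _ _ fun a ha => ?_
  have ha' : a ∈ s := by simpa using ha
  refine (hc a ha').trans (le_of_eq (congrArg _ ?_))
  rw [Set.ncard_eq_toFinset_card']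
  congr 1
  ext b
  simp only [Set.mem_toFinset, Set.mem_ofPred_eq, Finset.mem_filter, Set.mem_inter_iff,
    Set.mem_preimage]
  constructor
  · rintro ⟨h1, h2⟩
    exact ⟨⟨h1, h2 ▸ ha'⟩, h2⟩
  · rintro ⟨⟨h1, -⟩, h2⟩
    exact ⟨h1, h2⟩

variable {X Y : Type*} [MulAction G X] [MeasurableSpace X] [MulAction G Y] [MeasurableSpace Y]
  [MeasurableConstSMul G Y]

/-- Most choices of a random second coordinate extend an approximating partition. -/
theorem finEntropyAt_add_le {S : MapSequence G} (hS : S.IsSofic) (μ : Measure X)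
    (ν : Measure Y) [IsProbabilityMeasure ν] [SMulInvariantMeasure G Y ν] {α : X → A}
    {γ : Y → A × B} (hγ : IsMeasurablePartition γ) (κ : B → ℝ) (hκ0 : ∀ b, 0 ≤ κ b)
    (hκ : ∑ b, κ b = 1) {F : Finset G} (hF : F.Nonempty)
    (hlaw : law ν (pname F γ) = prodLaw (law μ (pname F α)) κ)
    (hmarg : law ν (Prod.snd ∘ γ) = κ) :
    finEntropyAt S μ α F + (finH κ : EReal) ≤ finEntropyAt S ν γ F := by
  refine le_iInf₂ fun ε hε => ?_
  suffices h : finEntropyAt S μ α F ≤ finEntropyEps S ν γ F ε + ((-finH κ : ℝ) : EReal) by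
    have h' := add_le_add_left h (finH κ : EReal)
    rwa [add_assoc, ← EReal.coe_add, neg_add_cancel, EReal.coe_zero, add_zero] at h'
  refine ereal_le_of_forall_pos_le_add fun η hη => ?_
  obtain ⟨ε₀, hε₀, hprod⟩ := exists_prod_le κ hκ0 (half_pos hη)
  -- The bound `ε` secures the approximation and `ε₀` the estimate on word weights. Half of `δ` is
  -- the error of the given word, half that of the random extension.
  set δ := min ε ε₀
  have hδ : 0 < δ := lt_min hε hε₀
  refine (iInf₂_le (δ / 2) (by positivity)).trans ?_
  have hmono : finEntropyEps S ν γ F δ + ((-finH κ : ℝ) : EReal) + (η : EReal) ≤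
      finEntropyEps S ν γ F ε + ((-finH κ : ℝ) : EReal) + (η : EReal) := by
    gcongr
    exact finEntropyEps_mono S ν γ F (min_le_left _ _)
  refine le_trans ?_ hmono
  rw [add_assoc, ← EReal.coe_add]
  refine finEntropyEps_le_of_ncard_le S μ ν ?_
  set N : ℝ := ((Fintype.card (F → A × B) : ℕ) : ℝ)
  -- Chosen so that the expected squared distance is at most `(δ / 2) ^ 2 / 2`, which leaves failure
  -- probability at most `1 / 2` in Chebyshev's inequality.
  set τ : ℝ := (δ / 2) ^ 2 / (2 * (N ^ 2 + 1))
  have hτ : 0 < τ := by positivity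
  have hm : Tendsto (fun i => (S.m i : ℝ)) atTop atTop :=
    tendsto_natCast_atTop_atTop.comp S.tendsto_m
  have hm1 : ∀ᶠ i in atTop, (F.card : ℝ) ^ 2 / S.m i ≤ τ / 2 :=
    (hm.const_div_atTop _).eventually_le_const (half_pos hτ)
  -- For large `m` the factor `1 / 2` from Chebyshev is absorbed in `exp (-m η / 2)`.
  have hm2 : ∀ᶠ i in atTop, Real.log 2 ≤ S.m i * (η / 2) :=
    (hm.atTop_mul_const (half_pos hη)).eventually_ge_atTop _
  filter_upwards [hS.eventually_badSet F (δ := τ / 4) (by positivity), hm1, hm2] with i hbad h1 h2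
  suffices h : ((approxPartitions μ (S.σ i) F α (δ / 2)).ncard : ℝ) *
      Real.exp (S.m i * (finH κ - η)) ≤ (approxPartitions ν (S.σ i) F γ δ).ncard by
    have e : S.m i * (-finH κ + η) = -(S.m i * (finH κ - η)) := by ring
    rw [e, Real.exp_neg, ← div_eq_mul_inv, le_div_iff₀ (Real.exp_pos _)]
    exact h
  refine mul_ncard_le_of_le_fiber _ _ (fun c => Prod.fst ∘ c) fun a ha => ?_
  rw [mem_approxPartitions] at ha
  set W : (Fin (S.m i) → B) → ℝ := fun β => ∏ x, κ (β x)
  have hW0 : ∀ β, 0 ≤ W β := fun β => Finset.prod_nonneg fun _ _ => hκ0 _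
  set ℓ : (Fin (S.m i) → B) → ℝ := fun β =>
    l1 (prodLaw (law (unif (S.m i)) (mname (S.σ i) F a)) κ)
      (law (unif (S.m i)) (mname (S.σ i) F fun x => (a x, β x)))
  have hexp : ∑ β, W β * ℓ β ^ 2 ≤ (δ / 2) ^ 2 / 2 := by
    refine (expected_l1_sq_le κ hκ0 hκ (S.σ i) F a).trans ?_
    have : 2 * (unif (S.m i)).real (badSet (S.σ i) F) + (F.card : ℝ) ^ 2 / S.m i ≤ τ := by linarith
    calc _ ≤ N ^ 2 * τ := by gcongr
      _ ≤ (N ^ 2 + 1) * τ := by gcongr; linarith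
      _ = (δ / 2) ^ 2 / 2 := by simp only [τ]; field_simp
  set T : Finset (Fin (S.m i) → B) := Finset.univ.filter fun β => ℓ β ≤ δ / 2
  have hT : 1 / 2 ≤ ∑ β ∈ T, W β := by
    have hsplit : ∑ β ∈ T, W β + ∑ β ∈ Tᶜ, W β = 1 := by
      rw [Finset.sum_add_sum_compl]
      exact sum_prod_eq_one κ hκ _
    have hc : (∑ β ∈ Tᶜ, W β) * (δ / 2) ^ 2 ≤ (δ / 2) ^ 2 / 2 := by
      refine le_trans ?_ hexp
      rw [Finset.sum_mul]
      refine (Finset.sum_le_sum fun β hβ => ?_).trans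
        (Finset.sum_le_sum_of_subset_of_nonneg (Finset.subset_univ _)
          fun β _ _ => mul_nonneg (hW0 β) (sq_nonneg _))
      have : δ / 2 < ℓ β := by simpa [T] using hβ
      refine mul_le_mul_of_nonneg_left ?_ (hW0 β)
      exact pow_le_pow_left₀ (by positivity) this.le 2
    have : ∑ β ∈ Tᶜ, W β ≤ 1 / 2 := by
      have hpos : 0 < (δ / 2) ^ 2 := by positivity
      refine le_of_mul_le_mul_right (hc.trans (le_of_eq ?_)) hpos
      ring
    linarith
  have hmem : ∀ β ∈ T, (fun x => (a x, β x)) ∈ approxPartitions ν (S.σ i) F γ δ := by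
    intro β hβ
    have hβ' : ℓ β ≤ δ / 2 := by simpa [T] using hβ
    rw [mem_approxPartitions, hlaw]
    refine (l1_triangle _ (prodLaw (law (unif (S.m i)) (mname (S.σ i) F a)) κ) _).trans ?_
    rw [l1_prodLaw _ _ κ hκ0 hκ]
    change _ + ℓ β ≤ δ
    linarith
  -- The letters of a successful `β` have frequencies close to `κ`, so no single such word carries
  -- much of the total weight `1 / 2`.
  have hWle : ∀ β ∈ T, W β ≤ Real.exp (-(S.m i * (finH κ - η / 2))) := by
    intro β hβ
    refine hprod (S.m i) β ?_
    have h3 := (mem_approxPartitions _ _ _ _ _ _).1 (hmem β hβ)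
    have h4 := l1_law_le_l1_name ν (S.σ i) hF hγ fun x => (a x, β x)
    have h5 := l1_comp_le ν (unif (S.m i)) hγ
      (isMeasurablePartition_fin fun x => (a x, β x)) Prod.snd
    rw [hmarg] at h5
    exact (h5.trans (h4.trans h3)).trans (min_le_right _ _)
  have hcard : Real.exp (S.m i * (finH κ - η)) ≤ T.card := by
    have h3 := hT.trans (Finset.sum_le_card_nsmul _ _ _ hWle)
    rw [nsmul_eq_mul, Real.exp_neg, ← div_eq_mul_inv, le_div_iff₀ (Real.exp_pos _)] at h3
    refine le_trans ?_ h3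
    have e : S.m i * (finH κ - η) = -(S.m i * (η / 2)) + S.m i * (finH κ - η / 2) := by ring
    rw [e, Real.exp_add]
    refine mul_le_mul_of_nonneg_right ?_ (Real.exp_pos _).le
    calc Real.exp (-(S.m i * (η / 2))) ≤ Real.exp (-Real.log 2) :=
          Real.exp_le_exp.2 (neg_le_neg h2)
      _ = 1 / 2 := by rw [Real.exp_neg, Real.exp_log two_pos, one_div]
  refine hcard.trans (Nat.cast_le.2 ?_)
  rw [← Set.ncard_coe_finset]
  refine Set.ncard_le_ncard_of_injOn (fun β x => (a x, β x)) ?_ ?_ (Set.toFinite _)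
  · intro β hβ
    exact ⟨hmem β hβ, rfl⟩
  · intro β _ β' _ h
    ext x
    exact (Prod.ext_iff.1 (congrFun h x)).2

theorem finH_prod (p : A → ℝ) (κ : B → ℝ) (hp : ∑ a, p a = 1) (hκ : ∑ b, κ b = 1) :
    finH (fun x : A × B => p x.1 * κ x.2) = finH p + finH κ := by
  unfold finH
  rw [Fintype.sum_prod_type]
  simp only [Real.negMulLog_mul, Finset.sum_add_distrib, ← Finset.sum_mul, ← Finset.mul_sum, hp,
    hκ, one_mul]

/-- Adding an independent Bernoulli coordinate raises the entropy by the entropy of the base. -/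
theorem finEntropyAt_prod {S : MapSequence G} (hS : S.IsSofic) (μ : Measure X)
    [IsProbabilityMeasure μ] (ν : Measure Y) [IsProbabilityMeasure ν] [SMulInvariantMeasure G Y ν]
    {α : X → A} {γ : Y → A × B} (hα : IsMeasurablePartition α) (hγ : IsMeasurablePartition γ)
    (κ : B → ℝ) (hκ0 : ∀ b, 0 ≤ κ b)
    (hκ : ∑ b, κ b = 1) {F : Finset G} (hF : F.Nonempty)
    (hlaw : law ν (pname F γ) = prodLaw (law μ (pname F α)) κ)
    (hone : ∀ a b, law ν γ (a, b) = law μ α a * κ b) :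
    finEntropyAt S ν γ F = finEntropyAt S μ α F + (finH κ : EReal) := by
  have hfst : law ν (Prod.fst ∘ γ) = law μ α := by
    rw [law_comp ν hγ]
    ext a
    rw [push, Finset.sum_filter, Fintype.sum_prod_type]
    simp only [hone]
    rw [Finset.sum_eq_single a (fun a' _ h => by simp [h]) (by simp)]
    simp [← Finset.mul_sum, hκ]
  have hmarg : law ν (Prod.snd ∘ γ) = κ := by
    rw [law_comp ν hγ]
    ext b
    rw [push, Finset.sum_filter, Fintype.sum_prod_type]
    simp [hone, ← Finset.sum_mul, sum_law μ hα]
  refine le_antisymm ?_ (finEntropyAt_add_le hS μ ν hγ κ hκ0 hκ hF hlaw hmarg)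
  -- By independence, the conditional entropy in the upper bound is exactly the entropy of the base.
  have hH : finH (law ν γ) - finH (law ν (Prod.fst ∘ γ)) = finH κ := by
    have : law ν γ = fun x : A × B => law μ α x.1 * κ x.2 := by
      ext ⟨a, b⟩; exact hone a b
    rw [this, hfst, finH_prod _ _ (sum_law μ hα) hκ]
    ring
  have hname : law ν (pname F (Prod.fst ∘ γ)) = law μ (pname F α) := by
    have : law ν (pname F (Prod.fst ∘ γ)) = push (fun φ f => (φ f).1) (law ν (pname F γ)) :=
      law_comp ν (hγ.pname F) (fun φ f => (φ f).1)
    rw [this, hlaw]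
    ext φ
    unfold push prodLaw
    rw [Finset.sum_filter]
    refine (sum_pi_prod fun φ' ψ =>
      @ite _ (φ' = φ) (Classical.propDecidable _)
        (law μ (pname F α) φ' * ∏ j, κ (ψ j)) 0).trans ?_
    rw [Finset.sum_eq_single φ (fun φ' _ h => by simp [h]) (by simp)]
    simp only [if_true]
    rw [← Finset.mul_sum, sum_pi_prod_eq_one κ hκ, mul_one]
  rw [← finEntropyAt_congr S ν μ (Prod.fst ∘ γ) α F hname, finEntropyAt]
  have key : ∀ ε : ℝ, 0 < ε → finEntropyAt S ν γ F ≤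
      finEntropyEps S ν (Prod.fst ∘ γ) F ε + (finH κ : EReal) := by
    intro ε hε
    have := finEntropyAt_le_of_coarsening S ν hγ (α' := Prod.fst ∘ γ) Prod.fst hF hε
      (by simp [l1]; positivity)
    rwa [hH] at this
  rw [finEntropyAt]
  have h1 : finEntropyAt S ν γ F ≤ (⨅ ε : {ε : ℝ // 0 < ε},
      finEntropyEps S ν (Prod.fst ∘ γ) F ε) + (finH κ : EReal) :=
    ereal_le_iInf_add fun ε => key ε ε.2
  rwa [iInf_subtype] at h1

end Lower

/-! ### Countable partitions and their finite coarsenings -/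

section Coarsening

variable {X ι : Type*} [MeasurableSpace X] [Countable ι]

theorem hasSum_law (μ : Measure X) [IsFiniteMeasure μ] {α : X → ι}
    (hα : IsMeasurablePartition α) (T : Set ι) :
    HasSum (fun t => if t ∈ T then law μ α t else 0) (μ.real (α ⁻¹' T)) := by
  have hU : α ⁻¹' T = ⋃ t, α ⁻¹' ({t} ∩ T) := by ext; simp
  have hm : μ (α ⁻¹' T) = ∑' t, μ (α ⁻¹' ({t} ∩ T)) := by
    rw [hU, measure_iUnion]
    · intro t t' h
      exact Disjoint.preimage α ((Set.disjoint_singleton.2 h).mono Set.inter_subset_left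
        Set.inter_subset_left)
    · exact fun t => hα.preimage _
  have := ENNReal.hasSum_toReal (f := fun t => μ (α ⁻¹' ({t} ∩ T))) (hm ▸ measure_ne_top μ _)
  rw [← ENNReal.tsum_toReal_eq (fun t => measure_ne_top μ _), ← hm] at this
  change HasSum _ (μ (α ⁻¹' T)).toReal
  convert this using 1
  ext t
  split_ifs with ht
  · rw [Set.inter_eq_left.2 (Set.singleton_subset_iff.2 ht)]
    rfl
  · rw [Set.singleton_inter_eq_empty.2 ht]
    simp

theorem summable_law (μ : Measure X) [IsFiniteMeasure μ] {α : X → ι}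
    (hα : IsMeasurablePartition α) : Summable (law μ α) := by
  simpa using (hasSum_law μ hα Set.univ).summable

theorem law_le_one (μ : Measure X) [IsProbabilityMeasure μ] {A : Type*} (g : X → A) (a : A) :
    law μ g a ≤ 1 := measureReal_le_one

theorem law_le_law_comp {ι : Type*} (μ : Measure X) [IsFiniteMeasure μ] {A : Type*} (α : X → ι) (j : ι → A)
    (t : ι) : law μ α t ≤ law μ (j ∘ α) (j t) := by
  refine measureReal_mono ?_
  rintro x rfl
  simp

/-- The Shannon entropy of a countable partition as a real number. -/
def realEntropy {ι : Type*} (μ : Measure X) (α : X → ι) : ℝ := ∑' t, Real.negMulLog (law μ α t)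

theorem negMulLog_law_nonneg {A : Type*} (μ : Measure X) [IsProbabilityMeasure μ] (α : X → A)
    (t : A) : 0 ≤ Real.negMulLog (law μ α t) :=
  Real.negMulLog_nonneg (law_nonneg _ _ _) (law_le_one _ _ _)

theorem summable_negMulLog_law {ι : Type*} (μ : Measure X) [IsProbabilityMeasure μ] {α : X → ι}
    (hH : partitionEntropy μ α < ⊤) : Summable fun t => Real.negMulLog (law μ α t) := by
  have := ENNReal.summable_toReal (f := fun t => ENNReal.ofReal (Real.negMulLog (law μ α t))) hH.ne
  simpa only [ENNReal.toReal_ofReal (negMulLog_law_nonneg μ α _)] using this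

theorem partitionEntropy_eq_ofReal {ι : Type*} (μ : Measure X) [IsProbabilityMeasure μ] {α : X → ι}
    (hH : partitionEntropy μ α < ⊤) : partitionEntropy μ α = ENNReal.ofReal (realEntropy μ α) :=
  (ENNReal.ofReal_tsum_of_nonneg (negMulLog_law_nonneg μ α) (summable_negMulLog_law μ hH)).symm

theorem realEntropy_nonneg {ι : Type*} (μ : Measure X) [IsProbabilityMeasure μ] (α : X → ι) :
    0 ≤ realEntropy μ α := tsum_nonneg (negMulLog_law_nonneg μ α)

variable {A : Type*} [Fintype A]

/-- The entropy of a coarsening is spread over the labels of `α`, each paying for the merged atom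
containing it. All coarsenings thus become series over one index set, ready for dominated
convergence. -/
theorem hasSum_finH_comp (μ : Measure X) [IsProbabilityMeasure μ] {α : X → ι}
    (hα : IsMeasurablePartition α) (j : ι → A) :
    HasSum (fun t => law μ α t * -Real.log (law μ (j ∘ α) (j t))) (finH (law μ (j ∘ α))) := by
  have h : ∀ s : A, HasSum
      (fun t => (if t ∈ j ⁻¹' {s} then law μ α t else 0) * -Real.log (law μ (j ∘ α) s))
      (law μ (j ∘ α) s * -Real.log (law μ (j ∘ α) s)) :=
    fun s => (hasSum_law μ hα (j ⁻¹' {s})).mul_right _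
  have h2 := hasSum_sum (s := Finset.univ) fun s _ => h s
  convert h2 using 1
  · ext t
    rw [Finset.sum_eq_single (j t)]
    · simp
    · intro s _ hs
      simp [hs.symm]
    · simp
  · simp [finH, Real.negMulLog]

/-- A merged atom is at least as large as its parts and so has smaller information. This is the
dominating bound for the series over labels. -/
theorem law_mul_neg_log_le {ι A : Type*} (μ : Measure X) [IsProbabilityMeasure μ] (α : X → ι) (j : ι → A)
    (t : ι) : law μ α t * -Real.log (law μ (j ∘ α) (j t)) ≤ Real.negMulLog (law μ α t) := by
  rw [Real.negMulLog, neg_mul, ← mul_neg]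
  rcases (law_nonneg μ α t).eq_or_lt with h | h
  · simp [← h]
  · exact mul_le_mul_of_nonneg_left
      (neg_le_neg (Real.log_le_log h (law_le_law_comp μ α j t))) h.le

theorem finH_comp_le (μ : Measure X) [IsProbabilityMeasure μ] {α : X → ι}
    (hα : IsMeasurablePartition α) (hH : partitionEntropy μ α < ⊤) (j : ι → A) :
    finH (law μ (j ∘ α)) ≤ realEntropy μ α :=
  hasSum_le (law_mul_neg_log_le μ α j) (hasSum_finH_comp μ hα j)
    (summable_negMulLog_law μ hH).hasSum

end Coarsening

/-! ### Separating sequences of finite coarsenings -/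

section Separating

variable {X ι : Type*} [MeasurableSpace X] [Countable ι] {u : ℕ → ℕ}

/-- A sequence of finite coarsenings which eventually distinguishes any two atoms of positive
measure. -/
def IsSeparating (μ : Measure X) (α : X → ι) (j : ∀ n, ι → Fin (u n)) : Prop :=
  ∀ t t', t ≠ t' → law μ α t ≠ 0 → law μ α t' ≠ 0 → ∀ᶠ n in atTop, j n t ≠ j n t'

/-- Every other label of positive measure eventually leaves the merged atom of `t`; dominated
convergence with the summable law as majorant does the rest. -/
theorem IsSeparating.tendsto_law {μ : Measure X} [IsProbabilityMeasure μ] {α : X → ι}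
    (hα : IsMeasurablePartition α) {j : ∀ n, ι → Fin (u n)} (hj : IsSeparating μ α j) {t : ι}
    (ht : law μ α t ≠ 0) :
    Tendsto (fun n => law μ (j n ∘ α) (j n t)) atTop (𝓝 (law μ α t)) := by
  have h1 : ∀ n, law μ (j n ∘ α) (j n t) =
      ∑' t', if t' ∈ j n ⁻¹' {j n t} then law μ α t' else 0 :=
    fun n => (hasSum_law μ hα (j n ⁻¹' {j n t})).tsum_eq.symm
  have h2 : law μ α t = ∑' t', if t' = t then law μ α t' else 0 := by
    rw [tsum_ite_eq]
  rw [h2]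
  simp only [h1]
  refine tendsto_tsum_of_dominated_convergence (summable_law μ hα) ?_ ?_
  · intro t'
    by_cases htt : t' = t
    · subst htt
      simp
    · rw [if_neg htt]
      by_cases h0 : law μ α t' = 0
      · simp [h0]
      · refine tendsto_const_nhds.congr' ?_
        filter_upwards [hj t' t htt h0 ht] with n hn
        simp [hn]
  · refine Eventually.of_forall fun n t' => ?_
    rw [Real.norm_eq_abs]
    split_ifs
    · exact le_of_eq (abs_of_nonneg (law_nonneg _ _ _))
    · simpa using law_nonneg _ _ _

/-- Each label's share converges because its merged atom shrinks to it in measure, and the terms of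
the entropy series of `α` dominate. -/
theorem IsSeparating.tendsto_finH {μ : Measure X} [IsProbabilityMeasure μ] {α : X → ι}
    (hα : IsMeasurablePartition α) (hH : partitionEntropy μ α < ⊤) {j : ∀ n, ι → Fin (u n)}
    (hj : IsSeparating μ α j) :
    Tendsto (fun n => finH (law μ (j n ∘ α))) atTop (𝓝 (realEntropy μ α)) := by
  have h1 : ∀ n, finH (law μ (j n ∘ α)) =
      ∑' t, law μ α t * -Real.log (law μ (j n ∘ α) (j n t)) :=
    fun n => (hasSum_finH_comp μ hα (j n)).tsum_eq.symm
  simp only [h1]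
  refine tendsto_tsum_of_dominated_convergence (summable_negMulLog_law μ hH) ?_ ?_
  · intro t
    rw [Real.negMulLog, neg_mul, ← mul_neg]
    by_cases h0 : law μ α t = 0
    · simp [h0]
    · exact (((hj.tendsto_law hα h0).log h0).neg).const_mul _
  · refine Eventually.of_forall fun n t => ?_
    rw [Real.norm_eq_abs, abs_of_nonneg]
    · exact law_mul_neg_log_le μ α (j n) t
    · refine mul_nonneg (law_nonneg _ _ _) (neg_nonneg.2 ?_)
      exact Real.log_nonpos (law_nonneg _ _ _) (law_le_one _ _ _)

/-- Every coarsening of `α` is almost a coarsening of the late members of a separating sequence. -/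
theorem IsSeparating.exists_approx {μ : Measure X} [IsProbabilityMeasure μ] {α : X → ι}
    (hα : IsMeasurablePartition α) {j : ∀ n, ι → Fin (u n)} (hj : IsSeparating μ α j)
    {A : Type*} (a : ι → A) {δ : ℝ} (hδ : 0 < δ) :
    ∀ᶠ n in atTop, ∃ θ : Fin (u n) → A,
      μ.real {x | (a ∘ α) x ≠ (θ ∘ j n ∘ α) x} ≤ δ := by
  have hne : Nonempty X := μ.nonempty_of_neZero
  have : Nonempty ι := hne.map α
  have hs := hasSum_law μ hα Set.univ
  simp only [Set.mem_univ, if_true, Set.preimage_univ, probReal_univ] at hs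
  obtain ⟨T, hT⟩ := (hs.eventually_const_lt (show 1 - δ < 1 by linarith)).exists
  -- Null labels are dropped, since separation says nothing about them. Finitely many remaining
  -- labels carry mass above `1 - δ` and are eventually told apart by `j n`, so `a` can be read off
  -- through an inverse of `j n` on them.
  set T' := T.filter fun t => law μ α t ≠ 0
  have hT' : 1 - δ < ∑ t ∈ T', law μ α t := by rwa [Finset.sum_filter_ne_zero]
  have hinj : ∀ᶠ n in atTop, Set.InjOn (j n) T' := by
    have : ∀ t ∈ T', ∀ t' ∈ T', ∀ᶠ n in atTop, j n t = j n t' → t = t' := by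
      intro t ht t' ht'
      by_cases h : t = t'
      · exact Eventually.of_forall fun _ _ => h
      · filter_upwards [hj t t' h (Finset.mem_filter.1 ht).2 (Finset.mem_filter.1 ht').2] with n hn h'
        exact absurd h' hn
    have h2 := (Finset.eventually_all T').2 fun t ht => (Finset.eventually_all T').2 (this t ht)
    filter_upwards [h2] with n hn t ht t' ht' h
    exact hn t ht t' ht' h
  filter_upwards [hinj] with n hn
  refine ⟨a ∘ Function.invFunOn (j n) T', ?_⟩
  have hsub : {x | (a ∘ α) x ≠ ((a ∘ Function.invFunOn (j n) T') ∘ j n ∘ α) x} ⊆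
      (α ⁻¹' (T' : Set ι))ᶜ := by
    intro x hx hxT
    refine hx ?_
    simp only [Function.comp_apply]
    rw [hn.leftInvOn_invFunOn hxT]
  refine (measureReal_mono hsub).trans ?_
  rw [probReal_compl_eq_one_sub (hα.preimage _)]
  have h3 : μ.real (α ⁻¹' (T' : Set ι)) = ∑ t ∈ T', law μ α t := by
    rw [← (hasSum_law μ hα (T' : Set ι)).tsum_eq, tsum_eq_sum (s := T') fun t ht => by simp [ht]]
    exact Finset.sum_congr rfl fun t ht => by simp [ht]
  linarith

end Separating

/-! ### Chains -/

section Chain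

variable {X ι : Type*} [MeasurableSpace X] [Countable ι] {u : ℕ → ℕ}

/-- Used to identify labels: two atoms that both contain a non-null set almost everywhere must share
a point. -/
theorem inter_nonempty_of_measure_diff {μ : Measure X} {D E E' : Set X} (hD : μ D ≠ 0)
    (h : μ (D \ E) = 0) (h' : μ (D \ E') = 0) : (E ∩ E').Nonempty := by
  by_contra hcon
  refine hD (measure_mono_null (t := (D \ E) ∪ (D \ E')) ?_ (measure_union_null h h'))
  intro x hx
  by_cases hE : x ∈ E
  · exact .inr ⟨hx, fun hE' => hcon ⟨x, hE, hE'⟩⟩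
  · exact .inl ⟨hx, hE⟩

theorem measure_ne_zero_of_law {ι : Type*} {μ : Measure X} {α : X → ι} {t : ι} (h : law μ α t ≠ 0) :
    μ (α ⁻¹' {t}) ≠ 0 := fun h0 => h (by simp [law, measureReal_def, h0])

/-- The members of a chain are almost everywhere coarsenings of `α`, and they separate its
atoms. -/
theorem IsChain.exists_separating {μ : Measure X} {α : X → ι} {a : ∀ n, X → Fin (u n)}
    (ha : IsChain μ α u a) :
    ∃ j : ∀ n, ι → Fin (u n), (∀ n, a n =ᵐ[μ] j n ∘ α) ∧ IsSeparating μ α j := by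
  choose j hj using ha.le
  have hae : ∀ n, a n =ᵐ[μ] j n ∘ α := by
    intro n
    refine measure_mono_null (t := ⋃ t, α ⁻¹' {t} \ a n ⁻¹' {j n t}) ?_
      (measure_iUnion_null fun t => hj n t)
    intro x hx
    simp only [Set.mem_iUnion]
    exact ⟨α x, rfl, fun h => hx h⟩
  refine ⟨j, hae, fun t t' htt h0 h0' => ?_⟩
  -- Separation persists: equal labels at stage `n + 1` put both atoms, up to null sets, in one atom
  -- of the coarser stage `n`.
  have hstep : ∀ n, j n t ≠ j n t' → j (n + 1) t ≠ j (n + 1) t' := by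
    intro n hn heq
    obtain ⟨k, hk⟩ := ha.mono n (j (n + 1) t)
    have key : ∀ s, law μ α s ≠ 0 → j (n + 1) s = j (n + 1) t → j n s = k := by
      intro s hs hst
      have h1 : μ (α ⁻¹' {s} \ a n ⁻¹' {k}) = 0 := by
        refine measure_mono_null (t := (α ⁻¹' {s} \ a (n + 1) ⁻¹' {j (n + 1) s}) ∪
          (a (n + 1) ⁻¹' {j (n + 1) t} \ a n ⁻¹' {k})) ?_
          (measure_union_null (hj (n + 1) s) hk)
        rw [hst]
        intro x hx
        by_cases hx' : x ∈ a (n + 1) ⁻¹' {j (n + 1) t}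
        · exact .inr ⟨hx', hx.2⟩
        · exact .inl ⟨hx.1, hx'⟩
      obtain ⟨x, hx, hx'⟩ := inter_nonempty_of_measure_diff (measure_ne_zero_of_law hs) (hj n s) h1
      exact hx.symm.trans hx'
    exact hn ((key t h0 rfl).trans (key t' h0' heq.symm).symm)
  -- Were the labels never separated, both atoms would lie almost everywhere in one atom of the
  -- join, hence in a single atom of `α`.
  have hex : ∃ n, j n t ≠ j n t' := by
    by_contra! hall
    obtain ⟨k, hk⟩ := ha.join fun n => j n t
    have key : ∀ s, law μ α s ≠ 0 → (∀ n, j n s = j n t) → s = k := by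
      intro s hs hst
      have h1 : μ (α ⁻¹' {s} \ α ⁻¹' {k}) = 0 := by
        refine measure_mono_null (t := (⋃ n, α ⁻¹' {s} \ a n ⁻¹' {j n s}) ∪
          ((fun (x : X) (n : ℕ) => a n x) ⁻¹' {fun n => j n t} \ α ⁻¹' {k})) ?_
          (measure_union_null (measure_iUnion_null fun n => hj n s) hk)
        intro x hx
        by_cases hx' : ∀ n, a n x = j n t
        · exact .inr ⟨funext hx', hx.2⟩
        · push Not at hx'
          obtain ⟨n, hn⟩ := hx'
          refine .inl (Set.mem_iUnion.2 ⟨n, hx.1, fun h => hn ?_⟩)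
          rw [← hst n]
          exact h
      obtain ⟨x, hx, hx'⟩ := inter_nonempty_of_measure_diff (measure_ne_zero_of_law hs)
        (E := α ⁻¹' {s}) (by simp) h1
      exact hx.symm.trans hx'
    exact htt ((key t h0 fun _ => rfl).trans (key t' h0' fun n => (hall n).symm).symm)
  obtain ⟨n, hn⟩ := hex
  exact eventually_atTop.2 ⟨n, fun k hk => Nat.le_induction hn (fun k _ ih => hstep k ih) k hk⟩

/-- All refinements hold pointwise, so the exceptional sets are empty. A point of `X` is needed
because even an empty atom of the join must be assigned an atom of `α`. -/
theorem isChain_comp {μ : Measure X} [Nonempty X] {α : X → ι} (hα : IsMeasurablePartition α)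
    {j : ∀ n, ι → Fin (u n)} (θ : ∀ n, Fin (u (n + 1)) → Fin (u n))
    (hθ : ∀ n t, j n t = θ n (j (n + 1) t)) (hj : ∀ t t', (∀ n, j n t = j n t') → t = t') :
    IsChain μ α u fun n => j n ∘ α where
  measurable n := hα.comp (j n)
  mono n s := by
    refine ⟨θ n s, ?_⟩
    convert measure_empty (μ := μ)
    ext x
    simp only [Set.mem_sdiff, Set.mem_preimage, Function.comp_apply, Set.mem_singleton_iff,
      Set.mem_empty_iff_false, iff_false, not_and, not_not]
    rintro rfl
    exact hθ n _
  le n t := by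
    refine ⟨j n t, ?_⟩
    convert measure_empty (μ := μ)
    ext x
    simp only [Set.mem_sdiff, Set.mem_preimage, Function.comp_apply, Set.mem_singleton_iff,
      Set.mem_empty_iff_false, iff_false, not_and, not_not]
    rintro rfl
    rfl
  join z := by
    by_cases hz : ∃ x, (fun n => (j n ∘ α) x) = z
    · obtain ⟨x, rfl⟩ := hz
      refine ⟨α x, ?_⟩
      convert measure_empty (μ := μ)
      ext y
      simp only [Set.mem_sdiff, Set.mem_preimage, Set.mem_singleton_iff,
        Set.mem_empty_iff_false, iff_false, not_and, not_not]
      intro hy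
      exact hj _ _ fun n => congrFun hy n
    · refine ⟨α (Classical.arbitrary X), ?_⟩
      convert measure_empty (μ := μ)
      ext y
      simp only [Set.mem_sdiff, Set.mem_preimage, Set.mem_singleton_iff,
        Set.mem_empty_iff_false, iff_false, not_and]
      exact fun hy => absurd ⟨y, hy⟩ hz

/-- Truncation of labels. -/
def trunc (n : ℕ) (k : ℕ) : Fin (n + 1) := ⟨min k n, by omega⟩

theorem trunc_trunc {n n' : ℕ} (h : n ≤ n') (k : ℕ) : trunc n k = trunc n (trunc n' k) := by
  simp only [trunc, Fin.mk.injEq]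
  omega

theorem trunc_injective {k k' : ℕ} (h : ∀ n, trunc n k = trunc n k') : k = k' := by
  have := h (max k k')
  simp only [trunc, Fin.mk.injEq] at this
  omega

theorem isChain_trunc {μ : Measure X} [Nonempty X] {α : X → ι} (hα : IsMeasurablePartition α)
    {e : ι → ℕ} (he : Function.Injective e) :
    IsChain μ α (fun n => n + 1) fun n => (trunc n ∘ e) ∘ α :=
  isChain_comp hα (j := fun n => trunc n ∘ e) (fun n k => trunc n k)
    (fun n t => trunc_trunc n.le_succ (e t)) fun _ _ h => he (trunc_injective h)

theorem isSeparating_trunc {ι : Type*} (μ : Measure X) (α : X → ι) {e : ι → ℕ} (he : Function.Injective e) :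
    IsSeparating μ α fun n => trunc n ∘ e := by
  intro t t' h _ _
  filter_upwards [eventually_ge_atTop (max (e t) (e t'))] with n hn h'
  refine h (he ?_)
  simp only [Function.comp_apply, trunc, Fin.mk.injEq] at h'
  have := le_max_left (e t) (e t')
  have := le_max_right (e t) (e t')
  omega

end Chain

/-! ### All chains have the same limit -/

section Limit

variable {G X ι : Type*} [Group G] [MulAction G X] [MeasurableSpace X] [Countable ι]
  [MeasurableConstSMul G X] {u w : ℕ → ℕ}

theorem finEntropyAt_congr_ae {X A : Type*} [MeasurableSpace X] [MulAction G X] [Fintype A]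
    (S : MapSequence G) (μ : Measure X)
    [IsFiniteMeasure μ] [SMulInvariantMeasure G X μ] {a a' : X → A} (h : a =ᵐ[μ] a')
    (F : Finset G) : finEntropyAt S μ a F = finEntropyAt S μ a' F := by
  refine finEntropyAt_congr S μ μ a a' F ?_
  have h0 : μ.real {x | a x ≠ a' x} = 0 := by
    rw [measureReal_def]
    have : μ {x | a x ≠ a' x} = 0 := h
    simp [this]
  have h1 := measureReal_pname_ne_le μ F a a'
  rw [h0, mul_zero] at h1
  have h2 : pname F a =ᵐ[μ] pname F a' := by
    have := le_antisymm h1 measureReal_nonneg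
    exact (measureReal_eq_zero_iff).1 this
  ext φ
  exact measureReal_congr (h2.fun_comp (· ∈ ({φ} : Set _)))

/-- The comparison of two separating sequences. -/
theorem limsup_le_liminf_of_separating (S : MapSequence G) (μ : Measure X)
    [IsProbabilityMeasure μ] [SMulInvariantMeasure G X μ] {α : X → ι}
    (hα : IsMeasurablePartition α) (hH : partitionEntropy μ α < ⊤)
    {j : ∀ n, ι → Fin (u n)} {k : ∀ n, ι → Fin (w n)} (hj : IsSeparating μ α j)
    (hk : IsSeparating μ α k) {F : Finset G} (hF : F.Nonempty) :
    limsup (fun n => finEntropyAt S μ (k n ∘ α) F) atTop ≤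
      liminf (fun n => finEntropyAt S μ (j n ∘ α) F) atTop := by
  set Λ := limsup (fun n => finEntropyAt S μ (k n ∘ α) F) atTop
  have hcard : (0 : ℝ) < F.card := Nat.cast_pos.2 hF.card_pos
  have key : ∀ n (η : ℝ), 0 < η → ∀ ε : {ε : ℝ // 0 < ε}, Λ ≤
      finEntropyEps S μ (j n ∘ α) F ε +
        ((realEntropy μ α - finH (law μ (j n ∘ α)) + η : ℝ) : EReal) := by
    rintro n η hη ⟨ε, hε⟩
    obtain ⟨ε₁, hε₁, hcont⟩ := exists_l1_finH_lt (law μ (j n ∘ α)) hη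
    -- The first bound puts the laws of names within `ε / 2`; the second puts the one-site laws
    -- within `ε₁`, hence the entropies within `η`.
    have hδ : 0 < min (ε / (4 * F.card)) (ε₁ / 2) := by positivity
    refine limsup_le_of_le (h := ?_)
    -- The stage `n` is fixed while `m` grows: late members of the other sequence nearly refine `j n
    -- ∘ α`.
    filter_upwards [hk.exists_approx hα (j n) hδ] with m ⟨θ, hθ⟩
    have hm1 := hα.comp (j n)
    have hm2 := hα.comp (k m)
    have h1 := l1_pname_le μ F hm1 (hm2.comp θ)
    have h2 := l1_law_le μ hm1 (hm2.comp θ)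
    have h3 : μ.real {x | (j n ∘ α) x ≠ (θ ∘ k m ∘ α) x} ≤ ε / (4 * F.card) :=
      hθ.trans (min_le_left _ _)
    have h4 : μ.real {x | (j n ∘ α) x ≠ (θ ∘ k m ∘ α) x} ≤ ε₁ / 2 := hθ.trans (min_le_right _ _)
    refine (finEntropyAt_le_of_coarsening S μ hm2 (α' := j n ∘ α) θ hF hε ?_).trans ?_
    · refine h1.trans ?_
      calc 2 * (F.card * μ.real {x | (j n ∘ α) x ≠ (θ ∘ k m ∘ α) x})
          ≤ 2 * (F.card * (ε / (4 * F.card))) := by gcongr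
        _ = ε / 2 := by field_simp; norm_num
    · gcongr
      have h5 := hcont _ (h2.trans (by linarith))
      have h6 := finH_comp_le μ hα hH (k m)
      have h7 := (abs_lt.1 h5).1
      have e : finH (law μ (θ ∘ k m ∘ α)) = finH (law μ (θ ∘ (k m ∘ α))) := rfl
      linarith
  have key2 : ∀ n (η : ℝ), 0 < η → Λ ≤ finEntropyAt S μ (j n ∘ α) F +
      ((realEntropy μ α - finH (law μ (j n ∘ α)) + η : ℝ) : EReal) := by
    intro n η hη
    have := ereal_le_iInf_add (key n η hη)
    rwa [iInf_subtype] at this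
  refine ereal_le_of_forall_pos_le_add fun η hη => ?_
  have hn := (hj.tendsto_finH hα hH).eventually_const_lt
    (show realEntropy μ α - η / 2 < realEntropy μ α by linarith)
  rw [← EReal.sub_le_iff_le_add (.inl (EReal.coe_ne_bot η)) (.inl (EReal.coe_ne_top η))]
  refine le_liminf_of_le (h := ?_)
  filter_upwards [hn] with n hn
  refine EReal.sub_le_of_le_add ((key2 n (η / 2) (half_pos hη)).trans ?_)
  gcongr
  linarith

theorem limsup_le_liminf_of_isChain (S : MapSequence G) (μ : Measure X)
    [IsProbabilityMeasure μ] [SMulInvariantMeasure G X μ] {α : X → ι}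
    (hα : IsMeasurablePartition α) (hH : partitionEntropy μ α < ⊤)
    {a : ∀ n, X → Fin (u n)} {b : ∀ n, X → Fin (w n)} (ha : IsChain μ α u a)
    (hb : IsChain μ α w b) {F : Finset G} (hF : F.Nonempty) :
    limsup (fun n => finEntropyAt S μ (b n) F) atTop ≤
      liminf (fun n => finEntropyAt S μ (a n) F) atTop := by
  obtain ⟨j, hj, hj'⟩ := ha.exists_separating
  obtain ⟨k, hk, hk'⟩ := hb.exists_separating
  simp only [fun n => finEntropyAt_congr_ae S μ (hj n) F,
    fun n => finEntropyAt_congr_ae S μ (hk n) F]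
  exact limsup_le_liminf_of_separating S μ hα hH hj' hk' hF

/-- The entropy of a countable partition of finite entropy is the limit along every chain. -/
theorem IsChain.tendsto_entropyAt (S : MapSequence G) {μ : Measure X}
    [IsProbabilityMeasure μ] [SMulInvariantMeasure G X μ] {α : X → ι}
    (hα : IsMeasurablePartition α) (hH : partitionEntropy μ α < ⊤)
    {a : ∀ n, X → Fin (u n)} (ha : IsChain μ α u a) {F : Finset G} (hF : F.Nonempty) :
    Tendsto (fun n => finEntropyAt S μ (a n) F) atTop (𝓝 (entropyAt S μ α F)) := by
  set L := liminf (fun n => finEntropyAt S μ (a n) F) atTop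
  -- Comparing the chain with itself already yields convergence.
  have hlim : Tendsto (fun n => finEntropyAt S μ (a n) F) atTop (𝓝 L) :=
    tendsto_of_le_liminf_of_limsup_le le_rfl (limsup_le_liminf_of_isChain S μ hα hH ha ha hF)
  have : entropyAt S μ α F = L := by
    refine le_antisymm (sInf_le ⟨u, a, ha, hlim⟩) (le_sInf ?_)
    rintro L' ⟨v, b, hb, hb'⟩
    rw [← hb'.liminf_eq, ← hlim.limsup_eq]
    exact limsup_le_liminf_of_isChain S μ hα hH hb ha hF
  rwa [this]

theorem entropyAt_anti (S : MapSequence G) {μ : Measure X}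
    [IsProbabilityMeasure μ] [SMulInvariantMeasure G X μ] {α : X → ι}
    (hα : IsMeasurablePartition α) (hH : partitionEntropy μ α < ⊤)
    {F F' : Finset G} (h : F ⊆ F') (hF' : F'.Nonempty) :
    entropyAt S μ α F' ≤ entropyAt S μ α F := by
  refine le_sInf ?_
  rintro L ⟨v, b, hb, hL⟩
  exact le_of_tendsto_of_tendsto' (hb.tendsto_entropyAt S hα hH hF') hL
    fun n => finEntropyAt_anti S μ (hb.measurable n) h

/-- The identities for a fixed `F` require `F` nonempty. Discarding the empty set is harmless,
because adjoining `1` to a set can only lower the entropy. -/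
theorem meanEntropy_eq (S : MapSequence G) {μ : Measure X}
    [IsProbabilityMeasure μ] [SMulInvariantMeasure G X μ] {α : X → ι}
    (hα : IsMeasurablePartition α) (hH : partitionEntropy μ α < ⊤) :
    meanEntropy S μ α = ⨅ F : {F : Finset G // F.Nonempty}, entropyAt S μ α F := by
  refine le_antisymm (le_iInf fun F => iInf_le _ F.1) (le_iInf fun F => ?_)
  exact (iInf_le _ ⟨insert 1 F, by simp⟩).trans
    (entropyAt_anti S hα hH (Finset.subset_insert 1 F) (by simp))

end Limit

/-! ### Approximation by local functions -/

section Local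

variable {G X : Type*} [Group G] [MulAction G X]

/-- Coarser truncations and smaller windows are recoverable from finer and larger ones, so finitely
many codes can be given a common domain. -/
theorem exists_enlarge {C : Type*} (β : X → ℕ) {n n' : ℕ} (hn : n ≤ n') {L L' : Finset G}
    (hL : L ⊆ L') (Φ : (L → Fin (n + 1)) → C) :
    ∃ Φ' : (L' → Fin (n' + 1)) → C,
      ∀ x, Φ' (pname L' (trunc n' ∘ β) x) = Φ (pname L (trunc n ∘ β) x) := by
  refine ⟨fun ψ => Φ fun l => trunc n (ψ ⟨l, hL l.2⟩), fun x => ?_⟩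
  refine congrArg Φ (funext fun l => ?_)
  simp only [pname, Function.comp_apply]
  rw [← trunc_trunc hn]

/-- The sets determined by finitely many translates of finitely many atoms of `β`. -/
def localSets (G : Type*) {X : Type*} [Group G] [MulAction G X] (β : X → ℕ) : Set (Set X) :=
  {s | ∃ (n : ℕ) (L : Finset G) (Φ : (L → Fin (n + 1)) → Prop),
    s = {x | Φ (pname L (trunc n ∘ β) x)}}

theorem isSetAlgebra_localSets (β : X → ℕ) : IsSetAlgebra (localSets G β) where
  empty_mem := ⟨0, ∅, fun _ => False, by simp⟩
  compl_mem := by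
    rintro s ⟨n, L, Φ, rfl⟩
    exact ⟨n, L, fun ψ => ¬ Φ ψ, rfl⟩
  union_mem := by
    rintro s t ⟨n, L, Φ, rfl⟩ ⟨n', L', Φ', rfl⟩
    obtain ⟨Φ₁, h₁⟩ := exists_enlarge β (le_max_left n n') (Finset.subset_union_left (s₂ := L')) Φ
    obtain ⟨Φ₂, h₂⟩ := exists_enlarge β (le_max_right n n') (Finset.subset_union_right (s₁ := L)) Φ'
    refine ⟨max n n', L ∪ L', fun ψ => Φ₁ ψ ∨ Φ₂ ψ, ?_⟩
    ext x
    simp only [Set.mem_union, Set.mem_ofPred_eq, h₁, h₂]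

variable [MeasurableSpace X] [MeasurableConstSMul G X]

theorem generateFrom_localSets_le {β : X → ℕ} (hβ : IsMeasurablePartition β) :
    MeasurableSpace.generateFrom (localSets G β) ≤ (inferInstance : MeasurableSpace X) := by
  refine MeasurableSpace.generateFrom_le ?_
  rintro s ⟨n, L, Φ, rfl⟩
  exact ((hβ.comp (trunc n)).pname L).preimage {ψ | Φ ψ}

theorem le_generateFrom_localSets {X : Type*} [MulAction G X] (β : X → ℕ) :
    MeasurableSpace.generateFrom {s : Set X | ∃ (g : G) (i : ℕ), s = g • (β ⁻¹' {i})} ≤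
      MeasurableSpace.generateFrom (localSets G β) := by
  refine MeasurableSpace.generateFrom_le ?_
  rintro s ⟨g, i, rfl⟩
  -- The level `i + 1` is needed: truncation at `i` would merge the label `i` with all larger ones.
  refine MeasurableSpace.measurableSet_generateFrom
    ⟨i + 1, {g}, fun ψ => (ψ ⟨g, Finset.mem_singleton_self g⟩ : ℕ) = i, ?_⟩
  ext x
  simp only [Set.mem_smul_set_iff_inv_smul_mem, Set.mem_preimage, Set.mem_singleton_iff, pname,
    Function.comp_apply, trunc, Set.mem_ofPred_eq]
  omega

/-- Local sets form an algebra whose σ-algebra contains the translates of the atoms, and an algebra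
is dense in measure in what it generates. The measure is trimmed so that density is applied on
exactly that σ-algebra. -/
theorem exists_localSet_approx {μ : Measure X} [IsProbabilityMeasure μ] {β : X → ℕ}
    (hβ : IsMeasurablePartition β) (hgen : IsGenerating G μ β) {A : Set X} (hA : MeasurableSet A)
    {δ : ℝ} (hδ : 0 < δ) : ∃ t ∈ localSets G β, μ.real (symmDiff A t) ≤ δ := by
  obtain ⟨A', hA', hAA'⟩ := hgen A hA
  have hle := generateFrom_localSets_le (G := G) hβ
  have hA'' := le_generateFrom_localSets β A' hA'
  have hfin : IsFiniteMeasure (μ.trim hle) := isFiniteMeasure_trim hle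
  have hdense := @Measure.MeasureDense.of_generateFrom_isSetAlgebra_finite X
    (MeasurableSpace.generateFrom (localSets G β)) (μ.trim hle) (localSets G β) hfin
    (isSetAlgebra_localSets β) rfl
  obtain ⟨t, ht, htA⟩ := @Measure.MeasureDense.approx X
    (MeasurableSpace.generateFrom (localSets G β)) _ _ hdense A' hA''
    (@measure_ne_top X (MeasurableSpace.generateFrom (localSets G β)) (μ.trim hle) hfin A') δ hδ
  refine ⟨t, ht, ?_⟩
  rw [trim_measurableSet_eq hle (hA''.symmDiff (MeasurableSpace.measurableSet_generateFrom ht))]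
    at htA
  have h1 := measure_symmDiff_le A A' t (μ := μ)
  rw [hAA', zero_add] at h1
  exact ENNReal.toReal_le_of_le_ofReal hδ.le (h1.trans htA.le)

/-- Every finite partition is approximated by local functions of a generating partition. -/
theorem exists_local_approx {μ : Measure X} [IsProbabilityMeasure μ] {β : X → ℕ}
    (hβ : IsMeasurablePartition β) (hgen : IsGenerating G μ β) {C : Type*} [Fintype C]
    {Q : X → C} (hQ : IsMeasurablePartition Q) {δ : ℝ} (hδ : 0 < δ) :
    ∃ (n : ℕ) (L : Finset G) (Φ : (L → Fin (n + 1)) → C),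
      μ.real {x | Q x ≠ Φ (pname L (trunc n ∘ β) x)} ≤ δ := by
  have hne : Nonempty X := μ.nonempty_of_neZero
  have hneC : Nonempty C := hne.map Q
  have hcard : (0 : ℝ) < Fintype.card C := Nat.cast_pos.2 Fintype.card_pos
  choose t ht htQ using fun c => exists_localSet_approx hβ hgen (hQ c) (div_pos hδ hcard)
  choose n L Φ hΦ using ht
  choose Φ' hΦ' using fun c => exists_enlarge β (Finset.le_sup (f := n) (Finset.mem_univ c))
    (Finset.subset_biUnion_of_mem L (Finset.mem_univ c)) (Φ c)
  -- Off the union of the symmetric differences, `Q x` is the only `c` for which `Φ' c` holds, so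
  -- the choice returns it; elsewhere any value will do.
  refine ⟨_, _, fun ψ => if h : ∃ c, Φ' c ψ then h.choose else Classical.arbitrary C, ?_⟩
  refine (measureReal_mono (s₂ := ⋃ c ∈ Finset.univ, symmDiff (Q ⁻¹' {c}) (t c)) ?_
    (measure_ne_top _ _)).trans ((measureReal_biUnion_finset_le _ _).trans
      ((Finset.sum_le_sum fun c _ => htQ c).trans ?_))
  · intro x hx
    by_contra hcon
    simp only [Set.mem_iUnion, not_exists] at hcon
    have hiff : ∀ c, Q x = c ↔ x ∈ t c := by
      intro c
      have := hcon c (Finset.mem_univ c)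
      rw [Set.mem_symmDiff] at this
      simp only [Set.mem_preimage, Set.mem_singleton_iff] at this
      tauto
    have hiff' : ∀ c, Q x = c ↔ Φ' c (pname _ (trunc _ ∘ β) x) := by
      intro c
      rw [hiff, hΦ', hΦ c]
      rfl
    have hex : ∃ c, Φ' c (pname _ (trunc _ ∘ β) x) := ⟨Q x, (hiff' _).1 rfl⟩
    refine hx ?_
    change _ = dite _ _ _
    rw [dif_pos hex]
    exact (hiff' _).2 hex.choose_spec
  · rw [Finset.sum_const, nsmul_eq_mul, Finset.card_univ]
    exact le_of_eq (by field_simp)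

end Local

/-! ### Independence of the generator -/

section Generator

variable {G X : Type*} [Group G] [MulAction G X] [MeasurableSpace X] [MeasurableConstSMul G X]

/-- A function of names on `X` and a function on the model which is the same function of names at
all good points have nearby distributions. -/
theorem l1_law_model_le (μ : Measure X) [IsProbabilityMeasure μ] {A E : Type*} [Fintype A]
    [Fintype E] {m : ℕ} [NeZero m] {σ : G → Equiv.Perm (Fin m)} {β : X → A}
    (hβ : IsMeasurablePartition β) {D T : Finset G} {τ : ℝ}
    (hbad : (unif m).real (badSet σ D) ≤ τ / 2) {b : Fin m → A}
    (hb : b ∈ approxPartitions μ σ T β τ) (f : (T → A) → E) (g : Fin m → E)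
    (hg : ∀ v ∉ badSet σ D, f (mname σ T b v) = g v) :
    l1 (law μ (f ∘ pname T β)) (law (unif m) g) ≤ 2 * τ := by
  rw [mem_approxPartitions] at hb
  have e1 := l1_comp_le μ (unif m) (hβ.pname T) (isMeasurablePartition_fin (mname σ T b)) f
  have e2 := l1_law_le (unif m) (isMeasurablePartition_fin (f ∘ mname σ T b))
    (isMeasurablePartition_fin g)
  have e3 : (unif m).real {v | (f ∘ mname σ T b) v ≠ g v} ≤ (unif m).real (badSet σ D) := by
    refine measureReal_mono fun v hv => ?_
    by_contra hbad
    exact hv (hg v hbad)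
  have e4 := l1_triangle (law μ (f ∘ pname T β)) (law (unif m) (f ∘ mname σ T b))
    (law (unif m) g)
  linarith

/-- The code `Φ` applied twice, as a function of `D * D`-names. -/
def codeNames {A B : Type*} {D : Finset G} (Φ : (D → A) → B) (ψ : (D * D : Finset G) → A) (d : D) :
    B := Φ fun e => ψ ⟨d * e, Finset.mul_mem_mul d.2 e.2⟩

theorem pname_code {X A B : Type*} [MulAction G X] {D : Finset G} (Φ : (D → A) → B) (β : X → A) :
    pname D (Φ ∘ pname D β) = codeNames Φ ∘ pname (D * D) β := by
  funext x d
  refine congrArg Φ (funext fun e => ?_)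
  simp only [pname, mul_inv_rev, mul_smul]

/-- On `X` the composition of codes is exact because `G` acts. On the model it needs `σ(d * e)⁻¹ =
σ(e)⁻¹ σ(d)⁻¹` at `v`, which holds at points that are not bad. -/
theorem mname_code {A B : Type*} {m : ℕ} {σ : G → Equiv.Perm (Fin m)} {D : Finset G}
    (Φ : (D → A) → B) (b : Fin m → A) {v : Fin m} (hv : v ∉ badSet σ D) :
    mname σ D (Φ ∘ mname σ D b) v = codeNames Φ (mname σ (D * D) b v) := by
  funext d
  refine congrArg Φ (funext fun e => congrArg b ?_)
  by_contra hne
  exact hv (.inr ⟨d, d.2, e, e.2, .inl hne⟩)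

/-- If `α` is approximately a local function of `β`, and a coarsening `π ∘ β` is approximately a
local function of `α`, then approximating partitions of `β` can be counted through those of `α`. -/
theorem finEntropyAt_le_of_codes {S : MapSequence G} (hS : S.IsSofic) (μ : Measure X)
    [IsProbabilityMeasure μ] [SMulInvariantMeasure G X μ] {A B C : Type*} [Fintype A] [Fintype B]
    [Fintype C] {β : X → A} (hβ : IsMeasurablePartition β) (α : X → B) (π : A → C)
    {D F : Finset G} (hD : 1 ∈ D) (hF : F ⊆ D) (Φ : (D → A) → B) (Ψ : (D → B) → C)
    {ε ε' η : ℝ} (hε : 0 < ε) (hε' : 0 < ε') (hη : 0 < η)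
    (hcount : ∀ (m : ℕ) [NeZero m] (c : Fin m → C),
      ({w : Fin m → C × C | Prod.snd ∘ w = c ∧
        l1 (law μ fun x => (π (β x), π (β x))) (law (unif m) w) ≤ ε'}.ncard : ℝ) ≤
          Real.exp (m * η))
    (hα : l1 (law μ (pname F α)) (law μ (pname F (Φ ∘ pname D β))) ≤ ε / 2)
    (hb : l1 (law μ fun x => (π (β x), π (β x)))
      (law μ fun x => (π (β x), Ψ (pname D (Φ ∘ pname D β) x))) ≤ ε' / 2) :
    finEntropyAt S μ β (D * D) ≤ finEntropyEps S μ α F ε +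
      ((finH (law μ β) - finH (law μ (π ∘ β)) + 2 * η : ℝ) : EReal) := by
  obtain ⟨ε₀, hε₀, hfib⟩ := exists_card_fiber_le π (law μ β) (law_nonneg μ β) hη
  -- Passing to the model costs `2 * τ`, which is at most `ε / 2` and `ε' / 2`: the halves left over
  -- by the approximations on `X`.
  set τ := min (min (ε / 4) (ε' / 4)) ε₀
  have hτ : 0 < τ := by positivity
  have hτ1 : τ ≤ ε / 4 := (min_le_left _ _).trans (min_le_left _ _)
  have hτ2 : τ ≤ ε' / 4 := (min_le_left _ _).trans (min_le_right _ _)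
  have h1D : (1 : G) ∈ D * D := by simpa using Finset.mul_mem_mul hD hD
  refine (iInf₂_le _ hτ).trans (finEntropyEps_le_of_ncard_le S μ μ ?_)
  filter_upwards [hS.eventually_badSet D (half_pos hτ)] with i hi
  generalize S.σ i = σ at hi ⊢
  have hmaps : ∀ b ∈ approxPartitions μ σ (D * D) β τ,
      Φ ∘ mname σ D b ∈ approxPartitions μ σ F α ε := by
    intro b hbA
    rw [mem_approxPartitions]
    have e1 := l1_law_model_le μ hβ hi hbA (fun ψ (f : F) => codeNames Φ ψ ⟨f, hF f.2⟩)
      (mname σ F (Φ ∘ mname σ D b)) (fun v hv => by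
        rw [← mname_code Φ b hv]
        rfl)
    have e2 : (fun ψ (f : F) => codeNames Φ ψ ⟨f, hF f.2⟩) ∘ pname (D * D) β =
        pname F (Φ ∘ pname D β) := by
      funext x f
      exact (congrFun (congrFun (pname_code Φ β) x) ⟨f, hF f.2⟩).symm
    rw [e2] at e1
    have e3 := l1_triangle (law μ (pname F α)) (law μ (pname F (Φ ∘ pname D β)))
      (law (unif (S.m i)) (mname σ F (Φ ∘ mname σ D b)))
    linarith
  have hpair : ∀ b ∈ approxPartitions μ σ (D * D) β τ,
      l1 (law μ fun x => (π (β x), π (β x)))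
        (law (unif (S.m i)) fun v => (π (b v), Ψ (mname σ D (Φ ∘ mname σ D b) v))) ≤ ε' := by
    intro b hbA
    have e1 := l1_law_model_le μ hβ hi hbA (fun ψ => (π (ψ ⟨1, h1D⟩), Ψ (codeNames Φ ψ)))
      (fun v => (π (b v), Ψ (mname σ D (Φ ∘ mname σ D b) v)))
      (fun v hv => by
        have : (σ 1).symm v = v := by
          by_contra hne
          exact hv (.inl hne)
        rw [mname_code Φ b hv]
        simp only [mname]
        rw [this])
    have e2 : (fun ψ => (π (ψ ⟨1, h1D⟩), Ψ (codeNames Φ ψ))) ∘ pname (D * D) β =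
        fun x => (π (β x), Ψ (pname D (Φ ∘ pname D β) x)) := by
      rw [pname_code]
      funext x
      simp [pname]
    rw [e2] at e1
    have e3 := l1_triangle (law μ fun x => (π (β x), π (β x)))
      (law μ fun x => (π (β x), Ψ (pname D (Φ ∘ pname D β) x)))
      (law (unif (S.m i)) fun v => (π (b v), Ψ (mname σ D (Φ ∘ mname σ D b) v)))
    linarith
  refine ncard_le_mul_of_fiber_le _ _ (fun b => Φ ∘ mname σ D b) hmaps fun a _ => ?_
  -- The fibre over `a` is counted in two stages. The word `π ∘ b`, paired with the word decoded
  -- from `a`, has a nearly diagonal law, leaving at most `exp (m η)` choices. Given `π ∘ b`, the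
  -- word `b` costs the conditional entropy of `β`.
  have hstep := ncard_le_mul_of_fiber_le
    {b ∈ approxPartitions μ σ (D * D) β τ | Φ ∘ mname σ D b = a}
    {w : Fin (S.m i) → C × C | Prod.snd ∘ w = Ψ ∘ mname σ D a ∧
        l1 (law μ fun x => (π (β x), π (β x))) (law (unif (S.m i)) w) ≤ ε'}
    (fun b v => (π (b v), Ψ (mname σ D a v)))
    (c := Real.exp (S.m i * (finH (law μ β) - finH (push π (law μ β)) + η))) ?_ ?_
  · refine hstep.trans ((mul_le_mul_of_nonneg_right (hcount _ _) (Real.exp_pos _).le).trans ?_)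
    rw [← Real.exp_add, law_comp μ hβ π]
    exact le_of_eq (by congr 1; ring)
  · rintro b ⟨hbA, rfl⟩
    exact ⟨rfl, hpair b hbA⟩
  · rintro w -
    refine le_trans (Nat.cast_le.2 (Set.ncard_le_ncard ?_)) (hfib _ (Prod.fst ∘ w))
    rintro b ⟨⟨hbA, -⟩, rfl⟩
    rw [mem_approxPartitions] at hbA
    exact ⟨rfl, (l1_law_le_l1_name μ σ ⟨1, h1D⟩ hβ b).trans (hbA.trans (min_le_right _ _))⟩

/-- A variable has no conditional entropy given its own copy; this makes the first stage of the
fibre count cost only `η`. -/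
theorem finH_diag (μ : Measure X) [IsProbabilityMeasure μ] {C : Type*} [Fintype C] {b : X → C}
    (hb : IsMeasurablePartition b) :
    finH (law μ fun x => (b x, b x)) - finH (push Prod.snd (law μ fun x => (b x, b x))) = 0 := by
  have h1 : finH (law μ fun x => (b x, b x)) = finH (law μ b) :=
    finH_comp_injective (e := fun c : C => (c, c)) (fun c c' h => (Prod.ext_iff.1 h).1) μ b
  have h2 : law μ b = push Prod.snd (law μ fun x => (b x, b x)) := law_comp μ (hb.pair hb) Prod.snd
  rw [h1, ← h2, sub_self]

/-- The order of choices matters. A truncation `M` of `β` carries nearly all its entropy. It is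
nearly local in a truncation of `α`, which fixes the range of `N`. Only then, for each `N` and `ε`,
is that truncation of `α` approximated by a local function of `β`, and the window `D` is taken to
contain all the windows involved. One third of `η₀` pays for the entropy tail of `β`, two thirds for
the fibre count. -/
theorem meanEntropy_le_of_isGenerating {S : MapSequence G} (hS : S.IsSofic) (μ : Measure X)
    [IsProbabilityMeasure μ] [SMulInvariantMeasure G X μ] {α β : X → ℕ}
    (hα : IsFiniteEntropyGenerator G μ α) (hβ : IsFiniteEntropyGenerator G μ β) :
    meanEntropy S μ β ≤ meanEntropy S μ α := by
  have hne : Nonempty X := μ.nonempty_of_neZero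
  obtain ⟨hαm, hαH, hαg⟩ := hα
  obtain ⟨hβm, hβH, hβg⟩ := hβ
  have hsepβ : IsSeparating μ β fun n => trunc n :=
    isSeparating_trunc μ β Function.injective_id
  rw [meanEntropy_eq S hαm hαH]
  refine le_iInf fun ⟨F, hF⟩ => ereal_le_of_forall_pos_le_add fun η₀ hη₀ => ?_
  set η := η₀ / 3
  have hη : 0 < η := by positivity
  have hlimα := (isChain_trunc (μ := μ) hαm Function.injective_id).tendsto_entropyAt S hαm hαH hF
  rw [← EReal.sub_le_iff_le_add (.inl (EReal.coe_ne_bot _)) (.inl (EReal.coe_ne_top _))]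
  refine ge_of_tendsto hlimα ?_
  obtain ⟨M, hM⟩ := ((hsepβ.tendsto_finH hβm hβH).eventually_const_lt
    (show realEntropy μ β - η < realEntropy μ β by linarith)).exists
  set b := trunc M ∘ β
  have hb : IsMeasurablePartition b := hβm.comp _
  obtain ⟨ε', hε', hcount⟩ := exists_card_fiber_le Prod.snd (law μ fun x => (b x, b x))
    (law_nonneg μ _) hη
  rw [finH_diag μ hb, zero_add] at hcount
  -- Decoding fails where this approximation fails or where the `L`-names of `αN` and `α'` differ.
  -- Each event has measure at most `ε' / 8`, and doubling their sum gives the required `ε' / 2`.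
  obtain ⟨N₀, L, Ψ₀, hΨ₀⟩ := exists_local_approx hαm hαg hb (show 0 < ε' / 8 by positivity)
  filter_upwards [eventually_ge_atTop N₀] with N hN
  refine EReal.sub_le_of_le_add ?_
  change _ ≤ finEntropyAt S μ (trunc N ∘ α) F + _
  suffices h : ∀ ε : {ε : ℝ // 0 < ε}, meanEntropy S μ β ≤
      finEntropyEps S μ (trunc N ∘ α) F ε + (η₀ : EReal) by
    have := ereal_le_iInf_add h
    rwa [iInf_subtype] at this
  rintro ⟨ε, hε⟩
  obtain ⟨Ψ₁, hΨ₁⟩ := exists_enlarge α hN (Finset.Subset.refl L) Ψ₀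
  set αN := trunc N ∘ α
  have hαN : IsMeasurablePartition αN := hαm.comp _
  -- An error at one site is multiplied by the size of the window when names are compared; the `+ 1`
  -- keeps the denominators positive.
  have hδ : 0 < min (ε / (4 * (F.card + 1))) (ε' / (8 * (L.card + 1))) := by positivity
  obtain ⟨n', L', Φ₀, hΦ₀⟩ := exists_local_approx hβm hβg hαN hδ
  set α' : X → Fin (N + 1) := fun x => Φ₀ (pname L' (trunc n' ∘ β) x)
  have hα' : IsMeasurablePartition α' := ((hβm.comp (trunc n')).pname L').comp Φ₀
  set D : Finset G := insert 1 (F ∪ L ∪ L')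
  have hFD : F ⊆ D := fun f hf => by simp [D, hf]
  have hLD : L ⊆ D := fun f hf => by simp [D, hf]
  have hLD' : L' ⊆ D := fun f hf => by simp [D, hf]
  have h1D : (1 : G) ∈ D := by simp [D]
  have hDD : (D * D).Nonempty := ⟨1 * 1, Finset.mul_mem_mul h1D h1D⟩
  have hlimβ := (isChain_trunc (μ := μ) hβm Function.injective_id).tendsto_entropyAt S hβm hβH hDD
  refine (iInf_le _ (D * D)).trans (le_of_tendsto hlimβ ?_)
  filter_upwards [eventually_ge_atTop (max n' M)] with M' hM'
  change finEntropyAt S μ (trunc M' ∘ β) (D * D) ≤ _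
  obtain ⟨Φ, hΦ⟩ := exists_enlarge β ((le_max_left n' M).trans hM') hLD' Φ₀
  have hΦ' : Φ ∘ pname D (trunc M' ∘ β) = α' := funext hΦ
  have hbM : ∀ x, trunc M (((trunc M' ∘ β) x : Fin (M' + 1)) : ℕ) = b x := fun x =>
    (trunc_trunc ((le_max_right n' M).trans hM') (β x)).symm
  have hdiff : μ.real {x | αN x ≠ α' x} ≤ ε / (4 * (F.card + 1)) := hΦ₀.trans (min_le_left _ _)
  have hdiff' : μ.real {x | αN x ≠ α' x} ≤ ε' / (8 * (L.card + 1)) :=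
    hΦ₀.trans (min_le_right _ _)
  have hle := finEntropyAt_le_of_codes hS μ (hβm.comp (trunc M')) αN
    (fun k : Fin (M' + 1) => trunc M k) h1D hFD Φ (fun ψ => Ψ₁ fun l => ψ ⟨l, hLD l.2⟩)
    hε hε' hη ?_ ?_ ?_
  · refine hle.trans ?_
    gcongr
    have e1 := finH_comp_le μ hβm hβH (trunc M')
    have e2 : (fun k : Fin (M' + 1) => trunc M k) ∘ trunc M' ∘ β = b := funext hbM
    rw [e2]
    have e3 : η₀ = 3 * η := by simp only [η]; ring
    have hM2 : realEntropy μ β - η < finH (law μ b) := hM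
    linarith
  · simp only [hbM]
    exact hcount
  · rw [hΦ']
    refine (l1_pname_le μ F hαN hα').trans ?_
    calc 2 * (F.card * μ.real {x | αN x ≠ α' x})
        ≤ 2 * ((F.card + 1) * (ε / (4 * (F.card + 1)))) := by
          gcongr
          linarith
      _ = ε / 2 := by field_simp; norm_num
  · simp only [hbM]
    rw [hΦ']
    have hcode : ∀ x, (Ψ₁ fun l : L => pname D α' x ⟨l, hLD l.2⟩) = Ψ₁ (pname L α' x) :=
      fun x => rfl
    simp only [hcode]
    have hcm : IsMeasurablePartition fun x => Ψ₁ (pname L α' x) := (hα'.pname L).comp Ψ₁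
    refine (l1_law_le μ (hb.pair hb) (hb.pair hcm)).trans ?_
    have hsub : {x | (b x, b x) ≠ (b x, Ψ₁ (pname L α' x))} ⊆
        {x | b x ≠ Ψ₀ (pname L (trunc N₀ ∘ α) x)} ∪ {x | pname L αN x ≠ pname L α' x} := by
      intro x hx
      by_contra hcon
      simp only [Set.mem_union, Set.mem_ofPred_eq, not_or, not_not] at hcon
      refine hx ?_
      rw [← hcon.2, hΨ₁ x, ← hcon.1]
    have e1 := (measureReal_mono hsub (measure_ne_top μ _)).trans (measureReal_union_le _ _)
    have e2 := measureReal_pname_ne_le μ L αN α'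
    have e3 : (L.card : ℝ) * μ.real {x | αN x ≠ α' x} ≤ ε' / 8 := by
      calc (L.card : ℝ) * μ.real {x | αN x ≠ α' x}
          ≤ (L.card + 1) * (ε' / (8 * (L.card + 1))) := by
            gcongr
            linarith
        _ = ε' / 8 := by field_simp
    linarith

theorem meanEntropy_eq_of_isGenerating {S : MapSequence G} (hS : S.IsSofic) (μ : Measure X)
    [IsProbabilityMeasure μ] [SMulInvariantMeasure G X μ] {α β : X → ℕ}
    (hα : IsFiniteEntropyGenerator G μ α) (hβ : IsFiniteEntropyGenerator G μ β) :
    meanEntropy S μ β = meanEntropy S μ α :=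
  le_antisymm (meanEntropy_le_of_isGenerating hS μ hα hβ)
    (meanEntropy_le_of_isGenerating hS μ hβ hα)

theorem IsFiniteEntropyGenerator.hasSoficEntropy {S : MapSequence G} (hS : S.IsSofic)
    {μ : Measure X} [IsProbabilityMeasure μ] [SMulInvariantMeasure G X μ] {α : X → ℕ}
    (hα : IsFiniteEntropyGenerator G μ α) : HasSoficEntropy S μ (meanEntropy S μ α) :=
  ⟨⟨α, hα⟩, fun _ hβ => meanEntropy_eq_of_isGenerating hS μ hα hβ⟩

end Generator

/-! ### Bernoulli shifts as measure-preserving systems -/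

section Shift

variable {G K : Type*} [Group G] [MeasurableSpace K]

theorem smul_apply_shift {K : Type*} (g f : G) (y : Shift G K) : (g • y) f = y (g⁻¹ * f) := rfl

theorem canonicalPartition_inv_smul {K : Type*} (g : G) (y : Shift G K) :
    canonicalPartition G K (g⁻¹ • y) = y g := by
  simp [canonicalPartition, smul_apply_shift]

theorem measurable_eval_shift {G : Type*} (g : G) : Measurable fun y : Shift G K => y g :=
  measurable_pi_apply (X := fun _ : G => K) g

instance measurableConstSMul_shift : MeasurableConstSMul G (Shift G K) where
  measurable_const_smul g :=
    measurable_pi_lambda (X := fun _ : G => K) _ fun f => measurable_eval_shift (g⁻¹ * f)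

instance isProbabilityMeasure_bernoulliMeasure (κ : Measure K) [IsProbabilityMeasure κ] :
    IsProbabilityMeasure (bernoulliMeasure G κ) :=
  inferInstanceAs (IsProbabilityMeasure (Measure.infinitePi fun _ : G => κ))

theorem bernoulliMeasure_pi {G : Type*} (κ : Measure K) [IsProbabilityMeasure κ] (s : Finset G)
    {t : G → Set K} (ht : ∀ g ∈ s, MeasurableSet (t g)) :
    bernoulliMeasure G κ {y | ∀ g ∈ s, y g ∈ t g} = ∏ g ∈ s, κ (t g) :=
  Measure.infinitePi_pi (fun _ : G => κ) ht

/-- A translation permutes the coordinates, so it carries boxes to boxes with the same factors; the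
product measure is determined by its values on boxes. -/
instance smulInvariantMeasure_bernoulliMeasure (κ : Measure K) [IsProbabilityMeasure κ] :
    SMulInvariantMeasure G (Shift G K) (bernoulliMeasure G κ) where
  measure_preimage_smul g s hs := by
    have hmeas : Measurable fun y : Shift G K => g • y := measurable_const_smul g
    have hmap : Measure.map (fun y : Shift G K => g • y) (bernoulliMeasure G κ) =
        bernoulliMeasure G κ := by
      refine Measure.eq_infinitePi (fun _ : G => κ) fun s t ht => ?_
      have hbox : MeasurableSet (α := Shift G K) ((s : Set G).pi t) :=
        MeasurableSet.pi s.countable_toSet fun i _ => ht i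
      refine (Measure.map_apply hmeas hbox).trans ?_
      have := bernoulliMeasure_pi (G := G) κ (s.map (Equiv.mulLeft g⁻¹).toEmbedding)
        (t := fun f => t (g * f)) (fun f _ => ht _)
      rw [Finset.prod_map] at this
      simp only [Equiv.coe_toEmbedding, Equiv.coe_mulLeft, mul_inv_cancel_left] at this
      rw [← this]
      congr 1
      ext y
      simp only [Finset.mem_map_equiv, Equiv.mulLeft_symm, inv_inv, Equiv.coe_mulLeft,
        Set.mem_ofPred_eq]
      constructor
      · intro h f hf
        have h' : (g • y) (g * f) ∈ t (g * f) := h (g * f) hf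
        rwa [smul_apply_shift, inv_mul_cancel_left] at h'
      · intro h f hf
        have h' := h (g⁻¹ * f) (by simpa using hf)
        rw [mul_inv_cancel_left] at h'
        exact h'
    conv_rhs => rw [← hmap]
    exact (Measure.map_apply hmeas hs).symm

theorem measurePreserving_eval_shift {G : Type*} (κ : Measure K) [IsProbabilityMeasure κ] (g : G) :
    MeasurePreserving (fun y : Shift G K => y g) (bernoulliMeasure G κ) κ :=
  measurePreserving_eval_infinitePi (fun _ : G => κ) g

theorem isMeasurablePartition_canonical {B : Type*} {c : K → B} (hc : IsMeasurablePartition c) :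
    IsMeasurablePartition (c ∘ canonicalPartition G K) :=
  fun b => measurable_eval_shift 1 (hc b)

theorem law_canonical (κ : Measure K) [IsProbabilityMeasure κ] {B : Type*} {c : K → B}
    (hc : IsMeasurablePartition c) :
    law (bernoulliMeasure G κ) (c ∘ canonicalPartition G K) = law κ c := by
  ext b
  exact (measurePreserving_eval_shift κ (1 : G)).measureReal_preimage (hc b).nullMeasurableSet

/-- The entry at `f` of a name is read from the coordinate `y f`, and distinct coordinates are
independent. -/
theorem law_pname_canonical (κ : Measure K) [IsProbabilityMeasure κ] {B : Type*} {c : K → B}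
    (hc : IsMeasurablePartition c) (F : Finset G) (φ : F → B) :
    law (bernoulliMeasure G κ) (pname F (c ∘ canonicalPartition G K)) φ =
      ∏ f, law κ c (φ f) := by
  set t : G → Set K := fun g => if h : g ∈ F then c ⁻¹' {φ ⟨g, h⟩} else Set.univ
  have ht : ∀ f : F, t f = c ⁻¹' {φ f} := fun f => dif_pos f.2
  have hset : pname F (c ∘ canonicalPartition G K) ⁻¹' {φ} = {y | ∀ g ∈ F, y g ∈ t g} := by
    ext y
    simp only [Set.mem_preimage, Set.mem_singleton_iff, Set.mem_ofPred_eq, funext_iff, pname,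
      Function.comp_apply, canonicalPartition_inv_smul]
    constructor
    · intro h g hg
      rw [ht ⟨g, hg⟩]
      exact h ⟨g, hg⟩
    · intro h f
      have := h f f.2
      rwa [ht] at this
  rw [law, hset, measureReal_def, bernoulliMeasure_pi κ F fun g hg => by
    rw [ht ⟨g, hg⟩]; exact hc _, ENNReal.toReal_prod, ← Finset.prod_coe_sort]
  exact Finset.prod_congr rfl fun f _ => by rw [ht]; rfl

end Shift

/-! ### Diagonal actions on products -/

section Prod

variable {G X Y : Type*} [Group G] [MulAction G X] [MeasurableSpace X] [MeasurableConstSMul G X]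
  [MulAction G Y] [MeasurableSpace Y] [MeasurableConstSMul G Y]

instance measurableConstSMul_prod : MeasurableConstSMul G (X × Y) where
  measurable_const_smul g := (measurable_fst.const_smul g).prodMk (measurable_snd.const_smul g)

instance smulInvariantMeasure_prod (μ : Measure X) [IsProbabilityMeasure μ]
    [SMulInvariantMeasure G X μ] (ν : Measure Y) [IsProbabilityMeasure ν]
    [SMulInvariantMeasure G Y ν] : SMulInvariantMeasure G (X × Y) (μ.prod ν) where
  measure_preimage_smul g _ hs :=
    ((measurePreserving_smul g μ).prod (measurePreserving_smul g ν)).measure_preimage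
      hs.nullMeasurableSet

end Prod

/-! ### Entropy of products with Bernoulli shifts -/

section Bernoulli

variable {G K X : Type*} [Group G] [MeasurableSpace K]
  [MulAction G X] [MeasurableSpace X] [MeasurableConstSMul G X]

theorem law_prod (μ : Measure X) {Y : Type*} [MeasurableSpace Y] (ν : Measure Y)
    [IsProbabilityMeasure ν] {A B : Type*} (a : X → A) (b : Y → B) (x : A) (y : B) :
    law (μ.prod ν) (fun z => (a z.1, b z.2)) (x, y) = law μ a x * law ν b y := by
  rw [law, law, law, ← measureReal_prod_prod]
  congr 1
  ext z; simp

/-- The finite case of the product formula. -/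
theorem finEntropyAt_prod_bernoulli {S : MapSequence G} (hS : S.IsSofic) (κ : Measure K)
    [IsProbabilityMeasure κ] (μ : Measure X) [IsProbabilityMeasure μ] [SMulInvariantMeasure G X μ]
    {A B : Type*} [Fintype A] [Fintype B] {a : X → A} (ha : IsMeasurablePartition a) {c : K → B}
    (hc : IsMeasurablePartition c) {F : Finset G} (hF : F.Nonempty) :
    finEntropyAt S (μ.prod (bernoulliMeasure G κ))
      (fun z => (a z.1, (c ∘ canonicalPartition G K) z.2)) F =
        finEntropyAt S μ a F + (finH (law κ c) : EReal) := by
  have hcan : IsMeasurablePartition (c ∘ canonicalPartition G K) :=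
    isMeasurablePartition_canonical hc
  have hγ : IsMeasurablePartition fun z : X × Shift G K =>
      (a z.1, (c ∘ canonicalPartition G K) z.2) :=
    IsMeasurablePartition.pair (g := fun z : X × Shift G K => a z.1)
      (h := fun z : X × Shift G K => (c ∘ canonicalPartition G K) z.2)
      (fun i => measurable_fst (ha i)) (fun i => measurable_snd (hcan i))
  refine finEntropyAt_prod hS μ _ ha hγ (law κ c) (law_nonneg κ c) (sum_law κ hc) hF ?_ ?_
  · ext φ
    rw [prodLaw, ← law_pname_canonical κ hc F, law, law, law, ← measureReal_prod_prod]
    congr 1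
    ext z
    simp only [pname, Set.mem_preimage, Set.mem_singleton_iff, Set.mem_prod, funext_iff,
      Prod.ext_iff, Prod.smul_fst, Prod.smul_snd]
    exact forall_and
  · intro x y
    rw [law_prod, law_canonical κ hc]

/-- With one label there is a single word and it approximates exactly, so every count is one. -/
theorem finEntropyAt_const {X : Type*} [MulAction G X] [MeasurableSpace X] (S : MapSequence G)
    (μ : Measure X) [IsProbabilityMeasure μ]
    (F : Finset G) : finEntropyAt S μ (fun _ => ()) F = 0 := by
  have hall : ∀ i (ε : ℝ), 0 < ε → approxPartitions μ (S.σ i) F (fun _ => ()) ε = Set.univ := by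
    intro i ε hε
    refine Set.eq_univ_of_forall fun β => ?_
    rw [mem_approxPartitions]
    have h1 : ∀ φ, law μ (pname F fun _ : X => ()) φ = 1 := by
      intro φ
      have : pname F (fun _ : X => ()) ⁻¹' {φ} = Set.univ := by ext; simp [eq_iff_true_of_subsingleton]
      simp [law, this]
    have h2 : ∀ φ, law (unif (S.m i)) (mname (S.σ i) F β) φ = 1 := by
      intro φ
      have : mname (S.σ i) F β ⁻¹' {φ} = Set.univ := by ext; simp [eq_iff_true_of_subsingleton]
      simp [law, this]
    simp [l1, h1, h2, hε.le]
  have heps : ∀ ε : ℝ, 0 < ε → finEntropyEps S μ (fun _ => ()) F ε = 0 := by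
    intro ε hε
    simp [finEntropyEps, hall _ ε hε]
  refine le_antisymm ((iInf₂_le 1 one_pos).trans (heps 1 one_pos).le) ?_
  exact le_iInf₂ fun ε hε => (heps ε hε).ge

/-- The finite case of the entropy of a Bernoulli shift. -/
theorem finEntropyAt_bernoulli {S : MapSequence G} (hS : S.IsSofic) (κ : Measure K)
    [IsProbabilityMeasure κ] {B : Type*} [Fintype B] {c : K → B}
    (hc : IsMeasurablePartition c) {F : Finset G} (hF : F.Nonempty) :
    finEntropyAt S (bernoulliMeasure G κ) (c ∘ canonicalPartition G K) F =
      (finH (law κ c) : EReal) := by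
  have hcan : IsMeasurablePartition (c ∘ canonicalPartition G K) :=
    isMeasurablePartition_canonical hc
  have hunit : IsMeasurablePartition fun _ : Shift G K => () := fun _ => by simp
  -- The shift is treated as a product whose first coordinate is the trivial partition of entropy
  -- zero.
  have h := finEntropyAt_prod hS (bernoulliMeasure G κ) (bernoulliMeasure G κ) hunit
    (hunit.pair hcan) (law κ c) (law_nonneg κ c) (sum_law κ hc) hF ?_ ?_
  · rw [finEntropyAt_const, zero_add] at h
    rw [← h, ← finEntropyAt_equiv_comp S _ (hunit.pair hcan) (Equiv.punitProd B) hF]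
    rfl
  · ext φ
    have h1 : law (bernoulliMeasure G κ) (pname F fun _ : Shift G K => ())
        (fun f => (φ f).1) = 1 := by
      have : pname F (fun _ : Shift G K => ()) ⁻¹' {fun f => (φ f).1} = Set.univ := by
        ext; simp
      simp [law, this]
    rw [prodLaw, ← law_pname_canonical κ hc F, h1, one_mul, law, law]
    congr 1
    ext z
    simp [pname, funext_iff, Prod.ext_iff]
  · intro x y
    rw [← law_canonical (G := G) κ hc]
    have : law (bernoulliMeasure G κ) (fun _ : Shift G K => ()) x = 1 := by
      have : (fun _ : Shift G K => ()) ⁻¹' {x} = Set.univ := by ext; simp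
      simp [law, this]
    rw [this, one_mul, law, law]
    congr 1
    ext z
    simp

theorem partitionEntropy_congr {X Y ι : Type*} [MeasurableSpace X] [MeasurableSpace Y]
    {μ : Measure X} {ν : Measure Y} {α : X → ι} {β : Y → ι} (h : law μ α = law ν β) :
    partitionEntropy μ α = partitionEntropy ν β := by
  unfold partitionEntropy
  exact tsum_congr fun i => by rw [show μ.real (α ⁻¹' {i}) = ν.real (β ⁻¹' {i}) from congrFun h i]

theorem partitionEntropy_comp_injective {X ι ι' : Type*} [MeasurableSpace X] (μ : Measure X)
    (α : X → ι) {e : ι → ι'} (he : Function.Injective e) :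
    partitionEntropy μ (e ∘ α) = partitionEntropy μ α := by
  unfold partitionEntropy
  rw [← he.tsum_eq]
  · refine tsum_congr fun i => ?_
    have : e ∘ α ⁻¹' {e i} = α ⁻¹' {i} := by ext; simp [he.eq_iff]
    rw [this]
  · intro i' hi'
    by_contra hno
    refine hi' ?_
    have : e ∘ α ⁻¹' {i'} = ∅ := by
      ext x
      simp only [Set.mem_preimage, Function.comp_apply, Set.mem_singleton_iff,
        Set.mem_empty_iff_false, iff_false]
      exact fun h => hno ⟨_, h⟩
    simp [this]

/-- The entropy term of a product atom is `y * negMulLog x + x * negMulLog y`, and both double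
series are products of summable ones. -/
theorem partitionEntropy_prod_lt_top {Y ι ι' : Type*} [MeasurableSpace Y] [Countable ι]
    [Countable ι'] (μ : Measure X) [IsProbabilityMeasure μ] (ν : Measure Y)
    [IsProbabilityMeasure ν] {α : X → ι} {β : Y → ι'} (hα : IsMeasurablePartition α)
    (hβ : IsMeasurablePartition β) (hHα : partitionEntropy μ α < ⊤)
    (hHβ : partitionEntropy ν β < ⊤) :
    partitionEntropy (μ.prod ν) (prodPartition α β) < ⊤ := by
  have h1 := (summable_negMulLog_law μ hHα).mul_of_nonneg (summable_law ν hβ)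
    (negMulLog_law_nonneg μ α) (law_nonneg ν β)
  have h2 := (summable_law μ hα).mul_of_nonneg (summable_negMulLog_law ν hHβ)
    (law_nonneg μ α) (negMulLog_law_nonneg ν β)
  refine lt_of_eq_of_lt ?_ (h1.add h2).tsum_ofReal_lt_top
  unfold partitionEntropy
  refine tsum_congr fun ⟨i, k⟩ => ?_
  have : (μ.prod ν).real (prodPartition α β ⁻¹' {(i, k)}) = law μ α i * law ν β k :=
    law_prod μ ν α β i k
  rw [this, Real.negMulLog_mul]
  congr 1
  ring

theorem IsMeasurablePartition.prodPartition {Y ι ι' : Type*} [MeasurableSpace Y]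
    {α : X → ι} {β : Y → ι'} (hα : IsMeasurablePartition α) (hβ : IsMeasurablePartition β) :
    IsMeasurablePartition (prodPartition α β) :=
  IsMeasurablePartition.pair (g := fun z : X × Y => α z.1) (h := fun z : X × Y => β z.2)
    (fun i => measurable_fst (hα i)) fun i => measurable_snd (hβ i)

/-- Addition on `EReal` is continuous here, even if `L` is infinite, because the second limit is
finite. -/
theorem ereal_tendsto_add_coe {x : ℕ → EReal} {L : EReal} {h : ℕ → ℝ} {H : ℝ}
    (hx : Tendsto x atTop (𝓝 L)) (hh : Tendsto h atTop (𝓝 H)) :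
    Tendsto (fun n => x n + (h n : EReal)) atTop (𝓝 (L + (H : EReal))) :=
  (EReal.continuousAt_add (p := (L, (H : EReal))) (.inr (EReal.coe_ne_bot H))
    (.inr (EReal.coe_ne_top H))).tendsto.comp (hx.prodMk_nhds (EReal.tendsto_coe.2 hh))

/-- The product formula for countable partitions. -/
theorem entropyAt_prod_bernoulli {S : MapSequence G} (hS : S.IsSofic) [Countable K]
    [DiscreteMeasurableSpace K] (κ : Measure K) [IsProbabilityMeasure κ]
    (hκ : partitionEntropy κ (id : K → K) < ⊤) (μ : Measure X) [IsProbabilityMeasure μ]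
    [SMulInvariantMeasure G X μ] {ι : Type*} [Countable ι] {α : X → ι}
    (hα : IsMeasurablePartition α) (hH : partitionEntropy μ α < ⊤) {F : Finset G}
    (hF : F.Nonempty) :
    entropyAt S (μ.prod (bernoulliMeasure G κ)) (prodPartition α (canonicalPartition G K)) F =
      entropyAt S μ α F + (realEntropy κ (id : K → K) : EReal) := by
  have hne : Nonempty X := μ.nonempty_of_neZero
  have hneY : Nonempty (Shift G K) := (bernoulliMeasure G κ).nonempty_of_neZero
  obtain ⟨e₁, he₁⟩ := exists_injective_nat ι
  obtain ⟨e₂, he₂⟩ := exists_injective_nat K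
  have hid : IsMeasurablePartition (id : K → K) := fun _ => MeasurableSet.of_discrete
  have hcan : IsMeasurablePartition (canonicalPartition G K) :=
    isMeasurablePartition_canonical hid
  have hHcan : partitionEntropy (bernoulliMeasure G κ) (canonicalPartition G K) < ⊤ := by
    have := partitionEntropy_congr (law_canonical (G := G) κ hid)
    exact lt_of_eq_of_lt this hκ
  -- Truncating both coordinates separately makes each member of the chain a relabelled product of
  -- finite partitions, to which the finite formula applies.
  set j : ∀ n, ι × K → Fin ((n + 1) * (n + 1)) := fun n p =>
    finProdFinEquiv (trunc n (e₁ p.1), trunc n (e₂ p.2))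
  have hchain : IsChain (μ.prod (bernoulliMeasure G κ))
      (prodPartition α (canonicalPartition G K)) (fun n => (n + 1) * (n + 1))
      fun n => j n ∘ prodPartition α (canonicalPartition G K) := by
    refine isChain_comp (hα.prodPartition hcan)
      (fun n s => finProdFinEquiv (trunc n (finProdFinEquiv.symm s).1,
        trunc n (finProdFinEquiv.symm s).2)) ?_ ?_
    · intro n p
      simp only [j, Equiv.symm_apply_apply]
      rw [← trunc_trunc n.le_succ, ← trunc_trunc n.le_succ]
    · intro p q h
      have h' : ∀ n, (trunc n (e₁ p.1), trunc n (e₂ p.2)) = (trunc n (e₁ q.1), trunc n (e₂ q.2)) :=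
        fun n => finProdFinEquiv.injective (h n)
      exact Prod.ext (he₁ (trunc_injective fun n => (Prod.ext_iff.1 (h' n)).1))
        (he₂ (trunc_injective fun n => (Prod.ext_iff.1 (h' n)).2))
  have hlim := hchain.tendsto_entropyAt S (hα.prodPartition hcan)
    (partitionEntropy_prod_lt_top μ _ hα hcan hH hHcan) hF
  have hlimα := (isChain_trunc (μ := μ) hα he₁).tendsto_entropyAt S hα hH hF
  have hlimκ := (isSeparating_trunc κ (id : K → K) he₂).tendsto_finH hid hκ
  refine tendsto_nhds_unique hlim ((ereal_tendsto_add_coe hlimα hlimκ).congr fun n => ?_)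
  have ha : IsMeasurablePartition ((trunc n ∘ e₁) ∘ α) := hα.comp _
  have hc : IsMeasurablePartition ((trunc n ∘ e₂) ∘ id) := hid.comp _
  rw [← finEntropyAt_prod_bernoulli hS κ μ ha hc hF]
  symm
  refine finEntropyAt_equiv_comp S _ (IsMeasurablePartition.prodPartition ha
    (isMeasurablePartition_canonical hc)) finProdFinEquiv hF

end Bernoulli

/-! ### Generating partitions -/

section Generating

variable {G X ι : Type*} [Group G] [MulAction G X]

/-- The smallest invariant σ-algebra containing the atoms of `α`. -/
abbrev invariantSpace (G : Type*) {X ι : Type*} [Group G] [MulAction G X] (α : X → ι) :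
    MeasurableSpace X :=
  MeasurableSpace.generateFrom {s : Set X | ∃ (g : G) (i : ι), s = g • (α ⁻¹' {i})}

theorem measurableSet_invariantSpace_smul [Countable ι] (α : X → ι) (g : G) (T : Set ι) :
    MeasurableSet[invariantSpace G α] (g • (α ⁻¹' T)) := by
  have : g • (α ⁻¹' T) = ⋃ i ∈ T, g • (α ⁻¹' {i}) := by
    ext x
    simp [Set.mem_smul_set_iff_inv_smul_mem]
  rw [this]
  exact MeasurableSet.biUnion T.to_countable fun i _ =>
    MeasurableSpace.measurableSet_generateFrom ⟨g, i, rfl⟩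

/-- In this form generation need only be checked on σ-algebras whose supremum is the whole one, such
as those pulled back along projections or coordinates. -/
theorem isGenerating_iff [MeasurableSpace X] (μ : Measure X) (α : X → ι) :
    IsGenerating G μ α ↔ (inferInstance : MeasurableSpace X) ≤
      eventuallyMeasurableSpace (invariantSpace G α) (ae μ) := by
  constructor
  · intro h A hA
    obtain ⟨A', hA', h0⟩ := h A hA
    exact ⟨A', hA', measure_symmDiff_eq_zero_iff.1 h0⟩
  · intro h A hA
    obtain ⟨A', hA', h0⟩ := h A hA
    exact ⟨A', hA', measure_symmDiff_eq_zero_iff.2 h0⟩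

/-- A factor map carries the σ-algebra of a generated factor into that of a finer partition. -/
theorem comap_le_of_isGenerating [MeasurableSpace X] {Z ι' : Type*} [MeasurableSpace Z]
    [MulAction G Z] [Countable ι'] {μ : Measure X} {ν : Measure Z} {f : Z → X}
    (hf : Measure.QuasiMeasurePreserving f ν μ) (hfG : ∀ (g : G) z, f (g • z) = g • f z)
    {α : X → ι} (hα : IsGenerating G μ α) {γ : Z → ι'} (r : ι' → ι) (hr : ∀ z, α (f z) = r (γ z)) :
    MeasurableSpace.comap f inferInstance ≤
      eventuallyMeasurableSpace (invariantSpace G γ) (ae ν) := by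
  have hle : MeasurableSpace.comap f (invariantSpace G α) ≤ invariantSpace G γ := by
    rw [invariantSpace, MeasurableSpace.comap_generateFrom]
    refine MeasurableSpace.generateFrom_le ?_
    rintro _ ⟨_, ⟨g, i, rfl⟩, rfl⟩
    convert measurableSet_invariantSpace_smul γ g (r ⁻¹' {i}) using 1
    ext z
    simp [Set.mem_smul_set_iff_inv_smul_mem, ← hfG, hr]
  rintro _ ⟨A, hA, rfl⟩
  obtain ⟨A', hA', h0⟩ := hα A hA
  refine ⟨f ⁻¹' A', hle _ ⟨A', hA', rfl⟩, ?_⟩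
  exact hf.preimage_ae_eq (measure_symmDiff_eq_zero_iff.1 h0)

/-- The product σ-algebra is the supremum of the pull-backs along the two projections, and each
projection is an equivariant factor map. -/
theorem isGenerating_prod [MeasurableSpace X] {Y : Type*} [MeasurableSpace Y]
    [MulAction G Y] {ι' ι'' : Type*} [Countable ι''] {μ : Measure X} [IsProbabilityMeasure μ]
    {ν : Measure Y} [IsProbabilityMeasure ν] {α : X → ι} {β : Y → ι'} (hα : IsGenerating G μ α)
    (hβ : IsGenerating G ν β) {γ : X × Y → ι''} (r : ι'' → ι × ι')
    (hr : ∀ z, (α z.1, β z.2) = r (γ z)) : IsGenerating G (μ.prod ν) γ := by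
  rw [isGenerating_iff]
  refine sup_le ?_ ?_
  · exact comap_le_of_isGenerating Measure.quasiMeasurePreserving_fst (fun _ _ => rfl) hα
      (fun k => (r k).1) fun z => (Prod.ext_iff.1 (hr z)).1
  · exact comap_le_of_isGenerating Measure.quasiMeasurePreserving_snd (fun _ _ => rfl) hβ
      (fun k => (r k).2) fun z => (Prod.ext_iff.1 (hr z)).2

/-- A partition of the base which is full up to null sets generates the Bernoulli shift. -/
theorem isGenerating_canonical {K : Type*} [MeasurableSpace K] (κ : Measure K)
    [IsProbabilityMeasure κ] [Countable ι] {c : K → ι}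
    (hc : ∀ B : Set K, MeasurableSet B → ∃ T : Set ι, B =ᵐ[κ] c ⁻¹' T) :
    IsGenerating G (bernoulliMeasure G κ) (c ∘ canonicalPartition G K) := by
  rw [isGenerating_iff]
  refine iSup_le fun g => ?_
  rintro _ ⟨B, hB, rfl⟩
  obtain ⟨T, hT⟩ := hc B hB
  refine ⟨g • ((c ∘ canonicalPartition G K) ⁻¹' T),
    measurableSet_invariantSpace_smul _ g T, ?_⟩
  have hset : g • ((c ∘ canonicalPartition G K) ⁻¹' T) =
      (fun y : Shift G K => y g) ⁻¹' (c ⁻¹' T) := by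
    ext y
    simp [Set.mem_smul_set_iff_inv_smul_mem, canonicalPartition_inv_smul]
  rw [hset]
  exact (measurePreserving_eval_shift κ g).quasiMeasurePreserving.preimage_ae_eq hT

theorem IsChain.comp_injective [MeasurableSpace X] {μ : Measure X} {ι' : Type*} {u : ℕ → ℕ}
    {α : X → ι} {a : ∀ n, X → Fin (u n)} (ha : IsChain μ α u a) [Nonempty X] {e : ι → ι'}
    (he : Function.Injective e) : IsChain μ (e ∘ α) u a where
  measurable := ha.measurable
  mono := ha.mono
  le n i' := by
    by_cases h : ∃ i, e i = i'
    · obtain ⟨i, rfl⟩ := h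
      obtain ⟨k, hk⟩ := ha.le n i
      refine ⟨k, ?_⟩
      have : e ∘ α ⁻¹' {e i} = α ⁻¹' {i} := by ext; simp [he.eq_iff]
      rwa [this]
    · refine ⟨a n (Classical.arbitrary X), ?_⟩
      have : e ∘ α ⁻¹' {i'} = ∅ := by
        ext x
        simp only [Set.mem_preimage, Function.comp_apply, Set.mem_singleton_iff,
          Set.mem_empty_iff_false, iff_false]
        exact fun h' => h ⟨_, h'⟩
      simp [this]
  join z := by
    obtain ⟨k, hk⟩ := ha.join z
    refine ⟨e k, ?_⟩
    have : e ∘ α ⁻¹' {e k} = α ⁻¹' {k} := by ext; simp [he.eq_iff]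
    rwa [this]

/-- A chain for `α` is also one for its relabelling, and the limit along any chain is the entropy.
-/
theorem entropyAt_comp_injective [MeasurableSpace X] [MeasurableConstSMul G X] {ι' : Type*}
    [Countable ι] [Countable ι'] (S : MapSequence G) {μ : Measure X} [IsProbabilityMeasure μ]
    [SMulInvariantMeasure G X μ] {α : X → ι} (hα : IsMeasurablePartition α)
    (hH : partitionEntropy μ α < ⊤) {e : ι → ι'} (he : Function.Injective e) {F : Finset G}
    (hF : F.Nonempty) : entropyAt S μ (e ∘ α) F = entropyAt S μ α F := by
  have hne : Nonempty X := μ.nonempty_of_neZero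
  obtain ⟨e', he'⟩ := exists_injective_nat ι
  have hchain := isChain_trunc (μ := μ) hα he'
  exact tendsto_nhds_unique
    ((hchain.comp_injective he).tendsto_entropyAt S (hα.comp e)
      ((partitionEntropy_comp_injective μ α he).trans_lt hH) hF)
    (hchain.tendsto_entropyAt S hα hH hF)

end Generating

/-! ### The entropy of the base -/

section Base

variable {K : Type*} [MeasurableSpace K]

theorem baseEntropy_eq_partitionEntropy_id [Countable K] (κ : Measure K)
    [IsProbabilityMeasure κ] : baseEntropy κ = partitionEntropy κ (id : K → K) := by
  rw [baseEntropy, if_pos ⟨Set.univ, Set.countable_univ, measure_univ⟩]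
  rfl

theorem coe_partitionEntropy {X ι : Type*} [MeasurableSpace X] (μ : Measure X)
    [IsProbabilityMeasure μ] {α : X → ι} (hH : partitionEntropy μ α < ⊤) :
    (partitionEntropy μ α : EReal) = (realEntropy μ α : EReal) := by
  rw [partitionEntropy_eq_ofReal μ hH, EReal.coe_ennreal_ofReal,
    max_eq_left (realEntropy_nonneg μ α)]

/-- A base measure of finite entropy has a countable measurable partition into its atoms, up to a
null set. -/
theorem exists_base_partition [MeasurableSingletonClass K] (κ : Measure K)
    [IsProbabilityMeasure κ] (hκ : baseEntropy κ < ⊤) :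
    ∃ c : K → ℕ, IsMeasurablePartition c ∧ partitionEntropy κ c = baseEntropy κ ∧
      ∀ B : Set K, MeasurableSet B → ∃ T : Set ℕ, B =ᵐ[κ] c ⁻¹' T := by
  have hex : ∃ K' : Set K, K'.Countable ∧ κ K' = 1 := by
    by_contra hno
    rw [baseEntropy, if_neg hno] at hκ
    exact lt_irrefl _ hκ
  obtain ⟨K', hK', h1⟩ := hex
  obtain ⟨f, hf⟩ := Set.countable_iff_exists_injOn.1 hK'
  have hnull : κ K'ᶜ = 0 := (prob_compl_eq_zero_iff hK'.measurableSet).2 h1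
  -- The shift by one reserves the label `0` for the null complement of `K'`.
  set c : K → ℕ := fun k => if k ∈ K' then f k + 1 else 0
  have hcin : ∀ k ∈ K', c k = f k + 1 := fun k hk => if_pos hk
  have hcout : ∀ k ∉ K', c k = 0 := fun k hk => if_neg hk
  have hpre : ∀ T : Set ℕ, 0 ∉ T → c ⁻¹' T ⊆ K' := by
    intro T hT k hk
    by_contra hkK
    rw [Set.mem_preimage, hcout k hkK] at hk
    exact hT hk
  have hatom : ∀ k ∈ K', c ⁻¹' {c k} = {k} := by
    intro k hk
    ext k'
    simp only [Set.mem_preimage, Set.mem_singleton_iff]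
    constructor
    · intro h
      have hk' : k' ∈ K' := hpre {c k} (by rw [hcin k hk]; simp) h
      rw [hcin k hk, hcin k' hk'] at h
      exact hf hk' hk (Nat.succ_injective h)
    · rintro rfl
      rfl
  refine ⟨c, ?_, ?_, ?_⟩
  · intro n
    by_cases hn : n = 0
    · subst hn
      have : c ⁻¹' {0} = K'ᶜ := by
        ext k
        by_cases hk : k ∈ K'
        · simp [hcin k hk, hk]
        · simp [hcout k hk, hk]
      rw [this]
      exact hK'.measurableSet.compl
    · exact (hK'.mono (hpre {n} (by simpa using Ne.symm hn))).measurableSet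
  · rw [baseEntropy, if_pos ⟨K', hK', h1⟩, partitionEntropy]
    have hinj : Function.Injective fun k : K' => c k := by
      intro k k' h
      have h' : (k : K) ∈ c ⁻¹' {c k'} := h
      rw [hatom _ k'.2] at h'
      exact Subtype.ext h'
    rw [← hinj.tsum_eq, ← tsum_subtype_eq_of_support_subset (s := K')]
    · exact tsum_congr fun k => by rw [hatom _ k.2]
    · intro k hk
      by_contra hkK
      have : κ {k} = 0 := measure_mono_null (Set.singleton_subset_iff.2 hkK) hnull
      exact hk (by simp [measureReal_def, this])
    · intro n hn
      by_contra hno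
      have hsub : c ⁻¹' {n} ⊆ K'ᶜ := by
        intro k hk hkK
        exact hno ⟨⟨k, hkK⟩, hk⟩
      exact hn (by simp [measureReal_def, measure_mono_null hsub hnull])
  · intro B _
    refine ⟨c '' (B ∩ K'), ?_⟩
    have hset : c ⁻¹' (c '' (B ∩ K')) = B ∩ K' := by
      refine Set.Subset.antisymm ?_ (Set.subset_preimage_image _ _)
      rintro k ⟨k', hk', h⟩
      have : k ∈ c ⁻¹' {c k'} := h.symm
      rw [hatom k' hk'.2] at this
      rwa [Set.mem_singleton_iff.1 this]
    rw [hset]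
    have : K' =ᵐ[κ] Set.univ := ae_eq_univ.2 hnull
    simpa using ((ae_eq_refl B).inter this).symm

end Base

/-! ### Entropy of systems: infimum over windows and the theorem -/

section Final

variable {G : Type*} [Group G]

theorem iInf_entropyAt_add {X ι ι' Z : Type*} [MulAction G X] [MeasurableSpace X]
    [MulAction G Z] [MeasurableSpace Z]
    {S : MapSequence G} {μ : Measure X} {ν : Measure Z} {α : X → ι} {γ : Z → ι'} {H : ℝ}
    (h : ∀ F : Finset G, F.Nonempty → entropyAt S ν γ F = entropyAt S μ α F + (H : EReal)) :
    (⨅ F : {F : Finset G // F.Nonempty}, entropyAt S ν γ F) =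
      (⨅ F : {F : Finset G // F.Nonempty}, entropyAt S μ α F) + (H : EReal) := by
  refine le_antisymm ?_ ?_
  · exact ereal_le_iInf_add fun F => (iInf_le _ F).trans (h F F.2).le
  · refine le_iInf fun F => ?_
    rw [h F F.2]
    gcongr
    exact iInf_le _ F

/-- The product of a system with a finite-entropy generator and a Bernoulli shift. -/
theorem hasSoficEntropy_prod {S : MapSequence G} (hS : S.IsSofic) {K : Type*} [Countable K]
    [MeasurableSpace K] [DiscreteMeasurableSpace K] (κ : Measure K) [IsProbabilityMeasure κ]
    (hκ : baseEntropy κ < ⊤) {X : Type*} [MeasurableSpace X] [MulAction G X]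
    [MeasurableConstSMul G X] (μ : Measure X) [IsProbabilityMeasure μ] [SMulInvariantMeasure G X μ]
    {α : X → ℕ} (hα : IsFiniteEntropyGenerator G μ α) :
    HasSoficEntropy S (μ.prod (bernoulliMeasure G κ))
      (meanEntropy S μ α + (baseEntropy κ : EReal)) := by
  obtain ⟨hαm, hαH, hαg⟩ := hα
  rw [baseEntropy_eq_partitionEntropy_id] at hκ ⊢
  obtain ⟨e, he⟩ := exists_injective_nat K
  have hne : Nonempty K := κ.nonempty_of_neZero
  have hid : IsMeasurablePartition (id : K → K) := fun _ => MeasurableSet.of_discrete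
  have hcan : IsMeasurablePartition (canonicalPartition G K) :=
    isMeasurablePartition_canonical hid
  have hHcan : partitionEntropy (bernoulliMeasure G κ) (canonicalPartition G K) < ⊤ :=
    (partitionEntropy_congr (law_canonical (G := G) κ hid)).trans_lt hκ
  have hHprod := partitionEntropy_prod_lt_top μ (bernoulliMeasure G κ) hαm hcan hαH hHcan
  have hmprod := hαm.prodPartition hcan
  -- Generators carry labels in `ℕ`, so the product partition is recoded injectively; this changes
  -- neither its entropy nor its atoms, apart from empty ones.
  set p : ℕ × K → ℕ := fun q => Nat.pair q.1 (e q.2)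
  have hp : Function.Injective p := by
    rintro ⟨a, k⟩ ⟨a', k'⟩ h
    obtain ⟨h1, h2⟩ := Nat.pair_eq_pair.1 h
    exact Prod.ext h1 (he h2)
  have hcang : IsGenerating G (bernoulliMeasure G κ) (canonicalPartition G K) :=
    isGenerating_canonical (c := id) κ fun B _ => ⟨B, ae_eq_refl _⟩
  have hgen : IsFiniteEntropyGenerator G (μ.prod (bernoulliMeasure G κ))
      (p ∘ prodPartition α (canonicalPartition G K)) := by
    refine ⟨hmprod.comp p, (partitionEntropy_comp_injective _ _ hp).trans_lt hHprod, ?_⟩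
    exact isGenerating_prod hαg hcang (Function.invFun p)
      fun z => (Function.leftInverse_invFun hp _).symm
  have hmean : meanEntropy S (μ.prod (bernoulliMeasure G κ))
      (p ∘ prodPartition α (canonicalPartition G K)) =
        meanEntropy S μ α + (partitionEntropy κ (id : K → K) : EReal) := by
    rw [meanEntropy_eq S hgen.1 hgen.2.1, meanEntropy_eq S hαm hαH, coe_partitionEntropy κ hκ]
    refine iInf_entropyAt_add fun F hF => ?_
    rw [entropyAt_comp_injective S hmprod hHprod hp hF,
      entropyAt_prod_bernoulli hS κ hκ μ hαm hαH hF]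
  rw [← hmean]
  exact hgen.hasSoficEntropy hS

/-- The base is replaced by a countable partition into its atoms, full up to null sets. For each
nonempty `F`, the finite formula along truncations already gives the base entropy, so the infimum is
over a constant. -/
theorem hasSoficEntropy_bernoulli {S : MapSequence G} (hS : S.IsSofic) {K : Type*}
    [MeasurableSpace K] [MeasurableSingletonClass K] (κ : Measure K) [IsProbabilityMeasure κ]
    (hκ : baseEntropy κ < ⊤) :
    HasSoficEntropy S (bernoulliMeasure G κ) (baseEntropy κ : EReal) := by
  obtain ⟨c, hc, hcH, hcg⟩ := exists_base_partition κ hκ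
  have hne : Nonempty (Shift G K) := (bernoulliMeasure G κ).nonempty_of_neZero
  rw [← hcH] at hκ ⊢
  have hm : IsMeasurablePartition (c ∘ canonicalPartition G K) :=
    isMeasurablePartition_canonical hc
  have hH : partitionEntropy (bernoulliMeasure G κ) (c ∘ canonicalPartition G K) < ⊤ :=
    (partitionEntropy_congr (law_canonical (G := G) κ hc)).trans_lt hκ
  have hgen : IsFiniteEntropyGenerator G (bernoulliMeasure G κ) (c ∘ canonicalPartition G K) :=
    ⟨hm, hH, isGenerating_canonical κ hcg⟩
  have hmean : meanEntropy S (bernoulliMeasure G κ) (c ∘ canonicalPartition G K) =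
      (partitionEntropy κ c : EReal) := by
    rw [meanEntropy_eq S hm hH, coe_partitionEntropy κ hκ]
    have hF : ∀ F : {F : Finset G // F.Nonempty},
        entropyAt S (bernoulliMeasure G κ) (c ∘ canonicalPartition G K) F =
          (realEntropy κ c : EReal) := by
      rintro ⟨F, hF⟩
      refine tendsto_nhds_unique
        ((isChain_trunc hm Function.injective_id).tendsto_entropyAt S hm hH hF) ?_
      refine (EReal.tendsto_coe.2
        ((isSeparating_trunc κ c Function.injective_id).tendsto_finH hc hκ)).congr fun n => ?_
      exact (finEntropyAt_bernoulli hS κ (hc.comp (trunc n ∘ id)) hF).symm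
    have : Nonempty {F : Finset G // F.Nonempty} := ⟨⟨{1}, by simp⟩⟩
    simp only [hF, ciInf_const]
  rw [← hmean]
  exact hgen.hasSoficEntropy hS

end Final

end SoficEntropy

end

theorem mainTheorem2 {G : Type*} [Group G] [Countable G]
    (S : MapSequence G) (hS : S.IsSofic) :
    (∀ (K : Type*) [Countable K] [MeasurableSpace K] [DiscreteMeasurableSpace K]
        (κ : Measure K) [IsProbabilityMeasure κ], baseEntropy κ < ⊤ →
      ∀ (X : Type*) [MeasurableSpace X] [MulAction G X] [MeasurableConstSMul G X]
        (μ : Measure X) [IsProbabilityMeasure μ] [SMulInvariantMeasure G X μ],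
        (∀ (ι : Type*) [Countable ι] (α : X → ι), IsMeasurablePartition α →
          partitionEntropy μ α < ⊤ → ∀ F : Finset G, F.Nonempty →
            entropyAt S (μ.prod (bernoulliMeasure G κ)) (prodPartition α (canonicalPartition G K)) F
                = entropyAt S μ α F + (baseEntropy κ : EReal) ∧
            (Finite ι → Finite K →
              finEntropyAt S (μ.prod (bernoulliMeasure G κ)) (prodPartition α (canonicalPartition G K)) F
                = finEntropyAt S μ α F + (baseEntropy κ : EReal))) ∧
        ((∃ α : X → ℕ, IsFiniteEntropyGenerator G μ α) →
          ∃ c : EReal, HasSoficEntropy S μ c ∧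
            HasSoficEntropy S (μ.prod (bernoulliMeasure G κ)) (c + (baseEntropy κ : EReal)))) ∧
    (∀ (K : Type*) [MeasurableSpace K] [StandardBorelSpace K]
        (κ : Measure K) [IsProbabilityMeasure κ], baseEntropy κ < ⊤ →
      HasSoficEntropy S (bernoulliMeasure G κ) (baseEntropy κ : EReal)) := by
  refine ⟨?_, fun K _ _ κ _ hκ => hasSoficEntropy_bernoulli hS κ hκ⟩
  intro K _ _ _ κ _ hκ X _ _ _ μ _ _
  refine ⟨?_, ?_⟩
  · intro ι _ α hα hH F hF
    have hκ' := hκ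
    rw [baseEntropy_eq_partitionEntropy_id] at hκ'
    rw [baseEntropy_eq_partitionEntropy_id, coe_partitionEntropy κ hκ']
    refine ⟨entropyAt_prod_bernoulli hS κ hκ' μ hα hH hF, fun hι hK => ?_⟩
    have := Fintype.ofFinite ι
    have := Fintype.ofFinite K
    have hid : IsMeasurablePartition (id : K → K) := fun _ => MeasurableSet.of_discrete
    have h := finEntropyAt_prod_bernoulli hS κ μ hα hid hF
    -- For finite `K` the series defining the base entropy is the finite sum in the direct formula.
    rw [realEntropy, tsum_fintype]
    exact h
  · rintro ⟨α, hα⟩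
    exact ⟨meanEntropy S μ α, hα.hasSoficEntropy hS, hasSoficEntropy_prod hS κ hκ μ hα⟩
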